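/- Let $k$ be a field, $B$ a Hopf algebra over $k$ with bijective antipode $S$, and let $\mathcal D={}^B_B\mathcal{YD}$ be the category of left-left Yetter–Drinfeld modules over $B$: an object is a $B$-module and $B$-comodule $V$ (coaction $v\mapsto v_{(-1)}\otimes v_{(0)}$) such that the coaction of $b\cdot v$ is $\sum b_1v_{(-1)}S(b_3)\otimes b_2\cdot v_{(0)}$; morphisms are the $B$-linear $B$-colinear maps; tensor products carry the diagonal action and the codiagonal coaction; the braiding is $C_{V,W}(v\otimes w)=\sum v_{(-1)}\cdot w\otimes v_{(0)}$. For algebras $A,A'$ in $\mathcal D$, $A\otimes A'$ denotes the braided tensor product algebra, with multiplication $(m_A\otimes m_{A'})(\mathrm{id}\otimes C_{A',A}\otimes \mathrm{id})$. For a braided Hopf algebra $L$ and an algebra $A$ in $\mathcal D$ with an action $\alpha:L\otimes A\to A$, the smash product $A\#L$ is $A\otimes L$ with unit $1\otimes 1$ and $$(a\#l)(a'\#l')=\sum a\,\alpha\big(l_1\otimes (l_2)_{(-1)}\cdot a'\big)\#(l_2)_{(0)}\,l'.$$ Let $H$ be a braided Hopf algebra (a Hopf algebra in $\mathcal D$)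 with invertible antipode. Let $$H^\circ_{\mathcal D}=\{f\in H^*: \ker f\text{ contains a two-sided ideal of } H \text{ of finite codimension that is a } B\text{-submodule and a } B\text{-subcomodule}\},$$ with the structure given by $\langle b\cdot f,x\rangle=\langle f,S(b)\cdot x\rangle$, $\sum f_{(-1)}\langle f_{(0)},x\rangle=\sum\langle f,x_{(0)}\rangle S^{-1}(x_{(-1)})$ for $b\in B$, $x\in H$, by $$\langle fg,x\rangle=\langle f\otimes g,\Delta x\rangle_2,\qquad \langle\Delta f,x\otimes y\rangle_2=\langle f,xy\rangle,\qquad \langle f\otimes g,x\otimes y\rangle_2=\sum\langle f,g_{(-1)}\cdot x\rangle\langle g_{(0)},y\rangle,$$ and by $1=\varepsilon_H$, $\varepsilon(f)=f(1)$, $S(f)=f\circ S_H$. Assume that the braiding of $\mathcal D$ is symmetric on $H$ and $H^\circ_{\mathcal D}$, i.e. $C_{Y,X}C_{X,Y}=\mathrm{id}$ for $X,Y\in\{H,H^\circ_{\mathcal D}\}$. Let $U$ be a braided Hopf subalgebra of $H^\circ_{\mathcal D}$, that is, a subspace closed under the action, the coaction, the multiplication, the unit, the comultiplication and the antipode. Let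 $U$ act on $H$ by $f\rightharpoonup x=\sum (f_{(-1)}\cdot x_1)\langle f_{(0)},x_2\rangle$, and form $H\#U$. Let $R$ be a right $U$-comodule algebra in $\mathcal D$, with coaction $\psi:R\to R\otimes U$ (a coassociative and counital morphism of algebras in $\mathcal D$). Let $H$ act on $R$ through the composite $$H\otimes R\xrightarrow{\mathrm{id}\otimes\psi}H\otimes R\otimes U\xrightarrow{C_{H,R}\otimes \mathrm{id}}R\otimes H\otimes U\xrightarrow{\mathrm{id}\otimes C_{H,U}}R\otimes U\otimes H\xrightarrow{\mathrm{id}\otimes\langle,\rangle}R,$$ and let $U$ act on $R\#H$ trivially on $R$ and via $\rightharpoonup$ on $H$, i.e. $f\cdot(r\#h)=\sum f_{(-1)}\cdot r\#(f_{(0)}\rightharpoonup h)$. Define $\lambda:H\#U\to\operatorname{End}H$ and $\rho:U\#H\to\operatorname{End}H$ by $\lambda(h\#f)(x)=h(f\rightharpoonup x)$ and by letting $\rho(f\#h)(x)$ be the image of $f\otimes h\otimes x$ under $$U\otimes H\otimes H\xrightarrow{\mathrm{id}\otimes \mathrm{id}\otimes\Delta}U\otimes H\otimes H\otimes H\xrightarrow{\mathrm{id}\otimes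 C_{H,H}\otimes \mathrm{id}}U\otimes H\otimes H\otimes H\xrightarrow{\langle,\rangle\otimes C_{H,H}}H\otimes H\xrightarrow{m}H,$$ so that $\rho(f\#1)(x)=\sum\langle f,x_1\rangle x_2$. One says that $U$ satisfies the $RL$-condition with respect to $H$ if $\rho(U\#1)\subseteq\lambda(H\#U)$, and that $H$ is quantum cocommutative if $C_{H,H}\Delta_H=\Delta_H$. **Theorem 3.6 (Duality Theorem).** (i) If $U$ satisfies the $RL$-condition with respect to $H$, then $(R\#H)\#U$ and $R\otimes(H\#U)$ are algebras in $\mathcal D$, and $(R\#H)\#U\cong R\otimes(H\#U)$ as algebras in $\mathcal D$. (ii) If $H$ is quantum cocommutative, then the same conclusion holds. -/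

import Mathlib

open scoped TensorProduct

namespace BraidedDuality

noncomputable section

open TensorProduct

/-- A linear left inverse of the linear map `f` (zero if there is none). Over a field every
injective `f` has one, see `leftInv_apply`. -/
def leftInv {k V W : Type*} [Field k] [AddCommMonoid V] [Module k V] [AddCommMonoid W] [Module k W]
    (f : V →ₗ[k] W) : W →ₗ[k] V :=
  open Classical in if h : ∃ g : W →ₗ[k] V, g ∘ₗ f = LinearMap.id then h.choose else 0

lemma leftInv_apply {k V W : Type*} [Field k] [AddCommMonoid V] [Module k V] [AddCommGroup W]
    [Module k W] {f : V →ₗ[k] W} (hf : Function.Injective f) (v : V) : leftInv f (f v) = v := by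
  have h : ∃ g : W →ₗ[k] V, g ∘ₗ f = LinearMap.id := by
    let : AddCommGroup V := Module.addCommMonoidToAddCommGroup k
    exact LinearMap.exists_leftInverse_of_injective f (LinearMap.ker_eq_bot.2 hf)
  unfold leftInv
  rw [dif_pos h]
  exact LinearMap.congr_fun h.choose_spec v

/-! ### Yetter-Drinfeld modules, morphisms, tensor products and the braiding -/

section YetterDrinfeld

variable {k B V W P Q : Type*} [Field k] [Ring B] [HopfAlgebra k B]
  [AddCommMonoid V] [Module k V] [AddCommMonoid W] [Module k W]
  [AddCommMonoid P] [Module k P] [AddCommMonoid Q] [Module k Q]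

/-- A linear map `B ⊗ V → V` and a linear map `V → B ⊗ V`, no axioms imposed
(the axioms are in `Ops.IsYD`). -/
structure Ops (k B V : Type*) [Field k] [Ring B] [HopfAlgebra k B]
    [AddCommMonoid V] [Module k V] where
  /-- the action `b ⊗ v ↦ b · v` -/
  act : B ⊗[k] V →ₗ[k] V
  /-- the coaction `v ↦ v₍₋₁₎ ⊗ v₍₀₎` -/
  coact : V →ₗ[k] B ⊗[k] V

/-- `b ⊗ v ↦ b₁ v₍₋₁₎ ⊗ b₂ · v₍₀₎`. -/
def Ops.diag (X : Ops k B V) : B ⊗[k] V →ₗ[k] B ⊗[k] V :=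
  map (LinearMap.mul' k B) X.act ∘ₗ
    (tensorTensorTensorComm k B B B V).toLinearMap ∘ₗ
    map (Coalgebra.comul (R := k) (A := B)) X.coact

/-- `b ⊗ v ↦ b₁ v₍₋₁₎ S(b₃) ⊗ b₂ · v₍₀₎`. -/
def Ops.ydMap (X : Ops k B V) : B ⊗[k] V →ₗ[k] B ⊗[k] V :=
  (LinearMap.mul' k B).rTensor V ∘ₗ
    (TensorProduct.rightComm k B V B).toLinearMap ∘ₗ
    map X.diag (HopfAlgebra.antipode k (A := B)) ∘ₗ
    (TensorProduct.rightComm k B B V).toLinearMap ∘ₗ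
    (Coalgebra.comul (R := k) (A := B)).rTensor V

/-- Left-left Yetter-Drinfeld modules over the Hopf algebra `B`. -/
structure Ops.IsYD (X : Ops k B V) : Prop where
  one_act : ∀ v, X.act (1 ⊗ₜ v) = v
  mul_act : ∀ a b v, X.act ((a * b) ⊗ₜ v) = X.act (a ⊗ₜ X.act (b ⊗ₜ v))
  counit_coact : ∀ v,
    TensorProduct.lid k V ((Coalgebra.counit (R := k) (A := B)).rTensor V (X.coact v)) = v
  coassoc : ∀ v, TensorProduct.assoc k B B V
      ((Coalgebra.comul (R := k) (A := B)).rTensor V (X.coact v)) =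
    X.coact.lTensor B (X.coact v)
  compat : X.coact ∘ₗ X.act = X.ydMap

/-- The morphisms of the Yetter-Drinfeld category: `B`-linear and `B`-colinear maps. -/
structure IsHom (X : Ops k B V) (Y : Ops k B W) (f : V →ₗ[k] W) : Prop where
  map_act : f ∘ₗ X.act = Y.act ∘ₗ f.lTensor B
  map_coact : Y.coact ∘ₗ f = f.lTensor B ∘ₗ X.coact

/-- The unit object `k` with trivial action and coaction. -/
def unitOps (k B : Type*) [Field k] [Ring B] [HopfAlgebra k B] : Ops k B k where
  act := (TensorProduct.lid k k).toLinearMap ∘ₗ (Coalgebra.counit (R := k) (A := B)).rTensor k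
  coact := TensorProduct.mk k B k 1

/-- The tensor product: diagonal action and codiagonal coaction. -/
def Ops.tensor (X : Ops k B V) (Y : Ops k B W) : Ops k B (V ⊗[k] W) where
  act := map X.act Y.act ∘ₗ (tensorTensorTensorComm k B B V W).toLinearMap ∘ₗ
    (Coalgebra.comul (R := k) (A := B)).rTensor (V ⊗[k] W)
  coact := (LinearMap.mul' k B).rTensor (V ⊗[k] W) ∘ₗ
    (tensorTensorTensorComm k B V B W).toLinearMap ∘ₗ map X.coact Y.coact

/-- The braiding `C : V ⊗ W → W ⊗ V`, `v ⊗ w ↦ v₍₋₁₎ · w ⊗ v₍₀₎`. -/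
def braiding (X : Ops k B V) (Y : Ops k B W) : V ⊗[k] W →ₗ[k] W ⊗[k] V :=
  Y.act.rTensor V ∘ₗ (TensorProduct.rightComm k B V W).toLinearMap ∘ₗ X.coact.rTensor W

/-- The braiding is symmetric on the pair `V, W`: `C_{W,V} C_{V,W} = id`. -/
def IsSymmetricPair (X : Ops k B V) (Y : Ops k B W) : Prop :=
  braiding Y X ∘ₗ braiding X Y = LinearMap.id

/-- Apply `c` to the two inner factors of a fourfold tensor product. -/
def middle (c : W ⊗[k] P →ₗ[k] P ⊗[k] W) :
    (V ⊗[k] W) ⊗[k] (P ⊗[k] Q) →ₗ[k] (V ⊗[k] P) ⊗[k] (W ⊗[k] Q) :=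
  (TensorProduct.assoc k V P (W ⊗[k] Q)).symm.toLinearMap ∘ₗ
    ((TensorProduct.assoc k P W Q).toLinearMap ∘ₗ c.rTensor Q ∘ₗ
      (TensorProduct.assoc k W P Q).symm.toLinearMap).lTensor V ∘ₗ
    (TensorProduct.assoc k V W (P ⊗[k] Q)).toLinearMap

end YetterDrinfeld

/-! ### Algebras and Hopf algebras in the Yetter-Drinfeld category -/

section Algebras

variable {k B V W : Type*} [Field k] [Ring B] [HopfAlgebra k B]
  [AddCommMonoid V] [Module k V] [AddCommMonoid W] [Module k W]

/-- The operations of an algebra in the Yetter-Drinfeld category (axioms in `AlgOps.IsAlg`). -/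
structure AlgOps (k B V : Type*) [Field k] [Ring B] [HopfAlgebra k B]
    [AddCommMonoid V] [Module k V] extends Ops k B V where
  mul : V ⊗[k] V →ₗ[k] V
  one : V

/-- Algebras in the Yetter-Drinfeld category. -/
structure AlgOps.IsAlg (X : AlgOps k B V) : Prop where
  isYD : X.toOps.IsYD
  mul_assoc : ∀ x y z, X.mul (X.mul (x ⊗ₜ y) ⊗ₜ z) = X.mul (x ⊗ₜ X.mul (y ⊗ₜ z))
  one_mul : ∀ x, X.mul (X.one ⊗ₜ x) = x
  mul_one : ∀ x, X.mul (x ⊗ₜ X.one) = x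
  mul_isHom : IsHom (X.toOps.tensor X.toOps) X.toOps X.mul
  one_isHom : IsHom (unitOps k B) X.toOps (LinearMap.toSpanSingleton k V X.one)

/-- The space `V ⊗ W` with unit `1 ⊗ 1` and the multiplication
`(m_V ⊗ m_W) (id ⊗ τ ⊗ id)` twisted by `τ : W ⊗ V → V ⊗ W`. -/
def AlgOps.twisted (X : AlgOps k B V) (Y : AlgOps k B W)
    (τ : W ⊗[k] V →ₗ[k] V ⊗[k] W) : AlgOps k B (V ⊗[k] W) where
  toOps := X.toOps.tensor Y.toOps
  mul := map X.mul Y.mul ∘ₗ middle τ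
  one := X.one ⊗ₜ Y.one

/-- The braided tensor product of algebras, `τ = C_{W,V}`. -/
def AlgOps.tensorAlg (X : AlgOps k B V) (Y : AlgOps k B W) : AlgOps k B (V ⊗[k] W) :=
  X.twisted Y (braiding Y.toOps X.toOps)

/-- The two objects are algebras in the Yetter-Drinfeld category and they are isomorphic as such. -/
def AlgOps.Isomorphic (X : AlgOps k B V) (Y : AlgOps k B W) : Prop :=
  X.IsAlg ∧ Y.IsAlg ∧ ∃ e : V ≃ₗ[k] W, IsHom X.toOps Y.toOps e.toLinearMap ∧
    (∀ x y, e (X.mul (x ⊗ₜ y)) = Y.mul (e x ⊗ₜ e y)) ∧ e X.one = Y.one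

/-- The operations of a braided Hopf algebra (axioms in `HopfOps.IsHopf`). -/
structure HopfOps (k B V : Type*) [Field k] [Ring B] [HopfAlgebra k B]
    [AddCommMonoid V] [Module k V] extends AlgOps k B V where
  comul : V →ₗ[k] V ⊗[k] V
  counit : V →ₗ[k] k
  antipode : V →ₗ[k] V

/-- Hopf algebras in the Yetter-Drinfeld category (braided Hopf algebras). -/
structure HopfOps.IsHopf (X : HopfOps k B V) : Prop where
  isAlg : X.toAlgOps.IsAlg
  coassoc : ∀ x, TensorProduct.assoc k V V V (X.comul.rTensor V (X.comul x)) =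
    X.comul.lTensor V (X.comul x)
  counit_left : ∀ x, TensorProduct.lid k V (X.counit.rTensor V (X.comul x)) = x
  counit_right : ∀ x, TensorProduct.rid k V (X.counit.lTensor V (X.comul x)) = x
  comul_isHom : IsHom X.toOps (X.toOps.tensor X.toOps) X.comul
  counit_isHom : IsHom X.toOps (unitOps k B) X.counit
  comul_mul : ∀ x y, X.comul (X.mul (x ⊗ₜ y)) =
    (X.toAlgOps.tensorAlg X.toAlgOps).mul (X.comul x ⊗ₜ X.comul y)
  comul_one : X.comul X.one = X.one ⊗ₜ X.one
  counit_mul : ∀ x y, X.counit (X.mul (x ⊗ₜ y)) = X.counit x * X.counit y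
  counit_one : X.counit X.one = 1
  antipode_left : ∀ x, X.mul (X.antipode.rTensor V (X.comul x)) = X.counit x • X.one
  antipode_right : ∀ x, X.mul (X.antipode.lTensor V (X.comul x)) = X.counit x • X.one
  antipode_isHom : IsHom X.toOps X.toOps X.antipode

/-- Quantum cocommutativity: `C Δ = Δ`. -/
def HopfOps.QuantumCocommutative (X : HopfOps k B V) : Prop :=
  braiding X.toOps X.toOps ∘ₗ X.comul = X.comul

/-- For `α : L ⊗ A → A`, the map `l ⊗ a ↦ α(l₁ ⊗ (l₂)₍₋₁₎ · a) ⊗ (l₂)₍₀₎`. -/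
def smashTwist (A : AlgOps k B V) (L : HopfOps k B W) (α : W ⊗[k] V →ₗ[k] V) :
    W ⊗[k] V →ₗ[k] V ⊗[k] W :=
  α.rTensor W ∘ₗ (TensorProduct.assoc k W V W).symm.toLinearMap ∘ₗ
    (braiding L.toOps A.toOps).lTensor W ∘ₗ
    (TensorProduct.assoc k W W V).toLinearMap ∘ₗ L.comul.rTensor V

/-- The smash product `A # L` with respect to `α : L ⊗ A → A`:
`(a # l)(a' # l') = a α(l₁ ⊗ (l₂)₍₋₁₎ · a') # (l₂)₍₀₎ l'`. -/
def smash (A : AlgOps k B V) (L : HopfOps k B W) (α : W ⊗[k] V →ₗ[k] V) :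
    AlgOps k B (V ⊗[k] W) :=
  A.twisted L.toAlgOps (smashTwist A L α)

/-- `ψ : R → R ⊗ L` makes the algebra `R` a right `L`-comodule algebra in the
Yetter-Drinfeld category. -/
structure IsComoduleAlgebra (R : AlgOps k B V) (L : HopfOps k B W)
    (ψ : V →ₗ[k] V ⊗[k] W) : Prop where
  isHom : IsHom R.toOps (R.toOps.tensor L.toOps) ψ
  coassoc : ∀ r, TensorProduct.assoc k V W W (ψ.rTensor W (ψ r)) = L.comul.lTensor V (ψ r)
  counit : ∀ r, TensorProduct.rid k V (L.counit.lTensor V (ψ r)) = r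
  map_mul : ∀ r s, ψ (R.mul (r ⊗ₜ s)) = (R.tensorAlg L.toAlgOps).mul (ψ r ⊗ₜ ψ s)
  map_one : ψ R.one = R.one ⊗ₜ L.one

end Algebras

/-! ### The finite dual and its Hopf subalgebras -/

section FiniteDual

variable {k B H : Type*} [Field k] [Ring B] [HopfAlgebra k B] [AddCommGroup H] [Module k H]

/-- Two-sided ideals of `H` in the Yetter-Drinfeld category. -/
structure IsYDIdeal (𝓗 : AlgOps k B H) (I : Submodule k H) : Prop where
  mul_mem_left : ∀ x, ∀ y ∈ I, 𝓗.mul (x ⊗ₜ y) ∈ I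
  mul_mem_right : ∀ x, ∀ y ∈ I, 𝓗.mul (y ⊗ₜ x) ∈ I
  act_mem : ∀ b : B, ∀ x ∈ I, 𝓗.act (b ⊗ₜ x) ∈ I
  coact_mem : ∀ x ∈ I, 𝓗.coact x ∈ LinearMap.range (I.subtype.lTensor B)

lemma IsYDIdeal.inf {𝓗 : AlgOps k B H} {I J : Submodule k H}
    (hI : IsYDIdeal 𝓗 I) (hJ : IsYDIdeal 𝓗 J) : IsYDIdeal 𝓗 (I ⊓ J) where
  mul_mem_left x y hy := ⟨hI.mul_mem_left x y hy.1, hJ.mul_mem_left x y hy.2⟩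
  mul_mem_right x y hy := ⟨hI.mul_mem_right x y hy.1, hJ.mul_mem_right x y hy.2⟩
  act_mem b x hx := ⟨hI.act_mem b x hx.1, hJ.act_mem b x hx.2⟩
  coact_mem x hx := by
    have key : ∀ K : Submodule k H, 𝓗.coact x ∈ LinearMap.range (K.subtype.lTensor B) →
        K.mkQ.lTensor B (𝓗.coact x) = 0 := by
      rintro K ⟨z, hz⟩
      rw [← hz, ← LinearMap.comp_apply, ← LinearMap.lTensor_comp]
      have : K.mkQ ∘ₗ K.subtype = 0 := by ext; simp
      simp [this]
    have hex : Function.Exact (I ⊓ J).subtype (I.mkQ.prod J.mkQ) := by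
      intro y
      simp [Submodule.Quotient.mk_eq_zero]
    have h2 := Module.Flat.lTensor_exact B hex
    refine (h2 _).1 ?_
    apply (TensorProduct.prodRight k k B (H ⧸ I) (H ⧸ J)).injective
    have h3 : ∀ t : B ⊗[k] H, TensorProduct.prodRight k k B (H ⧸ I) (H ⧸ J)
        ((I.mkQ.prod J.mkQ).lTensor B t) = (I.mkQ.lTensor B t, J.mkQ.lTensor B t) := by
      intro t
      induction t with
      | zero => simp only [map_zero]; rfl
      | tmul b y => simp
      | add s t hs ht => simp [hs, ht]
    rw [h3, key I (hI.coact_mem x hx.1), key J (hJ.coact_mem x hx.2), map_zero]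
    rfl

/-- The finite dual `H°`: the functionals whose kernel contains an ideal of finite codimension in
the Yetter-Drinfeld category. -/
def finiteDual (𝓗 : AlgOps k B H) : Submodule k (Module.Dual k H) where
  carrier := {f | ∃ I : Submodule k H, IsYDIdeal 𝓗 I ∧ FiniteDimensional k (H ⧸ I) ∧
    I ≤ LinearMap.ker f}
  zero_mem' := ⟨⊤, ⟨fun _ _ _ => trivial, fun _ _ _ => trivial, fun _ _ _ => trivial,
    fun x _ => LinearMap.lTensor_surjective B
      (g := (⊤ : Submodule k H).subtype) (fun y => ⟨⟨y, trivial⟩, rfl⟩) _⟩,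
    inferInstance, by simp⟩
  add_mem' := by
    rintro f g ⟨I, hI, hI', hf⟩ ⟨J, hJ, hJ', hg⟩
    refine ⟨I ⊓ J, hI.inf hJ, Submodule.CoFG.inf hI' hJ', fun x hx => ?_⟩
    have h1 : f x = 0 := hf hx.1
    have h2 : g x = 0 := hg hx.2
    simp [h1, h2]
  smul_mem' := by
    rintro c f ⟨I, hI, hI', hf⟩
    refine ⟨I, hI, hI', fun x hx => ?_⟩
    have h1 : f x = 0 := hf hx
    simp [h1]

/-- The inverse of the antipode of `B` (meaningful when the antipode is bijective). -/
def antipodeInv (k B : Type*) [Field k] [Ring B] [HopfAlgebra k B] : B →ₗ[k] B :=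
  leftInv (HopfAlgebra.antipode k (A := B))

/-- The action on functionals: `(b · f)(x) = f(S(b) · x)`. -/
def dualAct (𝓗 : Ops k B H) : B ⊗[k] Module.Dual k H →ₗ[k] Module.Dual k H :=
  TensorProduct.lift
    { toFun := fun b => LinearMap.lcomp k k
        (TensorProduct.curry 𝓗.act (HopfAlgebra.antipode k (A := B) b))
      map_add' := fun a b => by ext; simp
      map_smul' := fun c b => by ext; simp }

/-- For a functional `f`, the map `x ↦ f(x₍₀₎) S⁻¹(x₍₋₁₎)` from `H` to `B`. -/
def dualCoact (𝓗 : Ops k B H) : Module.Dual k H →ₗ[k] (H →ₗ[k] B) where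
  toFun f := (TensorProduct.rid k B).toLinearMap ∘ₗ map (antipodeInv k B) f ∘ₗ 𝓗.coact
  map_add' f g := by ext; simp [TensorProduct.map_add_right]
  map_smul' c f := by ext; simp [TensorProduct.map_smul_right]

/-- `b ⊗ f ↦ (x ↦ f(x) b)`, an injective map `B ⊗ U → Hom(H, B)`. -/
def coactPairing (B : Type*) [Ring B] [HopfAlgebra k B] (U : Submodule k (Module.Dual k H)) :
    B ⊗[k] U →ₗ[k] (H →ₗ[k] B) :=
  dualTensorHom k H B ∘ₗ (TensorProduct.comm k B (Module.Dual k H)).toLinearMap ∘ₗ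
    U.subtype.lTensor B

/-- Regard a linear map into the dual space with values in `U` as a map into `U`. -/
def corestrict {M : Type*} [AddCommMonoid M] [Module k M] (U : Submodule k (Module.Dual k H))
    (f : M →ₗ[k] Module.Dual k H) : M →ₗ[k] U :=
  leftInv U.subtype ∘ₗ f

/-- The action and coaction that a space `U` of functionals, closed under them, inherits:
`(b · f)(x) = f(S(b) · x)` and `f₍₀₎(x) f₍₋₁₎ = f(x₍₀₎) S⁻¹(x₍₋₁₎)`. -/
def dualOps (𝓗 : Ops k B H) (U : Submodule k (Module.Dual k H)) : Ops k B U where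
  act := corestrict U (dualAct 𝓗 ∘ₗ U.subtype.lTensor B)
  coact := leftInv (coactPairing B U) ∘ₗ dualCoact 𝓗 ∘ₗ U.subtype

/-- The evaluation `U ⊗ H → k`. -/
def ev (U : Submodule k (Module.Dual k H)) : U ⊗[k] H →ₗ[k] k :=
  TensorProduct.lift U.subtype

/-- The evaluation pairing of `U ⊗ U` with `H ⊗ H`, namely `(ev ⊗ ev) (id ⊗ C_{U,H} ⊗ id)`:
`⟨f ⊗ g, x ⊗ y⟩ = f(g₍₋₁₎ · x) g₍₀₎(y)`. -/
def ev₂ (𝓗 : Ops k B H) (U : Submodule k (Module.Dual k H)) :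
    U ⊗[k] U →ₗ[k] Module.Dual k (H ⊗[k] H) :=
  TensorProduct.curry
    (LinearMap.mul' k k ∘ₗ map (ev U) (ev U) ∘ₗ middle (braiding (dualOps 𝓗 U) 𝓗))

/-- The operations that a space `U` of functionals, closed under them, inherits from the Hopf
algebra `H`: besides the action and the coaction,
`⟨f g, x⟩ = ⟨f ⊗ g, Δ x⟩`, `1 = ε`, `⟨Δ f, x ⊗ y⟩ = ⟨f, x y⟩`, `ε(f) = f(1)`, `S(f) = f ∘ S`. -/
def dualHopfOps (𝓗 : HopfOps k B H) (U : Submodule k (Module.Dual k H)) : HopfOps k B U where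
  toOps := dualOps 𝓗.toOps U
  mul := corestrict U (LinearMap.lcomp k k 𝓗.comul ∘ₗ ev₂ 𝓗.toOps U)
  one := leftInv U.subtype 𝓗.counit
  comul := leftInv (ev₂ 𝓗.toOps U) ∘ₗ LinearMap.lcomp k k 𝓗.mul ∘ₗ U.subtype
  counit := (Module.Dual.eval k H 𝓗.one) ∘ₗ U.subtype
  antipode := corestrict U (LinearMap.lcomp k k 𝓗.antipode ∘ₗ U.subtype)

/-- `U` is a subobject of the dual: closed under the action and the coaction. -/
structure IsYDSubobject (𝓗 : Ops k B H) (U : Submodule k (Module.Dual k H)) : Prop where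
  act_mem : ∀ b : B, ∀ f ∈ U, dualAct 𝓗 (b ⊗ₜ f) ∈ U
  coact_mem : ∀ f ∈ U, dualCoact 𝓗 f ∈ LinearMap.range (coactPairing B U)

/-- `U` is a braided Hopf subalgebra of the finite dual: a subspace closed under the action, the
coaction, the multiplication, the unit, the comultiplication and the antipode. -/
structure IsHopfSubalgebra (𝓗 : HopfOps k B H) (U : Submodule k (Module.Dual k H)) : Prop where
  le_finiteDual : U ≤ finiteDual 𝓗.toAlgOps
  isSub : IsYDSubobject 𝓗.toOps U
  one_mem : 𝓗.counit ∈ U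
  mul_mem : ∀ t : U ⊗[k] U, ev₂ 𝓗.toOps U t ∘ₗ 𝓗.comul ∈ U
  comul_mem : ∀ f ∈ U, f ∘ₗ 𝓗.mul ∈ LinearMap.range (ev₂ 𝓗.toOps U)
  antipode_mem : ∀ f ∈ U, f ∘ₗ 𝓗.antipode ∈ U

lemma dualTensorHom_injective (M N : Type*) [AddCommGroup M] [Module k M] [AddCommGroup N]
    [Module k N] : Function.Injective (dualTensorHom k M N) := by
  classical
  let b := Module.Basis.ofVectorSpace k N
  rw [injective_iff_map_eq_zero]
  intro t ht
  apply (TensorProduct.equivFinsuppOfBasisRight (M := Module.Dual k M) b).injective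
  rw [map_zero]
  ext i x
  have h : ∀ t : Module.Dual k M ⊗[k] N,
      TensorProduct.equivFinsuppOfBasisRight b t i x = b.repr (dualTensorHom k M N t x) i := by
    intro t
    induction t with
    | zero => simp
    | tmul f n => simp [mul_comm]
    | add s t hs ht => simp [hs, ht]
  rw [h, ht]
  simp

lemma coactPairing_tmul (U : Submodule k (Module.Dual k H)) (b : B) (f : U) (x : H) :
    coactPairing B U (b ⊗ₜ f) x = f.1 x • b := by
  simp [coactPairing]

lemma coactPairing_injective (U : Submodule k (Module.Dual k H)) :
    Function.Injective (coactPairing B U) := by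
  have h : Function.Injective (U.subtype.lTensor B) :=
    Module.Flat.lTensor_preserves_injective_linearMap U.subtype U.injective_subtype
  exact (dualTensorHom_injective H B).comp ((TensorProduct.comm k B _).injective.comp h)

lemma corestrict_apply {M : Type*} [AddCommMonoid M] [Module k M]
    (U : Submodule k (Module.Dual k H)) (f : M →ₗ[k] Module.Dual k H) (m : M) (h : f m ∈ U) :
    (corestrict U f m : Module.Dual k H) = f m := by
  have := leftInv_apply U.injective_subtype (⟨f m, h⟩ : U)
  exact congrArg Subtype.val this

/-- The finite dual is a subobject of the dual. -/
lemma finiteDual_isYDSubobject (𝓗 : AlgOps k B H) :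
    IsYDSubobject 𝓗.toOps (finiteDual 𝓗) where
  act_mem := by
    rintro b f ⟨I, hI, hI', hf⟩
    refine ⟨I, hI, hI', fun x hx => ?_⟩
    exact hf (hI.act_mem _ x hx)
  coact_mem := by
    rintro f ⟨I, hI, hI', hf⟩
    have h0 : I ≤ LinearMap.ker (dualCoact 𝓗.toOps f) := by
      intro x hx
      obtain ⟨z, hz⟩ := hI.coact_mem x hx
      have hz' : ∀ z : B ⊗[k] I, TensorProduct.map (antipodeInv k B) f
          (I.subtype.lTensor B z) = 0 := by
        intro z
        induction z with
        | zero => simp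
        | tmul b y =>
          have : f y = 0 := hf y.2
          simp [this]
        | add s t hs ht => simp [hs, ht]
      simp [dualCoact, ← hz, hz']
    let U := finiteDual 𝓗
    let g : (H ⧸ I) →ₗ[k] B := I.liftQ _ h0
    obtain ⟨t, ht⟩ := (dualTensorHomEquiv k (H ⧸ I) B).surjective g
    let j : Module.Dual k (H ⧸ I) →ₗ[k] U :=
      { toFun := fun φ => ⟨φ ∘ₗ I.mkQ, I, hI, hI', fun x hx => by
          simp [(Submodule.Quotient.mk_eq_zero I).2 hx]⟩
        map_add' := fun _ _ => rfl
        map_smul' := fun _ _ => rfl }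
    refine ⟨TensorProduct.comm k U B (j.rTensor B t), ?_⟩
    have hj : ∀ t : Module.Dual k (H ⧸ I) ⊗[k] B, ∀ x : H,
        coactPairing B U (TensorProduct.comm k U B (j.rTensor B t)) x =
          dualTensorHom k (H ⧸ I) B t (I.mkQ x) := by
      intro t x
      induction t with
      | zero => simp
      | tmul φ b => simp [coactPairing_tmul, j]
      | add s t hs ht => simp only [map_add, LinearMap.add_apply, hs, ht]
    ext x
    rw [hj]
    have : dualTensorHom k (H ⧸ I) B t = g := ht
    rw [this]
    simp [g]

lemma dualOps_act {𝓗 : Ops k B H} {U : Submodule k (Module.Dual k H)}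
    (hU : IsYDSubobject 𝓗 U) (b : B) (f : U) (x : H) :
    ((dualOps 𝓗 U).act (b ⊗ₜ f)).1 x = f.1 (𝓗.act (HopfAlgebra.antipode k b ⊗ₜ x)) := by
  have := corestrict_apply U (dualAct 𝓗 ∘ₗ U.subtype.lTensor B) (b ⊗ₜ f) (hU.act_mem b f f.2)
  exact LinearMap.congr_fun this x

lemma dualOps_coact {𝓗 : Ops k B H} {U : Submodule k (Module.Dual k H)}
    (hU : IsYDSubobject 𝓗 U) (f : U) :
    coactPairing B U ((dualOps 𝓗 U).coact f) = dualCoact 𝓗 f := by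
  obtain ⟨t, ht⟩ := hU.coact_mem f f.2
  have : (dualOps 𝓗 U).coact f = leftInv (coactPairing B U) (dualCoact 𝓗 f) := rfl
  rw [this, ← ht, leftInv_apply (coactPairing_injective U)]

lemma antipodeInv_apply (hB : Function.Bijective (HopfAlgebra.antipode k (A := B))) (b : B) :
    HopfAlgebra.antipode k (antipodeInv k B b) = b := by
  obtain ⟨c, rfl⟩ := hB.2 b
  rw [antipodeInv, leftInv_apply hB.1]

/-- `x ⊗ y ↦ S⁻¹(y₍₋₁₎) · x ⊗ y₍₀₎`. -/
def invTwist (𝓗 : Ops k B H) : H ⊗[k] H →ₗ[k] H ⊗[k] H :=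
  (TensorProduct.comm k H H).toLinearMap ∘ₗ 𝓗.act.lTensor H ∘ₗ
    (TensorProduct.leftComm k B H H).toLinearMap ∘ₗ
    (TensorProduct.assoc k B H H).toLinearMap ∘ₗ
    ((antipodeInv k B).rTensor H ∘ₗ 𝓗.coact).rTensor H ∘ₗ
    (TensorProduct.comm k H H).toLinearMap

lemma ev₂_apply {𝓗 : Ops k B H} {U : Submodule k (Module.Dual k H)}
    (hU : IsYDSubobject 𝓗 U) (t : U ⊗[k] U) (z : H ⊗[k] H) :
    ev₂ 𝓗 U t z = TensorProduct.dualDistrib k H H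
      (TensorProduct.map U.subtype U.subtype t) (invTwist 𝓗 z) := by
  induction t with
  | zero => simp
  | add s t hs ht => simp only [map_add, LinearMap.add_apply, hs, ht]
  | tmul f g =>
    induction z with
    | zero => simp
    | add s t hs ht => simp only [map_add, hs, ht]
    | tmul x y =>
      have h1 : ∀ s : B ⊗[k] U, LinearMap.mul' k k (TensorProduct.map (ev U) (ev U)
          ((TensorProduct.assoc k U H (U ⊗[k] H)).symm
            (f ⊗ₜ[k] (TensorProduct.assoc k H U H
              ((𝓗.act.rTensor U (TensorProduct.rightComm k B U H (s ⊗ₜ[k] x))) ⊗ₜ[k] y))))) =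
          f.1 (𝓗.act (coactPairing B U s y ⊗ₜ x)) := by
        intro s
        induction s with
        | zero => simp
        | add s t hs ht =>
          simp only [map_add, TensorProduct.add_tmul, TensorProduct.tmul_add,
            LinearMap.add_apply, hs, ht]
        | tmul b g' =>
          simp [coactPairing_tmul, ev, ← TensorProduct.smul_tmul', mul_comm]
      have h2 : ∀ r : B ⊗[k] H, f.1 (𝓗.act ((TensorProduct.rid k B)
            (TensorProduct.map (antipodeInv k B) g.1 r) ⊗ₜ x)) =
          TensorProduct.dualDistrib k H H (f.1 ⊗ₜ g.1) ((TensorProduct.comm k H H)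
            (𝓗.act.lTensor H (TensorProduct.leftComm k B H H
              (TensorProduct.assoc k B H H ((antipodeInv k B).rTensor H r ⊗ₜ x))))) := by
        intro r
        induction r with
        | zero => simp
        | add s t hs ht =>
          simp only [map_add, TensorProduct.add_tmul, hs, ht]
        | tmul b h =>
          simp [← TensorProduct.smul_tmul', mul_comm]
      have h3 := h1 ((dualOps 𝓗 U).coact g)
      rw [dualOps_coact hU] at h3
      exact h3.trans (h2 (𝓗.coact y))

lemma antipodeInv_mul (hB : Function.Bijective (HopfAlgebra.antipode k (A := B))) (b : B) :
    LinearMap.mul' k B ((antipodeInv k B).rTensor B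
      (TensorProduct.comm k B B (Coalgebra.comul (R := k) b))) =
      algebraMap k B (Coalgebra.counit b) := by
  apply hB.1
  rw [Algebra.algebraMap_eq_smul_one, map_smul, HopfAlgebra.antipode_one,
    ← Algebra.algebraMap_eq_smul_one, ← HopfAlgebra.mul_antipode_rTensor_comul_apply]
  have h : ∀ t : B ⊗[k] B, HopfAlgebra.antipode k (LinearMap.mul' k B
      ((antipodeInv k B).rTensor B (TensorProduct.comm k B B t))) =
      LinearMap.mul' k B ((HopfAlgebra.antipode k).rTensor B t) := by
    intro t
    induction t with
    | zero => simp
    | add s t hs ht => simp only [map_add, hs, ht]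
    | tmul a c =>
      simp [HopfAlgebra.antipode_mul_antidistrib, antipodeInv_apply hB]
  exact h _

lemma invTwist_surjective (hB : Function.Bijective (HopfAlgebra.antipode k (A := B)))
    {𝓗 : Ops k B H} (h𝓗 : 𝓗.IsYD) : Function.Surjective (invTwist 𝓗) := by
  rw [← LinearMap.range_eq_top, eq_top_iff, ← TensorProduct.span_tmul_eq_top, Submodule.span_le]
  rintro _ ⟨x, y, rfl⟩
  -- the map `b ⊗ h ↦ b · x ⊗ h`
  let L : B ⊗[k] H →ₗ[k] H ⊗[k] H := (TensorProduct.curry 𝓗.act |>.flip x).rTensor H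
  let M : B ⊗[k] (B ⊗[k] H) →ₗ[k] H ⊗[k] H :=
    L ∘ₗ (LinearMap.mul' k B ∘ₗ (antipodeInv k B).rTensor B ∘ₗ
      (TensorProduct.comm k B B).toLinearMap).rTensor H ∘ₗ
      (TensorProduct.assoc k B B H).symm.toLinearMap
  have h1 : ∀ t : B ⊗[k] H, invTwist 𝓗 (L t) = M (𝓗.coact.lTensor B t) := by
    intro t
    induction t with
    | zero => simp
    | add s t hs ht => simp only [map_add, hs, ht]
    | tmul b h =>
      have h2 : ∀ r : B ⊗[k] H, (TensorProduct.comm k H H)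
            (𝓗.act.lTensor H (TensorProduct.leftComm k B H H
              (TensorProduct.assoc k B H H ((antipodeInv k B).rTensor H r ⊗ₜ
                (𝓗.act (b ⊗ₜ x)))))) = M (b ⊗ₜ r) := by
        intro r
        induction r with
        | zero => simp
        | add s t hs ht =>
          simp only [map_add, TensorProduct.add_tmul, TensorProduct.tmul_add, hs, ht]
        | tmul c h => simp [M, L, h𝓗.mul_act]
      exact h2 (𝓗.coact h)
  refine ⟨L (𝓗.coact y), ?_⟩
  rw [h1, ← h𝓗.coassoc]
  have h3 : ∀ t : B ⊗[k] H, M (TensorProduct.assoc k B B H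
      ((Coalgebra.comul (R := k) (A := B)).rTensor H t)) =
      x ⊗ₜ TensorProduct.lid k H ((Coalgebra.counit (R := k) (A := B)).rTensor H t) := by
    intro t
    induction t with
    | zero => simp
    | add s t hs ht => simp only [map_add, TensorProduct.tmul_add, hs, ht]
    | tmul b h =>
      have := antipodeInv_mul hB b
      simp only [M, L, LinearMap.comp_apply, LinearEquiv.coe_coe, LinearMap.rTensor_tmul,
        LinearEquiv.symm_apply_apply]
      rw [this, Algebra.algebraMap_eq_smul_one]
      simp [TensorProduct.smul_tmul, h𝓗.one_act]
  rw [h3, h𝓗.counit_coact]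

lemma ev₂_injective (hB : Function.Bijective (HopfAlgebra.antipode k (A := B)))
    {𝓗 : Ops k B H} (h𝓗 : 𝓗.IsYD) {U : Submodule k (Module.Dual k H)}
    (hU : IsYDSubobject 𝓗 U) : Function.Injective (ev₂ 𝓗 U) := by
  have h1 : Function.Injective (TensorProduct.map U.subtype U.subtype) :=
    have : Module.Flat k U := by
      have : Module.Free k U := Module.Free.of_divisionRing k U
      exact Module.Flat.of_free
    TensorProduct.map_injective_of_flat_flat _ _ U.injective_subtype U.injective_subtype
  have h2 : Function.Injective (TensorProduct.dualDistrib k H H) := by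
    intro s t hst
    apply dualTensorHom_injective H (Module.Dual k H)
    have h : ∀ (t : Module.Dual k H ⊗[k] Module.Dual k H) (x y : H),
        dualTensorHom k H (Module.Dual k H) t x y =
          TensorProduct.dualDistrib k H H t (x ⊗ₜ y) := by
      intro t x y
      induction t with
      | zero => simp
      | add s t hs ht => simp only [map_add, LinearMap.add_apply, hs, ht]
      | tmul f g => simp
    ext x y
    rw [h, h, hst]
  intro s t hst
  apply h1
  apply h2
  ext1
  ext x y
  obtain ⟨z, hz⟩ := invTwist_surjective hB h𝓗 (x ⊗ₜ y)
  have := LinearMap.congr_fun hst z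
  rw [ev₂_apply hU, ev₂_apply hU, hz] at this
  exact this

section Specification

variable {𝓗 : HopfOps k B H} {U : Submodule k (Module.Dual k H)}

lemma dualHopfOps_mul (hU : IsHopfSubalgebra 𝓗 U) (t : U ⊗[k] U) (x : H) :
    ((dualHopfOps 𝓗 U).mul t).1 x = ev₂ 𝓗.toOps U t (𝓗.comul x) :=
  LinearMap.congr_fun (corestrict_apply U _ t (hU.mul_mem t)) x

lemma dualHopfOps_one (hU : IsHopfSubalgebra 𝓗 U) :
    ((dualHopfOps 𝓗 U).one : Module.Dual k H) = 𝓗.counit :=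
  congrArg Subtype.val
    (leftInv_apply U.injective_subtype (⟨𝓗.counit, hU.one_mem⟩ : U))

lemma dualHopfOps_comul (hB : Function.Bijective (HopfAlgebra.antipode k (A := B)))
    (h𝓗 : 𝓗.IsHopf) (hU : IsHopfSubalgebra 𝓗 U) (f : U) (z : H ⊗[k] H) :
    ev₂ 𝓗.toOps U ((dualHopfOps 𝓗 U).comul f) z = f.1 (𝓗.mul z) := by
  obtain ⟨t, ht⟩ := hU.comul_mem f f.2
  have h : (dualHopfOps 𝓗 U).comul f = leftInv (ev₂ 𝓗.toOps U) (f.1 ∘ₗ 𝓗.mul) := rfl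
  rw [h, ← ht, leftInv_apply (ev₂_injective hB h𝓗.isAlg.isYD hU.isSub), ht]
  rfl

lemma dualHopfOps_antipode (hU : IsHopfSubalgebra 𝓗 U) (f : U) (x : H) :
    ((dualHopfOps 𝓗 U).antipode f).1 x = f.1 (𝓗.antipode x) :=
  LinearMap.congr_fun (corestrict_apply U _ f (hU.antipode_mem f f.2)) x

end Specification

end FiniteDual

/-! ### The actions, the maps `λ` and `ρ`, and the smash products -/

section Duality

variable {k B H R : Type*} [Field k] [Ring B] [HopfAlgebra k B]
  [AddCommGroup H] [Module k H] [AddCommGroup R] [Module k R]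

/-- The action `f ⇀ x = (f₍₋₁₎ · x₁) f₍₀₎(x₂)` of `U` on `H`. -/
def arrow (𝓗 : HopfOps k B H) (U : Submodule k (Module.Dual k H)) : U ⊗[k] H →ₗ[k] H :=
  (TensorProduct.rid k H).toLinearMap ∘ₗ (ev U).lTensor H ∘ₗ
    (TensorProduct.assoc k H U H).toLinearMap ∘ₗ
    (braiding (dualHopfOps 𝓗 U).toOps 𝓗.toOps).rTensor H ∘ₗ
    (TensorProduct.assoc k U H H).symm.toLinearMap ∘ₗ 𝓗.comul.lTensor U

/-- The smash product `H # U`. -/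
def smashHU (𝓗 : HopfOps k B H) (U : Submodule k (Module.Dual k H)) : AlgOps k B (H ⊗[k] U) :=
  smash 𝓗.toAlgOps (dualHopfOps 𝓗 U) (arrow 𝓗 U)

/-- `λ : H # U → End H`, `λ(h # f)(x) = h (f ⇀ x) = h (f₍₋₁₎ · x₁) f₍₀₎(x₂)`. -/
def lam (𝓗 : HopfOps k B H) (U : Submodule k (Module.Dual k H)) :
    H ⊗[k] U →ₗ[k] (H →ₗ[k] H) :=
  TensorProduct.curry
    (𝓗.mul ∘ₗ (arrow 𝓗 U).lTensor H ∘ₗ (TensorProduct.assoc k H U H).toLinearMap)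

/-- `ρ : U # H → End H`; `f ⊗ h ⊗ x` is sent through `id ⊗ id ⊗ Δ`, the braiding of `h` with `x₁`,
the evaluation of `f` on the first factor, the braiding of the remaining two factors, and the
multiplication.  In particular `ρ(f # 1)(x) = f(x₁) x₂`. -/
def rho (𝓗 : HopfOps k B H) (U : Submodule k (Module.Dual k H)) :
    U ⊗[k] H →ₗ[k] (H →ₗ[k] H) :=
  TensorProduct.curry
    ((TensorProduct.lid k H).toLinearMap ∘ₗ
      map (ev U) (𝓗.mul ∘ₗ braiding 𝓗.toOps 𝓗.toOps) ∘ₗ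
      middle (braiding 𝓗.toOps 𝓗.toOps) ∘ₗ 𝓗.comul.lTensor (U ⊗[k] H))

/-- The `RL`-condition `ρ(U # 1) ⊆ λ(H # U)`. -/
def RLCondition (𝓗 : HopfOps k B H) (U : Submodule k (Module.Dual k H)) : Prop :=
  ∀ f : U, rho 𝓗 U (f ⊗ₜ 𝓗.one) ∈ LinearMap.range (lam 𝓗 U)

/-- The action of `H` on a right `U`-comodule `R`: the composite
`(id ⊗ ev) (id ⊗ C_{H,U}) (C_{H,R} ⊗ id) (id ⊗ ψ)`. -/
def inducedAct (𝓗 : HopfOps k B H) (U : Submodule k (Module.Dual k H)) (𝓡 : AlgOps k B R)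
    (ψ : R →ₗ[k] R ⊗[k] U) : H ⊗[k] R →ₗ[k] R :=
  (TensorProduct.rid k R).toLinearMap ∘ₗ
    (ev U ∘ₗ braiding 𝓗.toOps (dualHopfOps 𝓗 U).toOps).lTensor R ∘ₗ
    (TensorProduct.assoc k R H U).toLinearMap ∘ₗ
    (braiding 𝓗.toOps 𝓡.toOps).rTensor U ∘ₗ
    (TensorProduct.assoc k H R U).symm.toLinearMap ∘ₗ ψ.lTensor H

/-- The smash product `R # H`. -/
def smashRH (𝓗 : HopfOps k B H) (U : Submodule k (Module.Dual k H)) (𝓡 : AlgOps k B R)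
    (ψ : R →ₗ[k] R ⊗[k] U) : AlgOps k B (R ⊗[k] H) :=
  smash 𝓡 𝓗 (inducedAct 𝓗 U 𝓡 ψ)

/-- The action of `U` on `R # H`, trivial on `R` and `⇀` on `H`:
`f ⊗ (r # h) ↦ f₍₋₁₎ · r # (f₍₀₎ ⇀ h)`. -/
def actRH (𝓗 : HopfOps k B H) (U : Submodule k (Module.Dual k H)) (𝓡 : AlgOps k B R) :
    U ⊗[k] (R ⊗[k] H) →ₗ[k] R ⊗[k] H :=
  (arrow 𝓗 U).lTensor R ∘ₗ (TensorProduct.assoc k R U H).toLinearMap ∘ₗ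
    (braiding (dualHopfOps 𝓗 U).toOps 𝓡.toOps).rTensor H ∘ₗ
    (TensorProduct.assoc k U R H).symm.toLinearMap

/-- The smash product `(R # H) # U`. -/
def smashRHU (𝓗 : HopfOps k B H) (U : Submodule k (Module.Dual k H)) (𝓡 : AlgOps k B R)
    (ψ : R →ₗ[k] R ⊗[k] U) : AlgOps k B ((R ⊗[k] H) ⊗[k] U) :=
  smash (smashRH 𝓗 U 𝓡 ψ) (dualHopfOps 𝓗 U) (actRH 𝓗 U 𝓡)

end Duality

end

end BraidedDuality

/-!
# Duality for braided Hopf algebras in the Yetter–Drinfeld category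

Let `⟨ , ⟩ : U ⊗ H → k` be the evaluation. The smash product `H # U` acts on `H` by `λ`, and this
action is faithful: the inverse of the antipode recovers `t = h # f` from `λ(t)`, since
`λ(t)(x₁) S⁻¹(x₂) = h ⟨f, x⟩` for the opposite comultiplication
(`HopfPairing.lamT_antipodeInv`), and `H` separates the points of `H ⊗ U`. Hence every identity
between maps into `H # U` can be checked on `H`; the associativity of `H # U` is an instance.

By faithfulness the `RL`-condition gives a unique map `j : U → H # U` with `λ(j f) = ρ(f # 1)`, that
is, `j(f)` acts on `H` by `x ↦ ⟨f, x₁⟩ x₂`. It is a morphism of Yetter–Drinfeld modules, because a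
linear map into `W ⊗ U` is one as soon as its pairing with `H` is (`isHom_of_pairing`). Comparing
actions on `H`, and using that the braiding is symmetric on `H` and `U`, one finds, up to braidings,

* `j(f) j(g) = j(g f)` (`HopfPairing.swap_mul_split`),
* `j(g) (1 # f) = (1 # f) j(g)` (`HopfPairing.swap_split_mul`),
* `j(f) (h # 1) = ⟨f₁, h₁⟩ (h₂ # 1) j(f₂)` (`HopfPairing.comul_comul_cap_split`),
* `j` has the convolution inverse `f ↦ j(f ∘ S⁻¹)` (`HopfPairing.comul_split_splitInv` and
  `HopfPairing.comul_splitInv_split`).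

Now let `R` be a right `U`-comodule algebra. Up to the braiding, the elements `r₀ ⊗ j(r₁)` of
`(R # H) # U` commute with `H` by the third identity, since `H` acts on `R` through the coaction,
and with `U` by the second one (`ComoduleAlgebra.tauT_smashT`); by the first identity they form a
copy of the algebra `R` (`ComoduleAlgebra.mul_coact_split`). Therefore `r ⊗ e ↦ r₀ ⊗ j(r₁) e` is
multiplicative from `R ⊗ (H # U)` to `(R # H) # U` (`ComoduleAlgebra.mul_shear`), and it is
bijective because `j` is invertible for the convolution (`ComoduleAlgebra.shearIso`). The axioms
of an algebra for `(R # H) # U` are transported along this isomorphism. If `H` is quantum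
cocommutative, then `ρ(f # 1) = λ(1 # f)`, so the `RL`-condition holds.

This computation takes place in an arbitrary braided monoidal category, for a nondegenerate
`HopfPairing`. Words in the letters `H`, `U`, `R` are nested to the right and carry an arbitrary
tail `Y`, so that the associators disappear and each step is a rewriting of the leading letters. The
theorem about Yetter–Drinfeld modules follows by applying it to the category `YDModule`, with
`Model` and `Model.Rel` relating spaces in different universes, and linear maps between them, to
the objects and morphisms of that category.
-/

/-! ### Words with a tail in a braided monoidal category -/

namespace BraidedDuality

section TailCalculus

open CategoryTheory MonoidalCategory

local infixr:70 " ⊠ " => MonoidalCategoryStruct.tensorObj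

universe v u

section Rewriting

variable {C : Type u} [Category.{v} C] {A B D E F : C}

/-- An equation between composites of two morphisms, followed by a further morphism. -/
theorem comp₂₂ {a : A ⟶ B} {b : B ⟶ D} {c : A ⟶ E} {d : E ⟶ D} (h : a ≫ b = c ≫ d) {Z : C}
    (r : D ⟶ Z) : a ≫ b ≫ r = c ≫ d ≫ r := by
  rw [← Category.assoc, h, Category.assoc]

/-- A composite of two morphisms rewritten as one of three, followed by a further morphism. -/
theorem comp₂₃ {a : A ⟶ B} {b : B ⟶ D} {c : A ⟶ E} {d : E ⟶ F} {e : F ⟶ D}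
    (h : a ≫ b = c ≫ d ≫ e) {Z : C} (r : D ⟶ Z) : a ≫ b ≫ r = c ≫ d ≫ e ≫ r := by
  rw [← Category.assoc, h, Category.assoc, Category.assoc]

variable [MonoidalCategory C]

theorem whisk₁₂ (P : C) {a : A ⟶ D} {c : A ⟶ B} {d : B ⟶ D} (h : a = c ≫ d) :
    P ◁ a = P ◁ c ≫ P ◁ d := by rw [h, whiskerLeft_comp]

theorem whisk₂₂ (P : C) {a : A ⟶ B} {b : B ⟶ D} {c : A ⟶ E} {d : E ⟶ D} (h : a ≫ b = c ≫ d) :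
    P ◁ a ≫ P ◁ b = P ◁ c ≫ P ◁ d := by
  rw [← whiskerLeft_comp, h, whiskerLeft_comp]

theorem whisk₂₃ (P : C) {a : A ⟶ B} {b : B ⟶ D} {c : A ⟶ E} {d : E ⟶ F} {e : F ⟶ D}
    (h : a ≫ b = c ≫ d ≫ e) : P ◁ a ≫ P ◁ b = P ◁ c ≫ P ◁ d ≫ P ◁ e := by
  rw [← whiskerLeft_comp, h, whiskerLeft_comp, whiskerLeft_comp]

end Rewriting

section Ops

variable {C : Type u} [Category.{v} C] [MonoidalCategory C] {A B D E : C}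

/-- A morphism `f : A ⟶ B ⊗ D` applied to the first letter of the word `A ⊗ Y`. All words are
nested to the right, so that the associators disappear from the computations. -/
def splitT (f : A ⟶ B ⊠ D) (Y : C) : A ⊠ Y ⟶ B ⊠ D ⊠ Y := f ▷ Y ≫ (α_ B D Y).hom

/-- A morphism `f : A ⊗ B ⟶ D` applied to the first two letters of the word `A ⊗ (B ⊗ Y)`. -/
def mergeT (f : A ⊠ B ⟶ D) (Y : C) : A ⊠ B ⊠ Y ⟶ D ⊠ Y := (α_ A B Y).inv ≫ f ▷ Y

/-- A morphism `f : A ⊗ B ⟶ D ⊗ E` applied to the first two letters of `A ⊗ (B ⊗ Y)`. -/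
def squareT (f : A ⊠ B ⟶ D ⊠ E) (Y : C) : A ⊠ B ⊠ Y ⟶ D ⊠ E ⊠ Y :=
  (α_ A B Y).inv ≫ f ▷ Y ≫ (α_ D E Y).hom

/-- A pairing `f : A ⊗ B ⟶ 𝟙` applied to the first two letters of `A ⊗ (B ⊗ Y)`. -/
def capT (f : A ⊠ B ⟶ 𝟙_ C) (Y : C) : A ⊠ B ⊠ Y ⟶ Y :=
  (α_ A B Y).inv ≫ f ▷ Y ≫ (λ_ Y).hom

/-- An element `f : 𝟙 ⟶ A` inserted in front of the word `Y`. -/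
def unitT (f : 𝟙_ C ⟶ A) (Y : C) : Y ⟶ A ⊠ Y := (λ_ Y).inv ≫ f ▷ Y

/-- A functional `f : A ⟶ 𝟙` applied to the first letter of `A ⊗ Y`. -/
def counitT (f : A ⟶ 𝟙_ C) (Y : C) : A ⊠ Y ⟶ Y := f ▷ Y ≫ (λ_ Y).hom

theorem splitT_nat (f : A ⟶ B ⊠ D) {Y Z : C} (g : Y ⟶ Z) :
    splitT f Y ≫ B ◁ D ◁ g = A ◁ g ≫ splitT f Z := by
  simp only [splitT, Category.assoc, ← associator_naturality_right]
  rw [whisker_exchange_assoc]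

theorem mergeT_nat (f : A ⊠ B ⟶ D) {Y Z : C} (g : Y ⟶ Z) :
    mergeT f Y ≫ D ◁ g = A ◁ B ◁ g ≫ mergeT f Z := by
  simp only [mergeT, Category.assoc, associator_inv_naturality_right_assoc, whisker_exchange]

theorem squareT_nat (f : A ⊠ B ⟶ D ⊠ E) {Y Z : C} (g : Y ⟶ Z) :
    squareT f Y ≫ D ◁ E ◁ g = A ◁ B ◁ g ≫ squareT f Z := by
  simp only [squareT, Category.assoc, associator_inv_naturality_right_assoc,
    whisker_exchange_assoc, associator_naturality_right]

theorem capT_nat (f : A ⊠ B ⟶ 𝟙_ C) {Y Z : C} (g : Y ⟶ Z) :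
    capT f Y ≫ g = A ◁ B ◁ g ≫ capT f Z := by
  simp only [capT, Category.assoc, associator_inv_naturality_right_assoc,
    whisker_exchange_assoc, leftUnitor_naturality]

theorem unitT_nat (f : 𝟙_ C ⟶ A) {Y Z : C} (g : Y ⟶ Z) :
    unitT f Y ≫ A ◁ g = g ≫ unitT f Z := by
  simp only [unitT, Category.assoc, leftUnitor_inv_naturality_assoc, whisker_exchange]

theorem strand_nat (f : A ⟶ B) {Y Z : C} (g : Y ⟶ Z) : f ▷ Y ≫ B ◁ g = A ◁ g ≫ f ▷ Z :=
  (whisker_exchange f g).symm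

variable [BraidedCategory C]

/-- The braiding of the first two letters of `A ⊗ (B ⊗ Y)`. -/
def swapT (A B Y : C) : A ⊠ B ⊠ Y ⟶ B ⊠ A ⊠ Y := squareT (β_ A B).hom Y

theorem swapT_nat (A B : C) {Y Z : C} (g : Y ⟶ Z) :
    swapT A B Y ≫ B ◁ A ◁ g = A ◁ B ◁ g ≫ swapT A B Z := squareT_nat _ g

/-- Naturality of the braiding. In the lemmas with the suffix `over`, the letter `X` starts on the
left of the letters that the other morphism changes; with the suffix `under`, on their right. -/
theorem strand_over (f : A ⟶ B) (X Y : C) :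
    swapT X A Y ≫ f ▷ (X ⊠ Y) = X ◁ f ▷ Y ≫ swapT X B Y := by
  have h := BraidedCategory.braiding_naturality_right X f
  calc _ = 𝟙 _ ⊗≫ ((β_ X A).hom ≫ f ▷ X) ▷ Y ⊗≫ 𝟙 _ := by
        simp only [swapT, squareT]; monoidal
    _ = _ := by rw [← h]; simp only [swapT, squareT]; monoidal

theorem strand_under (f : A ⟶ B) (X Y : C) :
    swapT A X Y ≫ X ◁ f ▷ Y = f ▷ (X ⊠ Y) ≫ swapT B X Y := by
  have h := BraidedCategory.braiding_naturality_left f X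
  calc _ = 𝟙 _ ⊗≫ ((β_ A X).hom ≫ X ◁ f) ▷ Y ⊗≫ 𝟙 _ := by
        simp only [swapT, squareT]; monoidal
    _ = _ := by rw [← h]; simp only [swapT, squareT]; monoidal

theorem split_over (f : A ⟶ B ⊠ D) (X Y : C) :
    swapT X A Y ≫ splitT f (X ⊠ Y) =
      X ◁ splitT f Y ≫ swapT X B (D ⊠ Y) ≫ B ◁ swapT X D Y := by
  have h := BraidedCategory.braiding_naturality_right X f
  rw [BraidedCategory.braiding_tensor_right_hom] at h
  calc _ = 𝟙 _ ⊗≫ ((β_ X A).hom ≫ f ▷ X) ▷ Y ⊗≫ 𝟙 _ := by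
        simp only [swapT, squareT, splitT]; monoidal
    _ = _ := by rw [← h]; simp only [swapT, squareT, splitT]; monoidal

theorem split_under (f : A ⟶ B ⊠ D) (X Y : C) :
    swapT A X Y ≫ X ◁ splitT f Y =
      splitT f (X ⊠ Y) ≫ B ◁ swapT D X Y ≫ swapT B X (D ⊠ Y) := by
  have h := BraidedCategory.braiding_naturality_left f X
  rw [BraidedCategory.braiding_tensor_left_hom] at h
  calc _ = 𝟙 _ ⊗≫ ((β_ A X).hom ≫ X ◁ f) ▷ Y ⊗≫ 𝟙 _ := by
        simp only [swapT, squareT, splitT]; monoidal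
    _ = _ := by rw [← h]; simp only [swapT, squareT, splitT]; monoidal

theorem merge_over (f : A ⊠ B ⟶ D) (X Y : C) :
    swapT X A (B ⊠ Y) ≫ A ◁ swapT X B Y ≫ mergeT f (X ⊠ Y) =
      X ◁ mergeT f Y ≫ swapT X D Y := by
  have h := BraidedCategory.braiding_naturality_right X f
  rw [BraidedCategory.braiding_tensor_right_hom] at h
  calc _ = 𝟙 _ ⊗≫ (((α_ X A B).inv ≫ (β_ X A).hom ▷ B ≫ (α_ A X B).hom ≫ A ◁ (β_ X B).hom ≫
            (α_ A B X).inv) ≫ f ▷ X) ▷ Y ⊗≫ 𝟙 _ := by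
        simp only [swapT, squareT, mergeT]; monoidal
    _ = _ := by rw [← h]; simp only [swapT, squareT, mergeT]; monoidal

theorem merge_under (f : A ⊠ B ⟶ D) (X Y : C) :
    A ◁ swapT B X Y ≫ swapT A X (B ⊠ Y) ≫ X ◁ mergeT f Y =
      mergeT f (X ⊠ Y) ≫ swapT D X Y := by
  have h := BraidedCategory.braiding_naturality_left f X
  rw [BraidedCategory.braiding_tensor_left_hom] at h
  calc _ = 𝟙 _ ⊗≫ (((α_ A B X).hom ≫ A ◁ (β_ B X).hom ≫ (α_ A X B).inv ≫ (β_ A X).hom ▷ B ≫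
            (α_ X A B).hom) ≫ X ◁ f) ▷ Y ⊗≫ 𝟙 _ := by
        simp only [swapT, squareT, mergeT]; monoidal
    _ = _ := by rw [← h]; simp only [swapT, squareT, mergeT]; monoidal

theorem square_under (f : A ⊠ B ⟶ D ⊠ E) (X Y : C) :
    A ◁ swapT B X Y ≫ swapT A X (B ⊠ Y) ≫ X ◁ squareT f Y =
      squareT f (X ⊠ Y) ≫ D ◁ swapT E X Y ≫ swapT D X (E ⊠ Y) := by
  have h := BraidedCategory.braiding_naturality_left f X
  rw [BraidedCategory.braiding_tensor_left_hom, BraidedCategory.braiding_tensor_left_hom] at h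
  calc _ = 𝟙 _ ⊗≫ (((α_ A B X).hom ≫ A ◁ (β_ B X).hom ≫ (α_ A X B).inv ≫ (β_ A X).hom ▷ B ≫
            (α_ X A B).hom) ≫ X ◁ f) ▷ Y ⊗≫ 𝟙 _ := by
        simp only [swapT, squareT]; monoidal
    _ = _ := by rw [← h]; simp only [swapT, squareT]; monoidal

theorem cap_under (f : A ⊠ B ⟶ 𝟙_ C) (X Y : C) :
    A ◁ swapT B X Y ≫ swapT A X (B ⊠ Y) ≫ X ◁ capT f Y = capT f (X ⊠ Y) := by
  have h := BraidedCategory.braiding_naturality_left f X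
  rw [BraidedCategory.braiding_tensor_left_hom] at h
  calc _ = 𝟙 _ ⊗≫ (((α_ A B X).hom ≫ A ◁ (β_ B X).hom ≫ (α_ A X B).inv ≫ (β_ A X).hom ▷ B ≫
            (α_ X A B).hom) ≫ X ◁ f) ▷ Y ⊗≫ 𝟙 _ := by
        simp only [swapT, squareT, capT]; monoidal
    _ = _ := by
      rw [← h, braiding_tensorUnit_left]; simp only [capT]; monoidal

theorem unit_under (f : 𝟙_ C ⟶ A) (X Y : C) :
    unitT f (X ⊠ Y) ≫ swapT A X Y = X ◁ unitT f Y := by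
  have h := BraidedCategory.braiding_naturality_left f X
  calc _ = 𝟙 _ ⊗≫ (f ▷ X ≫ (β_ A X).hom) ▷ Y ⊗≫ 𝟙 _ := by
        simp only [swapT, squareT, unitT]; monoidal
    _ = _ := by rw [h, braiding_tensorUnit_left]; simp only [unitT]; monoidal

theorem counit_over (f : A ⟶ 𝟙_ C) (X Y : C) :
    swapT X A Y ≫ counitT f (X ⊠ Y) = X ◁ counitT f Y := by
  have h := BraidedCategory.braiding_naturality_right X f
  calc _ = 𝟙 _ ⊗≫ ((β_ X A).hom ≫ f ▷ X) ▷ Y ⊗≫ 𝟙 _ := by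
        simp only [swapT, squareT, counitT]; monoidal
    _ = _ := by rw [← h, braiding_tensorUnit_right]; simp only [counitT]; monoidal

theorem counit_under (f : A ⟶ 𝟙_ C) (X Y : C) :
    swapT A X Y ≫ X ◁ counitT f Y = counitT f (X ⊠ Y) := by
  have h := BraidedCategory.braiding_naturality_left f X
  calc _ = 𝟙 _ ⊗≫ ((β_ A X).hom ≫ X ◁ f) ▷ Y ⊗≫ 𝟙 _ := by
        simp only [swapT, squareT, counitT]; monoidal
    _ = _ := by rw [← h, braiding_tensorUnit_left]; simp only [counitT]; monoidal

/-- The braid relation for the three letters `X`, `A`, `B`. -/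
theorem swap_braid (A B X Y : C) :
    swapT X A (B ⊠ Y) ≫ A ◁ swapT X B Y ≫ swapT A B (X ⊠ Y) =
      X ◁ swapT A B Y ≫ swapT X B (A ⊠ Y) ≫ B ◁ swapT X A Y := by
  have h := BraidedCategory.braiding_naturality_right X (β_ A B).hom
  rw [BraidedCategory.braiding_tensor_right_hom, BraidedCategory.braiding_tensor_right_hom] at h
  calc _ = 𝟙 _ ⊗≫ (((α_ X A B).inv ≫ (β_ X A).hom ▷ B ≫ (α_ A X B).hom ≫ A ◁ (β_ X B).hom ≫
            (α_ A B X).inv) ≫ (β_ A B).hom ▷ X) ▷ Y ⊗≫ 𝟙 _ := by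
        simp only [swapT, squareT]; monoidal
    _ = _ := by rw [← h]; simp only [swapT, squareT]; monoidal

theorem swapT_swapT {A B : C} (h : (β_ A B).hom ≫ (β_ B A).hom = 𝟙 _) (Y : C) :
    swapT A B Y ≫ swapT B A Y = 𝟙 _ := by
  calc _ = 𝟙 _ ⊗≫ ((β_ A B).hom ≫ (β_ B A).hom) ▷ Y ⊗≫ 𝟙 _ := by
        simp only [swapT, squareT]; monoidal
    _ = _ := by rw [h]; monoidal

end Ops

end TailCalculus

end BraidedDuality

/-! ### Hopf objects: opposite structures and the inverse antipode -/

namespace BraidedDuality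

section Pairing

open CategoryTheory MonoidalCategory MonObj ComonObj HopfObj

local infixr:70 " ⊠ " => MonoidalCategoryStruct.tensorObj

universe v u

variable {C : Type u} [Category.{v} C] [MonoidalCategory C] [BraidedCategory C]

section Hopf

variable (H : C) [HopfObj H]

/-- The coopposite comultiplication. -/
def comulOp : H ⟶ H ⊠ H := Δ[H] ≫ (β_ H H).hom

/-- The opposite multiplication. -/
def mulOp : H ⊠ H ⟶ H := (β_ H H).hom ≫ μ[H]

variable {H}

theorem comulOp_tail (Y : C) :
    splitT (comulOp H) Y = splitT Δ[H] Y ≫ swapT H H Y := by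
  simp only [splitT, comulOp, swapT, squareT]; monoidal

theorem mulOp_tail (Y : C) :
    mergeT (mulOp H) Y = swapT H H Y ≫ mergeT μ[H] Y := by
  simp only [mergeT, mulOp, swapT, squareT]; monoidal

theorem comul_comul (Y : C) :
    splitT Δ[H] Y ≫ splitT Δ[H] (H ⊠ Y) = splitT Δ[H] Y ≫ H ◁ splitT Δ[H] Y := by
  have h := ComonObj.comul_assoc H
  calc _ = 𝟙 _ ⊗≫ (Δ[H] ≫ Δ[H] ▷ H ≫ (α_ H H H).hom) ▷ Y ⊗≫ 𝟙 _ := by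
        simp only [splitT]; monoidal
    _ = _ := by rw [← h]; simp only [splitT]; monoidal

theorem mul_mul (Y : C) :
    mergeT μ[H] (H ⊠ Y) ≫ mergeT μ[H] Y = H ◁ mergeT μ[H] Y ≫ mergeT μ[H] Y := by
  have h := MonObj.mul_assoc H
  calc _ = 𝟙 _ ⊗≫ (μ[H] ▷ H ≫ μ[H]) ▷ Y ⊗≫ 𝟙 _ := by
        simp only [mergeT]; monoidal
    _ = _ := by rw [h]; simp only [mergeT]; monoidal

theorem comul_counit_left (Y : C) : splitT Δ[H] Y ≫ counitT ε[H] (H ⊠ Y) = 𝟙 _ := by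
  calc _ = 𝟙 _ ⊗≫ (Δ[H] ≫ ε[H] ▷ H) ▷ Y ⊗≫ 𝟙 _ := by
        simp only [splitT, counitT]; monoidal
    _ = _ := by rw [ComonObj.counit_comul]; monoidal

theorem comul_counit_right (Y : C) : splitT Δ[H] Y ≫ H ◁ counitT ε[H] Y = 𝟙 _ := by
  calc _ = 𝟙 _ ⊗≫ (Δ[H] ≫ H ◁ ε[H]) ▷ Y ⊗≫ 𝟙 _ := by
        simp only [splitT, counitT]; monoidal
    _ = _ := by rw [ComonObj.comul_counit]; monoidal

theorem one_mul_tail (Y : C) : unitT η[H] (H ⊠ Y) ≫ mergeT μ[H] Y = 𝟙 _ := by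
  calc _ = 𝟙 _ ⊗≫ (η[H] ▷ H ≫ μ[H]) ▷ Y ⊗≫ 𝟙 _ := by
        simp only [unitT, mergeT]; monoidal
    _ = _ := by rw [MonObj.one_mul]; monoidal

theorem mul_one_tail (Y : C) : H ◁ unitT η[H] Y ≫ mergeT μ[H] Y = 𝟙 _ := by
  calc _ = 𝟙 _ ⊗≫ (H ◁ η[H] ≫ μ[H]) ▷ Y ⊗≫ 𝟙 _ := by
        simp only [unitT, mergeT]; monoidal
    _ = _ := by rw [MonObj.mul_one]; monoidal

theorem mul_comul_tail (Y : C) :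
    mergeT μ[H] Y ≫ splitT Δ[H] Y = splitT Δ[H] (H ⊠ Y) ≫ H ◁ H ◁ splitT Δ[H] Y ≫
      H ◁ swapT H H (H ⊠ Y) ≫ mergeT μ[H] (H ⊠ H ⊠ Y) ≫ H ◁ mergeT μ[H] Y := by
  have h := BimonObj.mul_comul H
  calc _ = 𝟙 _ ⊗≫ (μ[H] ≫ Δ[H]) ▷ Y ⊗≫ 𝟙 _ := by
        simp only [splitT, mergeT]; monoidal
    _ = _ := by
      rw [h, MonoidalCategory.tensorHom_def, MonoidalCategory.tensorHom_def]
      simp only [splitT, mergeT, swapT, squareT, tensorμ]; monoidal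

theorem antipode_right_tail (Y : C) :
    splitT Δ[H] Y ≫ H ◁ 𝒮[H] ▷ Y ≫ mergeT μ[H] Y = counitT ε[H] Y ≫ unitT η[H] Y := by
  have h := HopfObj.antipode_right H
  calc _ = 𝟙 _ ⊗≫ (Δ[H] ≫ H ◁ 𝒮[H] ≫ μ[H]) ▷ Y ⊗≫ 𝟙 _ := by
        simp only [splitT, mergeT]; monoidal
    _ = _ := by rw [h]; simp only [counitT, unitT]; monoidal

theorem antipode_left_tail (Y : C) :
    splitT Δ[H] Y ≫ 𝒮[H] ▷ (H ⊠ Y) ≫ mergeT μ[H] Y = counitT ε[H] Y ≫ unitT η[H] Y := by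
  have h := HopfObj.antipode_left H
  calc _ = 𝟙 _ ⊗≫ (Δ[H] ≫ 𝒮[H] ▷ H ≫ μ[H]) ▷ Y ⊗≫ 𝟙 _ := by
        simp only [splitT, mergeT]; monoidal
    _ = _ := by rw [h]; simp only [counitT, unitT]; monoidal

theorem one_antipode_tail (Y : C) : unitT η[H] Y ≫ 𝒮[H] ▷ Y = unitT η[H] Y := by
  simp only [unitT, Category.assoc, ← comp_whiskerRight, one_antipode]

theorem mul_antipode_tail (Y : C) :
    mergeT μ[H] Y ≫ 𝒮[H] ▷ Y =
      𝒮[H] ▷ (H ⊠ Y) ≫ H ◁ 𝒮[H] ▷ Y ≫ swapT H H Y ≫ mergeT μ[H] Y := by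
  have h := HopfObj.mul_antipode H
  calc _ = 𝟙 _ ⊗≫ (μ[H] ≫ 𝒮[H]) ▷ Y ⊗≫ 𝟙 _ := by
        simp only [mergeT]; monoidal
    _ = _ := by
      rw [h, MonoidalCategory.tensorHom_def]
      simp only [mergeT, swapT, squareT]; monoidal

theorem comulOp_comulOp (Y : C) :
    splitT (comulOp H) Y ≫ splitT (comulOp H) (H ⊠ Y) =
      splitT (comulOp H) Y ≫ H ◁ splitT (comulOp H) Y := by
  simp only [comulOp_tail, whiskerLeft_comp, Category.assoc]
  rw [comp₂₃ (split_over _ _ _), comp₂₃ (split_under _ _ _), swap_braid, comp₂₂ (comul_comul _)]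

theorem mulOp_mulOp (Y : C) :
    mergeT (mulOp H) (H ⊠ Y) ≫ mergeT (mulOp H) Y =
      H ◁ mergeT (mulOp H) Y ≫ mergeT (mulOp H) Y := by
  simp only [mulOp_tail, whiskerLeft_comp, Category.assoc]
  rw [← reassoc_of% merge_under μ[H] H Y, ← mul_mul, ← reassoc_of% merge_over μ[H] H Y,
    ← reassoc_of% swap_braid H H H Y]

theorem comulOp_counit_left (Y : C) : splitT (comulOp H) Y ≫ counitT ε[H] (H ⊠ Y) = 𝟙 _ := by
  rw [comulOp_tail, Category.assoc, counit_over, comul_counit_right]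

theorem comulOp_counit_right (Y : C) : splitT (comulOp H) Y ≫ H ◁ counitT ε[H] Y = 𝟙 _ := by
  rw [comulOp_tail, Category.assoc, counit_under, comul_counit_left]

theorem comulOp_swap (hH : (β_ H H).hom ≫ (β_ H H).hom = 𝟙 _) (Y : C) :
    splitT (comulOp H) Y ≫ swapT H H Y = splitT Δ[H] Y := by
  rw [comulOp_tail, Category.assoc, swapT_swapT hH, Category.comp_id]

/-- Both sides are the permuted iterated comultiplication `x₁ ⊗ x₃ ⊗ x₂`. -/
theorem comulOp_comul (hH : (β_ H H).hom ≫ (β_ H H).hom = 𝟙 _) (Y : C) :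
    splitT (comulOp H) Y ≫ H ◁ splitT Δ[H] Y ≫ swapT H H (H ⊠ Y) =
    splitT Δ[H] Y ≫ H ◁ splitT (comulOp H) Y := by
  simp only [comulOp_tail, whiskerLeft_comp, Category.assoc]
  rw [comp₂₃ (split_under _ _ _), swapT_swapT hH, Category.comp_id, comp₂₂ (comul_comul Y)]

theorem mul_comulOp (hH : (β_ H H).hom ≫ (β_ H H).hom = 𝟙 _) (Y : C) :
    mergeT μ[H] Y ≫ splitT (comulOp H) Y = splitT (comulOp H) (H ⊠ Y) ≫
      H ◁ H ◁ splitT (comulOp H) Y ≫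
      H ◁ swapT H H (H ⊠ Y) ≫ mergeT μ[H] (H ⊠ H ⊠ Y) ≫ H ◁ mergeT μ[H] Y := by
  have hc (Y : C) : swapT H H Y ≫ swapT H H Y = 𝟙 _ := swapT_swapT hH Y
  have hc' : H ◁ swapT H H (H ⊠ Y) ≫ H ◁ swapT H H (H ⊠ Y) = 𝟙 _ := by
    rw [← whiskerLeft_comp, hc, whiskerLeft_id]
  simp only [comulOp_tail, whiskerLeft_comp, Category.assoc]
  rw [reassoc_of% mul_comul_tail (H := H) Y, ← merge_over, ← reassoc_of% merge_under μ[H] H (H ⊠ Y),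
    reassoc_of% whisk₂₃ H (merge_under μ[H] H Y).symm, reassoc_of% hc', ← mergeT_nat,
    comp₂₂ (swapT_nat H H _), comp₂₂ (swapT_nat H H _), comp₂₂ (swapT_nat H H _)]

variable {Sinv : H ⟶ H}

/-- The inverse of the antipode is an antipode for the opposite multiplication:
`x₂ S⁻¹(x₁) = ε(x)`, up to the braiding. -/
theorem antipode_left_op (hH : (β_ H H).hom ≫ (β_ H H).hom = 𝟙 _)
    (h₁ : Sinv ≫ 𝒮[H] = 𝟙 _) (h₂ : 𝒮[H] ≫ Sinv = 𝟙 _) (Y : C) :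
    splitT Δ[H] Y ≫ Sinv ▷ (H ⊠ Y) ≫ mergeT (mulOp H) Y = counitT ε[H] Y ≫ unitT η[H] Y := by
  have h₃ (Z : C) : Sinv ▷ Z ≫ 𝒮[H] ▷ Z = 𝟙 _ := by rw [← comp_whiskerRight, h₁, id_whiskerRight]
  have h₄ (Z : C) : 𝒮[H] ▷ Z ≫ Sinv ▷ Z = 𝟙 _ := by rw [← comp_whiskerRight, h₂, id_whiskerRight]
  have h : (splitT Δ[H] Y ≫ Sinv ▷ (H ⊠ Y) ≫ mergeT (mulOp H) Y) ≫ 𝒮[H] ▷ Y =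
      (counitT ε[H] Y ≫ unitT η[H] Y) ≫ 𝒮[H] ▷ Y := by
    simp only [mulOp_tail, Category.assoc]
    rw [mul_antipode_tail, comp₂₂ (strand_over 𝒮[H] H Y), comp₂₂ (strand_under 𝒮[H] H Y),
      reassoc_of% swapT_swapT hH, comp₂₂ (strand_nat _ _), reassoc_of% h₃, antipode_right_tail,
      one_antipode_tail]
  have := congrArg (· ≫ Sinv ▷ Y) h
  simpa only [Category.assoc, h₄, Category.comp_id] using this

theorem antipode_right_op (hH : (β_ H H).hom ≫ (β_ H H).hom = 𝟙 _)
    (h₁ : Sinv ≫ 𝒮[H] = 𝟙 _) (h₂ : 𝒮[H] ≫ Sinv = 𝟙 _) (Y : C) :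
    splitT Δ[H] Y ≫ H ◁ Sinv ▷ Y ≫ mergeT (mulOp H) Y = counitT ε[H] Y ≫ unitT η[H] Y := by
  have h₃ (Z : C) : Sinv ▷ Z ≫ 𝒮[H] ▷ Z = 𝟙 _ := by rw [← comp_whiskerRight, h₁, id_whiskerRight]
  have h₄ (Z : C) : 𝒮[H] ▷ Z ≫ Sinv ▷ Z = 𝟙 _ := by rw [← comp_whiskerRight, h₂, id_whiskerRight]
  have h₅ : H ◁ Sinv ▷ Y ≫ H ◁ 𝒮[H] ▷ Y = 𝟙 _ := by rw [← whiskerLeft_comp, h₃, whiskerLeft_id]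
  have h : (splitT Δ[H] Y ≫ H ◁ Sinv ▷ Y ≫ mergeT (mulOp H) Y) ≫ 𝒮[H] ▷ Y =
      (counitT ε[H] Y ≫ unitT η[H] Y) ≫ 𝒮[H] ▷ Y := by
    simp only [mulOp_tail, Category.assoc]
    rw [mul_antipode_tail, comp₂₂ (strand_over 𝒮[H] H Y), comp₂₂ (strand_under 𝒮[H] H Y),
      reassoc_of% swapT_swapT hH, reassoc_of% h₅, antipode_left_tail,
      one_antipode_tail]
  have := congrArg (· ≫ Sinv ▷ Y) h
  simpa only [Category.assoc, h₄, Category.comp_id] using this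

theorem comulOp_antipode (hH : (β_ H H).hom ≫ (β_ H H).hom = 𝟙 _)
    (h₁ : Sinv ≫ 𝒮[H] = 𝟙 _) (h₂ : 𝒮[H] ≫ Sinv = 𝟙 _) (Y : C) :
    splitT (comulOp H) Y ≫ H ◁ Sinv ▷ Y ≫ mergeT μ[H] Y = counitT ε[H] Y ≫ unitT η[H] Y := by
  rw [← antipode_left_op hH h₁ h₂, comulOp_tail, mulOp_tail, Category.assoc,
    comp₂₂ (strand_under Sinv H Y)]

/-- The inverse of the antipode is antimultiplicative up to the braiding. -/
theorem mul_antipodeInv (hH : (β_ H H).hom ≫ (β_ H H).hom = 𝟙 _)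
    (h₁ : Sinv ≫ 𝒮[H] = 𝟙 _) (h₂ : 𝒮[H] ≫ Sinv = 𝟙 _) (Y : C) :
    mergeT μ[H] Y ≫ Sinv ▷ Y =
      Sinv ▷ (H ⊠ Y) ≫ H ◁ Sinv ▷ Y ≫ mergeT (mulOp H) Y := by
  have h₃ (Z : C) : Sinv ▷ Z ≫ 𝒮[H] ▷ Z = 𝟙 _ := by rw [← comp_whiskerRight, h₁, id_whiskerRight]
  have h₄ (Z : C) : 𝒮[H] ▷ Z ≫ Sinv ▷ Z = 𝟙 _ := by rw [← comp_whiskerRight, h₂, id_whiskerRight]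
  have h₅ : H ◁ Sinv ▷ Y ≫ H ◁ 𝒮[H] ▷ Y = 𝟙 _ := by rw [← whiskerLeft_comp, h₃, whiskerLeft_id]
  have h : (Sinv ▷ (H ⊠ Y) ≫ H ◁ Sinv ▷ Y ≫ mergeT (mulOp H) Y) ≫ 𝒮[H] ▷ Y =
      mergeT μ[H] Y := by
    simp only [mulOp_tail, Category.assoc]
    rw [mul_antipode_tail, comp₂₂ (strand_over 𝒮[H] H Y), comp₂₂ (strand_under 𝒮[H] H Y),
      reassoc_of% swapT_swapT hH, reassoc_of% h₅, reassoc_of% h₃]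
  rw [← h, Category.assoc, h₄, Category.comp_id]

end Hopf

end Pairing

end BraidedDuality

/-! ### Nondegenerate Hopf pairings and the smash product `H # U` -/

namespace BraidedDuality

section Pairing

open CategoryTheory MonoidalCategory MonObj ComonObj HopfObj

local infixr:70 " ⊠ " => MonoidalCategoryStruct.tensorObj

universe v u

variable {C : Type u} [Category.{v} C] [MonoidalCategory C] [BraidedCategory C]

/-- The pairing of `U ⊗ U` with `H ⊗ H` induced by a pairing of `U` with `H`: the inner factors are
braided past each other, and then `ev` is applied twice. -/
def evTwo {H U : C} (ev : U ⊠ H ⟶ 𝟙_ C) : (U ⊠ U) ⊠ (H ⊠ H) ⟶ 𝟙_ C :=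
  (α_ U U (H ⊠ H)).hom ≫ U ◁ squareT (β_ U H).hom H ≫ (α_ U H (U ⊠ H)).inv ≫
    (ev ⊗ₘ ev) ≫ (λ_ (𝟙_ C)).hom

/-- A nondegenerate Hopf pairing of an object `U` with the Hopf object `H` whose antipode is
invertible; the braidings among `H` and `U` are symmetric. The operations on `U` are determined by
those of `H`, since elements of `H` separate the morphisms into `Z ⊗ U` (`nondeg`); the axioms of a
Hopf object for `U` follow by duality and need not be assumed. -/
structure HopfPairing (H U : C) [HopfObj H] where
  ev : U ⊠ H ⟶ 𝟙_ C
  mul : U ⊠ U ⟶ U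
  one : 𝟙_ C ⟶ U
  comul : U ⟶ U ⊠ U
  antipode : U ⟶ U
  antipodeInv : H ⟶ H
  antipodeInv_antipode : antipodeInv ≫ 𝒮[H] = 𝟙 _
  antipode_antipodeInv : 𝒮[H] ≫ antipodeInv = 𝟙 _
  symm_HH : (β_ H H).hom ≫ (β_ H H).hom = 𝟙 _
  symm_HU : (β_ H U).hom ≫ (β_ U H).hom = 𝟙 _
  symm_UH : (β_ U H).hom ≫ (β_ H U).hom = 𝟙 _
  symm_UU : (β_ U U).hom ≫ (β_ U U).hom = 𝟙 _
  mul_ev : mul ▷ H ≫ ev = (U ⊠ U) ◁ Δ[H] ≫ evTwo ev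
  one_ev : one ▷ H ≫ ev = (λ_ H).hom ≫ ε[H]
  comul_ev : comul ▷ (H ⊠ H) ≫ evTwo ev = U ◁ μ[H] ≫ ev
  antipode_ev : antipode ▷ H ≫ ev = U ◁ 𝒮[H] ≫ ev
  nondeg : ∀ {X Z : C} (f g : X ⟶ Z ⊠ U), f ▷ H ≫ (α_ Z U H).hom ≫ Z ◁ ev =
    g ▷ H ≫ (α_ Z U H).hom ≫ Z ◁ ev → f = g

namespace HopfPairing

variable {H U : C} [HopfObj H] (P : HopfPairing H U)

theorem evTwo_tail (Y : C) :
    U ◁ swapT U H (H ⊠ Y) ≫ capT P.ev (U ⊠ H ⊠ Y) ≫ capT P.ev Y =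
      𝟙 _ ⊗≫ evTwo P.ev ▷ Y ⊗≫ 𝟙 _ := by
  rw [evTwo, MonoidalCategory.tensorHom_def]
  simp only [swapT, squareT, capT]; monoidal

/-- By the symmetry of the braiding on `H`, the letter `H` may be moved past the pairing from either
side. -/
theorem cap_swap (Y : C) : swapT U H (H ⊠ Y) ≫ H ◁ capT P.ev Y =
    U ◁ swapT H H Y ≫ capT P.ev (H ⊠ Y) := by
  have h : U ◁ swapT H H Y ≫ U ◁ swapT H H Y = 𝟙 _ := by
    rw [← whiskerLeft_comp, swapT_swapT P.symm_HH, whiskerLeft_id]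
  rw [← cap_under, reassoc_of% h]

theorem mul_cap (Y : C) : mergeT P.mul (H ⊠ Y) ≫ capT P.ev Y =
    U ◁ U ◁ splitT (comulOp H) Y ≫ U ◁ capT P.ev (H ⊠ Y) ≫ capT P.ev Y := by
  calc _ = 𝟙 _ ⊗≫ (P.mul ▷ H ≫ P.ev) ▷ Y ⊗≫ 𝟙 _ := by
        simp only [mergeT, capT]; monoidal
    _ = U ◁ U ◁ splitT Δ[H] Y ≫ (𝟙 _ ⊗≫ evTwo P.ev ▷ Y ⊗≫ 𝟙 _) := by
        rw [P.mul_ev]; simp only [splitT]; monoidal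
    _ = _ := by
      rw [← evTwo_tail, capT_nat P.ev (capT P.ev Y), comulOp_tail,
        reassoc_of% whisk₂₂ U (P.cap_swap Y)]
      simp only [whiskerLeft_comp, Category.assoc]

theorem comul_cap (Y : C) : splitT P.comul (H ⊠ H ⊠ Y) ≫ U ◁ capT P.ev (H ⊠ Y) ≫ capT P.ev Y =
    U ◁ mergeT (mulOp H) Y ≫ capT P.ev Y := by
  have h : splitT P.comul (H ⊠ H ⊠ Y) ≫ U ◁ swapT U H (H ⊠ Y) ≫ U ◁ H ◁ capT P.ev Y ≫
      capT P.ev Y = U ◁ mergeT μ[H] Y ≫ capT P.ev Y := by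
    rw [← capT_nat, evTwo_tail]
    calc _ = 𝟙 _ ⊗≫ (P.comul ▷ (H ⊠ H) ≫ evTwo P.ev) ▷ Y ⊗≫ 𝟙 _ := by
          simp only [splitT]; monoidal
      _ = _ := by rw [P.comul_ev]; simp only [mergeT, capT]; monoidal
  rw [reassoc_of% whisk₂₂ U (P.cap_swap Y), comp₂₂ (splitT_nat _ _)] at h
  have h₂ : U ◁ swapT H H Y ≫ U ◁ swapT H H Y = 𝟙 _ := by
    rw [← whiskerLeft_comp, swapT_swapT P.symm_HH, whiskerLeft_id]
  rw [mulOp_tail, whiskerLeft_comp, Category.assoc, ← h, reassoc_of% h₂]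

theorem one_cap (Y : C) : unitT P.one (H ⊠ Y) ≫ capT P.ev Y = counitT ε[H] Y := by
  calc _ = 𝟙 _ ⊗≫ (P.one ▷ H ≫ P.ev) ▷ Y ⊗≫ 𝟙 _ := by
        simp only [unitT, capT]; monoidal
    _ = _ := by rw [P.one_ev]; simp only [counitT]; monoidal

theorem antipode_cap (Y : C) : P.antipode ▷ (H ⊠ Y) ≫ capT P.ev Y =
    U ◁ 𝒮[H] ▷ Y ≫ capT P.ev Y := by
  calc _ = 𝟙 _ ⊗≫ (P.antipode ▷ H ≫ P.ev) ▷ Y ⊗≫ 𝟙 _ := by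
        simp only [capT]; monoidal
    _ = _ := by rw [P.antipode_ev]; simp only [capT]; monoidal

/-- The action `f ⇀ x = x₁ ⟨f, x₂⟩` of `U` on `H`, written with the opposite comultiplication; the
braidings make sense of the order of the letters. -/
def arrow : U ⊠ H ⟶ H :=
  U ◁ comulOp H ≫ (α_ U H H).inv ≫ P.ev ▷ H ≫ (λ_ H).hom

theorem arrow_tail (Y : C) :
    mergeT P.arrow Y = U ◁ splitT (comulOp H) Y ≫ capT P.ev (H ⊠ Y) := by
  simp only [mergeT, arrow, splitT, capT]; monoidal

/-- The action `f ⊗ x ↦ ⟨f, x₁⟩ x₂` of `U` on `H`, that is, `ρ(f # 1)(x)`. -/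
def rhoMap : U ⊠ H ⟶ H :=
  U ◁ Δ[H] ≫ (α_ U H H).inv ≫ P.ev ▷ H ≫ (λ_ H).hom

theorem rhoMap_tail (Y : C) :
    mergeT P.rhoMap Y = U ◁ splitT Δ[H] Y ≫ capT P.ev (H ⊠ Y) := by
  simp only [mergeT, rhoMap, splitT, capT]; monoidal

theorem mul_arrow (Y : C) :
    mergeT P.mul (H ⊠ Y) ≫ mergeT P.arrow Y = U ◁ mergeT P.arrow Y ≫ mergeT P.arrow Y := by
  simp only [arrow_tail, whiskerLeft_comp, Category.assoc]
  rw [comp₂₂ (mergeT_nat P.mul _), mul_cap,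
    ← reassoc_of% whisk₂₂ U (capT_nat P.ev (splitT (comulOp H) Y)).symm,
    comp₂₂ (whisk₂₂ U (whisk₂₂ U (comulOp_comulOp Y)))]

theorem one_arrow (Y : C) : unitT P.one (H ⊠ Y) ≫ mergeT P.arrow Y = 𝟙 _ := by
  rw [arrow_tail, comp₂₂ (unitT_nat _ _), one_cap, comulOp_counit_left]

theorem mul_cap_right (Y : C) : U ◁ mergeT μ[H] Y ≫ capT P.ev Y =
    splitT P.comul (H ⊠ H ⊠ Y) ≫ U ◁ swapT U H (H ⊠ Y) ≫ capT P.ev (U ⊠ H ⊠ Y) ≫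
      capT P.ev Y := by
  have h₂ : U ◁ swapT H H Y ≫ U ◁ swapT H H Y = 𝟙 _ := by
    rw [← whiskerLeft_comp, swapT_swapT P.symm_HH, whiskerLeft_id]
  have h := P.comul_cap Y
  rw [mulOp_tail, whiskerLeft_comp, Category.assoc] at h
  rw [capT_nat P.ev (capT P.ev Y), reassoc_of% whisk₂₂ U (P.cap_swap Y), comp₂₂ (splitT_nat _ _), h,
    reassoc_of% h₂]

/-- The action `⇀` makes `H` a `U`-module algebra: `f ⇀ (x y) = (f₁ ⇀ x) (f₂ ⇀ y)`. -/
theorem arrow_mul (Y : C) :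
    U ◁ mergeT μ[H] Y ≫ mergeT P.arrow Y =
      splitT P.comul (H ⊠ H ⊠ Y) ≫ U ◁ swapT U H (H ⊠ Y) ≫ mergeT P.arrow (U ⊠ H ⊠ Y) ≫
        H ◁ mergeT P.arrow Y ≫ mergeT μ[H] Y := by
  have h := congrArg (U ◁ ·) (mul_comulOp P.symm_HH Y)
  simp only [whiskerLeft_comp] at h
  simp only [arrow_tail, whiskerLeft_comp, Category.assoc]
  rw [reassoc_of% h, ← capT_nat, reassoc_of% P.mul_cap_right, ← comp₂₂ (splitT_nat _ _),
    ← comp₂₂ (splitT_nat _ _), ← comp₂₂ (splitT_nat _ _)]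
  rw [comp₂₃ (whisk₂₃ U (split_over (comulOp H) U (H ⊠ Y))), ← comp₂₂ (capT_nat _ _),
    comp₂₂ (swapT_nat U H _), comp₂₂ (P.cap_swap _),
    comp₂₂ (capT_nat P.ev (U ◁ H ◁ splitT (comulOp H) Y)),
    comp₂₂ (capT_nat P.ev (U ◁ swapT H H (H ⊠ Y))),
    ← comp₂₂ (whisk₂₂ U (swapT_nat U H _)), ← comp₂₂ (whisk₂₂ U (swapT_nat U H _))]

/-- The commutation rule `f ⊗ x ↦ (f₁ ⇀ x) ⊗ f₂` of the smash product `H # U`. -/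
def twist : U ⊠ H ⟶ H ⊠ U :=
  P.comul ▷ H ≫ (α_ U U H).hom ≫ U ◁ (β_ U H).hom ≫ (α_ U H U).inv ≫ P.arrow ▷ U

theorem twist_tail (Y : C) : squareT P.twist Y =
    splitT P.comul (H ⊠ Y) ≫ U ◁ swapT U H Y ≫ mergeT P.arrow (U ⊠ Y) := by
  simp only [squareT, twist, splitT, swapT, mergeT]; monoidal

/-- The multiplication of the smash product `H # U`. -/
def smashMul : (H ⊠ U) ⊠ (H ⊠ U) ⟶ H ⊠ U :=
  (α_ H U (H ⊠ U)).hom ≫ H ◁ squareT P.twist U ≫ mergeT μ[H] (U ⊠ U) ≫ H ◁ P.mul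

/-- The representation `λ : (H # U) ⊗ H ⟶ H`, `λ(h # f)(x) = h (f ⇀ x)`. -/
def lamMap : (H ⊠ U) ⊠ H ⟶ H := (α_ H U H).hom ≫ H ◁ P.arrow ≫ μ[H]

/-- The multiplication of `H # U` in front of a word. -/
def smashT (Y : C) : H ⊠ U ⊠ H ⊠ U ⊠ Y ⟶ H ⊠ U ⊠ Y :=
  H ◁ squareT P.twist (U ⊠ Y) ≫ mergeT μ[H] (U ⊠ U ⊠ Y) ≫ H ◁ mergeT P.mul Y

/-- The representation `λ` of `H # U` on `H`, in front of a word. -/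
def lamT (Y : C) : H ⊠ U ⊠ H ⊠ Y ⟶ H ⊠ Y := H ◁ mergeT P.arrow Y ≫ mergeT μ[H] Y

theorem smashT_nat {Y Z : C} (g : Y ⟶ Z) :
    P.smashT Y ≫ H ◁ U ◁ g = H ◁ U ◁ H ◁ U ◁ g ≫ P.smashT Z := by
  simp only [smashT, Category.assoc]
  rw [whisk₂₂ H (mergeT_nat P.mul g), comp₂₂ (mergeT_nat _ _),
    comp₂₂ (whisk₂₂ H (squareT_nat _ (U ◁ g)))]

theorem twist_arrow (Y : C) : squareT P.twist (H ⊠ Y) ≫ P.lamT Y =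
    U ◁ mergeT μ[H] Y ≫ mergeT P.arrow Y := by
  rw [arrow_mul, lamT, twist_tail, Category.assoc, Category.assoc]

theorem twist_mul_arrow (Y : C) : squareT P.twist (U ⊠ H ⊠ Y) ≫ H ◁ mergeT P.mul (H ⊠ Y) ≫
    P.lamT Y = U ◁ P.lamT Y ≫ mergeT P.arrow Y := by
  rw [lamT, comp₂₂ (whisk₂₂ H (P.mul_arrow Y)), ← lamT, comp₂₂ (squareT_nat _ _), twist_arrow, lamT,
    whiskerLeft_comp, Category.assoc]

theorem mul_lamT (Y : C) : mergeT μ[H] (U ⊠ H ⊠ Y) ≫ P.lamT Y =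
    H ◁ P.lamT Y ≫ mergeT μ[H] Y := by
  rw [lamT, comp₂₂ (mergeT_nat _ _), mul_mul, whiskerLeft_comp, Category.assoc]

/-- The map `λ` is multiplicative. -/
theorem smashT_lamT (Y : C) : P.smashT (H ⊠ Y) ≫ P.lamT Y =
    H ◁ U ◁ P.lamT Y ≫ P.lamT Y := by
  have h := congrArg (H ◁ ·) (P.twist_mul_arrow Y)
  simp only [whiskerLeft_comp] at h
  simp only [smashT, Category.assoc]
  rw [comp₂₂ (mergeT_nat μ[H] _), mul_lamT, reassoc_of% h]
  rfl

theorem one_lamT (Y : C) : unitT P.one (H ⊠ Y) ≫ unitT η[H] (U ⊠ H ⊠ Y) ≫ P.lamT Y = 𝟙 _ := by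
  rw [lamT, comp₂₂ (unitT_nat _ _), one_mul_tail, Category.comp_id, one_arrow]

/-- An element of `H # U` is recovered from its image under `λ`:
`h ⟨f, x⟩ = λ(h # f)(x₁) S⁻¹(x₂)`, where `x₁ ⊗ x₂` is the opposite comultiplication. -/
theorem lamT_antipodeInv (Y : C) : H ◁ U ◁ splitT (comulOp H) Y ≫ P.lamT (H ⊠ Y) ≫
    H ◁ P.antipodeInv ▷ Y ≫ mergeT μ[H] Y = H ◁ capT P.ev Y := by
  have h := congrArg (fun t => H ◁ U ◁ H ◁ t) (comulOp_antipode P.symm_HH P.antipodeInv_antipode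
    P.antipode_antipodeInv Y)
  have h₂ := congrArg (fun t => H ◁ U ◁ t) (comulOp_counit_right (H := H) Y)
  have h₃ := whisk₂₂ H (capT_nat P.ev (unitT η[H] Y))
  simp only [whiskerLeft_comp, whiskerLeft_id] at h h₂
  simp only [lamT, arrow_tail, whiskerLeft_comp, Category.assoc]
  rw [comp₂₂ (mergeT_nat μ[H] _), mul_mul, comp₂₂ (whisk₂₂ H (capT_nat P.ev _)),
    comp₂₂ (whisk₂₂ H (capT_nat P.ev _)), comp₂₂ (whisk₂₂ H (whisk₂₂ U (comulOp_comulOp Y)))]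
  rw [reassoc_of% h, reassoc_of% h₂, ← reassoc_of% h₃, mul_one_tail, Category.comp_id]

/-- The statement of `lamT_antipodeInv` without a tail. -/
theorem lamMap_eq : (H ⊠ U) ◁ comulOp H ≫ (α_ _ _ _).inv ≫ P.lamMap ▷ H ≫
    H ◁ P.antipodeInv ≫ μ[H] ≫ (ρ_ H).inv = (α_ H U H).hom ≫ H ◁ P.ev := by
  calc _ = 𝟙 _ ⊗≫ (H ◁ U ◁ splitT (comulOp H) (𝟙_ C) ≫ P.lamT (H ⊠ 𝟙_ C) ≫
    H ◁ P.antipodeInv ▷ 𝟙_ C ≫ mergeT μ[H] (𝟙_ C)) ⊗≫ 𝟙 _ := by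
        simp only [lamMap, lamT, splitT, mergeT]; monoidal
    _ = _ := by
      rw [lamT_antipodeInv]; simp only [capT]; monoidal

/-- The representation `λ` of `H # U` on `H` is faithful. -/
theorem lamMap_injective {X : C} {f g : X ⟶ H ⊠ U}
    (h : f ▷ H ≫ P.lamMap = g ▷ H ≫ P.lamMap) : f = g := by
  apply P.nondeg
  have key (f : X ⟶ H ⊠ U) : f ▷ H ≫ (α_ H U H).hom ≫ H ◁ P.ev = X ◁ comulOp H ≫
      (α_ _ _ _).inv ≫ (f ▷ H ≫ P.lamMap) ▷ H ≫ H ◁ P.antipodeInv ≫ μ[H] ≫ (ρ_ H).inv := by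
    rw [← lamMap_eq, ← whisker_exchange_assoc, associator_inv_naturality_left_assoc,
      comp_whiskerRight, Category.assoc]
  rw [key, key, h]

/-- Two morphisms into `H # U` are equal if they act in the same way on `H`. -/
theorem splitT_ext {X : C} {f g : X ⟶ H ⊠ U} (h : splitT f (H ⊠ 𝟙_ C) ≫ P.lamT (𝟙_ C) =
    splitT g (H ⊠ 𝟙_ C) ≫ P.lamT (𝟙_ C)) : f = g := by
  apply P.lamMap_injective
  have key (f : X ⟶ H ⊠ U) : f ▷ H ≫ P.lamMap =
      𝟙 _ ⊗≫ (splitT f (H ⊠ 𝟙_ C) ≫ P.lamT (𝟙_ C)) ⊗≫ 𝟙 _ := by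
    simp only [lamMap, lamT, splitT, mergeT]; monoidal
  rw [key, key, h]

theorem squareT_ext {X Z : C} {f g : X ⊠ Z ⟶ H ⊠ U} (h : squareT f (H ⊠ 𝟙_ C) ≫ P.lamT (𝟙_ C) =
    squareT g (H ⊠ 𝟙_ C) ≫ P.lamT (𝟙_ C)) : f = g := by
  apply P.splitT_ext
  have key (f : X ⊠ Z ⟶ H ⊠ U) : splitT f (H ⊠ 𝟙_ C) =
      (α_ X Z (H ⊠ 𝟙_ C)).hom ≫ squareT f (H ⊠ 𝟙_ C) := by
    simp only [squareT, splitT]; monoidal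
  rw [key, key, Category.assoc, h, Category.assoc]

end HopfPairing

end Pairing

end BraidedDuality

/-! ### The morphism `j` with `λ(j f) = ρ(f # 1)` -/

namespace BraidedDuality

section RL

open CategoryTheory MonoidalCategory MonObj ComonObj HopfObj

local infixr:70 " ⊠ " => MonoidalCategoryStruct.tensorObj

universe v u

variable {C : Type u} [Category.{v} C] [MonoidalCategory C] [BraidedCategory C]

namespace HopfPairing

variable {H U : C} [HopfObj H] (P : HopfPairing H U)

/-- The simultaneous pairing of two elements of `U` with two elements of `H` is symmetric. -/
theorem swap_cap_cap (Y : C) : swapT U U (H ⊠ H ⊠ Y) ≫ U ◁ capT P.ev (H ⊠ Y) ≫ capT P.ev Y =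
    U ◁ U ◁ swapT H H Y ≫ U ◁ capT P.ev (H ⊠ Y) ≫ capT P.ev Y := by
  have h₂ : U ◁ swapT U H (H ⊠ Y) ≫ U ◁ swapT H U (H ⊠ Y) = 𝟙 _ := by
    rw [← whiskerLeft_comp, swapT_swapT P.symm_UH, whiskerLeft_id]
  have h : swapT U U (H ⊠ H ⊠ Y) ≫ U ◁ capT P.ev (H ⊠ Y) =
      U ◁ swapT U H (H ⊠ Y) ≫ capT P.ev (U ⊠ H ⊠ Y) := by
    rw [← cap_under P.ev U (H ⊠ Y), reassoc_of% h₂]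
  rw [reassoc_of% h, capT_nat P.ev (capT P.ev Y), reassoc_of% whisk₂₂ U (P.cap_swap Y)]

variable {j : U ⟶ H ⊠ U}

/-- The element `j(f)` of `H # U` acts on `H` as `ρ(f # 1)`. -/
theorem split_lamT (hj : j ▷ H ≫ P.lamMap = P.rhoMap) (Y : C) :
    splitT j (H ⊠ Y) ≫ P.lamT Y = mergeT P.rhoMap Y := by
  calc _ = 𝟙 _ ⊗≫ (j ▷ H ≫ P.lamMap) ▷ Y ⊗≫ 𝟙 _ := by
        simp only [lamMap, lamT, splitT, mergeT]; monoidal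
    _ = _ := by rw [hj]; simp only [mergeT]; monoidal

theorem split_smashT_lamT (hj : j ▷ H ≫ P.lamMap = P.rhoMap) (Y : C) :
    splitT j (H ⊠ U ⊠ H ⊠ Y) ≫ P.smashT (H ⊠ Y) ≫ P.lamT Y =
      U ◁ P.lamT Y ≫ mergeT P.rhoMap Y := by
  rw [smashT_lamT, comp₂₂ (splitT_nat _ _), P.split_lamT hj]

/-- The morphism `j` is antimultiplicative up to the braiding: `j(f) j(g) = j(g f)`. -/
theorem swap_mul_split (hj : j ▷ H ≫ P.lamMap = P.rhoMap) (Y : C) :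
    swapT U U Y ≫ mergeT P.mul Y ≫ splitT j Y =
      U ◁ splitT j Y ≫ splitT j (H ⊠ U ⊠ Y) ≫ P.smashT Y := by
  have h₁ (Y : C) : swapT U U Y ≫ mergeT P.mul Y ≫ splitT j Y =
      squareT ((β_ U U).hom ≫ P.mul ≫ j) Y := by
    simp only [squareT, swapT, mergeT, splitT]; monoidal
  have h₂ (Y : C) : U ◁ splitT j Y ≫ splitT j (H ⊠ U ⊠ Y) ≫ P.smashT Y =
      squareT (U ◁ j ≫ j ▷ (H ⊠ U) ≫ P.smashMul) Y := by
    simp only [smashT, smashMul, squareT, mergeT, splitT]; monoidal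
  rw [h₁, h₂]
  congr 1
  have h₃ := congrArg (fun t => U ◁ U ◁ t) (comulOp_swap (H := H) P.symm_HH (H ⊠ 𝟙_ C))
  simp only [whiskerLeft_comp] at h₃
  apply P.squareT_ext
  simp only [← h₁, ← h₂, Category.assoc]
  rw [P.split_smashT_lamT hj, P.split_lamT hj,
    ← reassoc_of% whisk₁₂ U (P.split_lamT hj (𝟙_ C)).symm]
  simp only [rhoMap_tail, whiskerLeft_comp, Category.assoc]
  rw [comp₂₂ (mergeT_nat P.mul _), mul_cap, comp₂₂ (swapT_nat U U _), comp₂₂ (swapT_nat U U _),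
    swap_cap_cap, reassoc_of% h₃, comp₂₂ (whisk₂₂ U (whisk₂₂ U (comul_comul _))),
    comp₂₂ (whisk₂₂ U (capT_nat P.ev _))]

/-- The elements `j(g)` commute, up to the braiding, with the elements of `1 # U`, because the two
actions of `U` on `H` by left and right translations commute. -/
theorem swap_split_mul (hj : j ▷ H ≫ P.lamMap = P.rhoMap) (Y : C) :
    swapT U U Y ≫ splitT j (U ⊠ Y) ≫ H ◁ mergeT P.mul Y =
      U ◁ splitT j Y ≫ squareT P.twist (U ⊠ Y) ≫ H ◁ mergeT P.mul Y := by
  have h₁ (Y : C) : swapT U U Y ≫ splitT j (U ⊠ Y) ≫ H ◁ mergeT P.mul Y =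
      squareT ((β_ U U).hom ≫ j ▷ U ≫ (α_ H U U).hom ≫ H ◁ P.mul) Y := by
    simp only [squareT, swapT, mergeT, splitT]; monoidal
  have h₂ (Y : C) : U ◁ splitT j Y ≫ squareT P.twist (U ⊠ Y) ≫ H ◁ mergeT P.mul Y =
      squareT (U ◁ j ≫ (α_ U H U).inv ≫ P.twist ▷ U ≫ (α_ H U U).hom ≫ H ◁ P.mul) Y := by
    simp only [squareT, mergeT, splitT]; monoidal
  rw [h₁, h₂]
  congr 1
  have h₃ : H ◁ mergeT P.mul (H ⊠ 𝟙_ C) ≫ P.lamT (𝟙_ C) =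
      H ◁ U ◁ mergeT P.arrow (𝟙_ C) ≫ P.lamT (𝟙_ C) := by
    rw [lamT, comp₂₂ (whisk₂₂ H (P.mul_arrow _))]
  have h₄ := congrArg (fun t => U ◁ U ◁ t) (comulOp_comul P.symm_HH (𝟙_ C))
  simp only [whiskerLeft_comp] at h₄
  apply P.squareT_ext
  simp only [← h₁, ← h₂, Category.assoc]
  rw [twist_mul_arrow, h₃, comp₂₂ (splitT_nat _ _), P.split_lamT hj,
    ← reassoc_of% whisk₁₂ U (P.split_lamT hj (𝟙_ C)).symm]
  simp only [rhoMap_tail, arrow_tail, whiskerLeft_comp, Category.assoc]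
  rw [comp₂₂ (whisk₂₂ U (capT_nat P.ev _)), comp₂₂ (whisk₂₂ U (capT_nat P.ev _)),
    comp₂₂ (swapT_nat U U _),
    comp₂₂ (swapT_nat U U _), swap_cap_cap, reassoc_of% h₄]

/-- `⟨f, (x y)₁⟩ (x y)₂ = ⟨f₁, x₁⟩ x₂ ⟨f₂, y₁⟩ y₂` up to the braiding. -/
theorem mul_rhoMap (Y : C) : U ◁ mergeT μ[H] Y ≫ mergeT P.rhoMap Y =
    splitT P.comul (H ⊠ H ⊠ Y) ≫ U ◁ U ◁ splitT Δ[H] (H ⊠ Y) ≫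
      U ◁ swapT U H (H ⊠ H ⊠ Y) ≫ capT P.ev (U ⊠ H ⊠ H ⊠ Y) ≫ swapT U H (H ⊠ Y) ≫
      H ◁ mergeT P.rhoMap Y ≫ mergeT μ[H] Y := by
  have h := congrArg (U ◁ ·) (mul_comul_tail (H := H) Y)
  simp only [whiskerLeft_comp] at h
  simp only [rhoMap_tail, whiskerLeft_comp, Category.assoc]
  rw [reassoc_of% h, ← capT_nat, reassoc_of% P.mul_cap_right, ← comp₂₂ (splitT_nat _ _),
    ← comp₂₂ (splitT_nat _ _), ← comp₂₂ (splitT_nat _ _)]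
  rw [comp₂₂ (swapT_nat U H _), comp₂₂ (P.cap_swap _),
    comp₂₂ (capT_nat P.ev (U ◁ H ◁ splitT Δ[H] Y)), comp₂₂ (capT_nat P.ev (U ◁ swapT H H (H ⊠ Y))),
    comp₂₂ (whisk₂₂ U (swapT_nat U H _)), comp₂₂ (whisk₂₂ U (swapT_nat U H _))]

theorem swap_comul_comul_cap (Y : C) :
    swapT U H Y ≫ splitT Δ[H] (U ⊠ Y) ≫ H ◁ H ◁ splitT P.comul Y ≫ H ◁ swapT H U (U ⊠ Y) ≫
      swapT H U (H ⊠ U ⊠ Y) ≫ capT P.ev (H ⊠ U ⊠ Y) =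
    splitT P.comul (H ⊠ Y) ≫ U ◁ U ◁ splitT Δ[H] Y ≫
      U ◁ swapT U H (H ⊠ Y) ≫ capT P.ev (U ⊠ H ⊠ Y) ≫ swapT U H Y := by
  have h₁ : H ◁ swapT U H (U ⊠ Y) ≫ H ◁ swapT H U (U ⊠ Y) = 𝟙 _ := by
    rw [← whiskerLeft_comp, swapT_swapT P.symm_UH, whiskerLeft_id]
  rw [comp₂₃ (split_over _ _ _), comp₂₃ (whisk₂₃ H (split_under _ _ _)), reassoc_of% h₁,
    comp₂₃ (split_under _ _ _), comp₂₂ (swapT_nat U H _), reassoc_of% swapT_swapT P.symm_UH,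
    ← capT_nat, comp₂₂ (splitT_nat _ _)]

/-- The commutation rule for `j(f)` and the elements of `H # 1`, up to the braiding:
`j(f) (h # 1) = ⟨f₁, h₁⟩ (h₂ # 1) j(f₂)`. -/
theorem comul_comul_cap_split (hj : j ▷ H ≫ P.lamMap = P.rhoMap) (Y : C) :
    splitT Δ[H] (U ⊠ Y) ≫ H ◁ H ◁ splitT P.comul Y ≫ H ◁ swapT H U (U ⊠ Y) ≫
      swapT H U (H ⊠ U ⊠ Y) ≫ capT P.ev (H ⊠ U ⊠ Y) ≫ H ◁ splitT j Y ≫ mergeT μ[H] (U ⊠ Y) =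
    swapT H U Y ≫ splitT j (H ⊠ Y) ≫ H ◁ squareT P.twist Y ≫ mergeT μ[H] (U ⊠ Y) := by
  have h₁ (Y : C) : splitT P.comul (H ⊠ Y) ≫ U ◁ U ◁ splitT Δ[H] Y ≫ U ◁ swapT U H (H ⊠ Y) ≫
      capT P.ev (U ⊠ H ⊠ Y) ≫ swapT U H Y ≫ H ◁ splitT j Y ≫ mergeT μ[H] (U ⊠ Y) =
      squareT (P.comul ▷ H ≫ (α_ U U H).hom ≫ U ◁ U ◁ Δ[H] ≫ U ◁ swapT U H H ≫
        capT P.ev (U ⊠ H) ≫ (β_ U H).hom ≫ H ◁ j ≫ mergeT μ[H] U) Y := by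
    simp only [squareT, swapT, mergeT, splitT, capT]; monoidal
  have h₂ (Y : C) : splitT j (H ⊠ Y) ≫ H ◁ squareT P.twist Y ≫ mergeT μ[H] (U ⊠ Y) =
      squareT (j ▷ H ≫ (α_ H U H).hom ≫ H ◁ P.twist ≫ mergeT μ[H] U) Y := by
    simp only [squareT, mergeT, splitT]; monoidal
  have key : splitT P.comul (H ⊠ Y) ≫ U ◁ U ◁ splitT Δ[H] Y ≫ U ◁ swapT U H (H ⊠ Y) ≫
      capT P.ev (U ⊠ H ⊠ Y) ≫ swapT U H Y ≫ H ◁ splitT j Y ≫ mergeT μ[H] (U ⊠ Y) =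
      splitT j (H ⊠ Y) ≫ H ◁ squareT P.twist Y ≫ mergeT μ[H] (U ⊠ Y) := by
    rw [h₁, h₂]
    congr 1
    apply P.squareT_ext
    simp only [← h₁, ← h₂, Category.assoc]
    rw [mul_lamT, ← reassoc_of% whisk₁₂ H (P.split_lamT hj (𝟙_ C)).symm, ← mul_rhoMap,
      reassoc_of% whisk₂₂ H (P.twist_arrow (𝟙_ C)), ← lamT, comp₂₂ (splitT_nat _ _),
      P.split_lamT hj]
  have h₃ := P.swap_comul_comul_cap Y
  rw [← key, ← reassoc_of% h₃, reassoc_of% swapT_swapT P.symm_HU]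

/-- The endomorphism of `U` transposed to the square of the inverse antipode of `H`; see
`doubleAntipodeInv_cap`. The object `U` is not assumed to be closed under the transpose of `S⁻¹`;
that it is closed under that of `S⁻²` follows from the existence of `j`. -/
def doubleAntipodeInv (j : U ⟶ H ⊠ U) : U ⟶ U :=
  P.comul ≫ U ◁ j ≫ U ◁ P.antipodeInv ▷ U ≫ capT P.ev U

theorem doubleAntipodeInv_cap (hj : j ▷ H ≫ P.lamMap = P.rhoMap) (Y : C) :
    P.doubleAntipodeInv j ▷ (H ⊠ Y) ≫ capT P.ev Y =
      U ◁ P.antipodeInv ▷ Y ≫ U ◁ P.antipodeInv ▷ Y ≫ capT P.ev Y := by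
  have h₁ (Y : C) : P.doubleAntipodeInv j ▷ Y = splitT P.comul Y ≫ U ◁ splitT j Y ≫
      U ◁ P.antipodeInv ▷ (U ⊠ Y) ≫ capT P.ev (U ⊠ Y) := by
    simp only [doubleAntipodeInv, splitT, capT]; monoidal
  have h₂ : splitT j (H ⊠ Y) ≫ H ◁ capT P.ev Y =
      U ◁ splitT (comulOp H) Y ≫ U ◁ splitT Δ[H] (H ⊠ Y) ≫
        U ◁ H ◁ H ◁ P.antipodeInv ▷ Y ≫ U ◁ H ◁ mergeT μ[H] Y ≫ capT P.ev (H ⊠ Y) := by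
    rw [← lamT_antipodeInv, comp₂₂ (splitT_nat _ _), reassoc_of% P.split_lamT hj, rhoMap_tail]
    simp only [Category.assoc]
    rw [comp₂₂ (capT_nat _ _), capT_nat]
  have h₃ : splitT (comulOp H) Y ≫ splitT Δ[H] (H ⊠ Y) ≫ H ◁ H ◁ P.antipodeInv ▷ Y ≫
      H ◁ mergeT μ[H] Y ≫ H ◁ P.antipodeInv ▷ Y ≫ mergeT (mulOp H) Y =
      P.antipodeInv ▷ Y ≫ P.antipodeInv ▷ Y := by
    have h₄ := antipode_right_op P.symm_HH P.antipodeInv_antipode P.antipode_antipodeInv (H ⊠ Y)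
    have h₅ : unitT η[H] (H ⊠ Y) ≫ mergeT (mulOp H) Y = 𝟙 _ := by
      rw [mulOp_tail, reassoc_of% unit_under, mul_one_tail]
    rw [comp₂₃ (whisk₂₃ H (mul_antipodeInv P.symm_HH P.antipodeInv_antipode P.antipode_antipodeInv
      Y)),
      ← mulOp_mulOp, ← comp₂₂ (whisk₂₂ H (strand_nat P.antipodeInv (P.antipodeInv ▷ Y))),
      ← comp₂₂ (mergeT_nat _ _), ← comp₂₂ (mergeT_nat _ _), reassoc_of% h₄,
      reassoc_of% comulOp_counit_left, comp₂₂ (unitT_nat _ _), comp₂₂ (unitT_nat _ _), h₅,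
      Category.comp_id]
  have h₆ := congrArg (U ◁ ·) h₂
  have h₇ := congrArg (U ◁ ·) h₃
  simp only [whiskerLeft_comp] at h₆ h₇
  rw [h₁]
  simp only [Category.assoc]
  rw [capT_nat P.ev (capT P.ev Y), comp₂₂ (whisk₂₂ U (strand_nat P.antipodeInv (capT P.ev Y))),
    reassoc_of% h₆, comp₂₂ (whisk₂₂ U (capT_nat P.ev (P.antipodeInv ▷ Y))), comp₂₂ (splitT_nat _ _),
    comp₂₂ (splitT_nat _ _), comp₂₂ (splitT_nat _ _), comp₂₂ (splitT_nat _ _),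
    comp₂₂ (splitT_nat _ _),
    comul_cap, reassoc_of% h₇]

/-- The convolution inverse `f ↦ j(f ∘ S⁻¹)` of `j`, where `f ∘ S⁻¹` is obtained as `(f ∘ S⁻²) ∘ S`;
it acts on `H` by `x ↦ ⟨f, S⁻¹(x₁)⟩ x₂`, see `splitInv_lamT`. -/
def splitInv (j : U ⟶ H ⊠ U) : U ⟶ H ⊠ U := P.doubleAntipodeInv j ≫ P.antipode ≫ j

/-- The counit `f ↦ ⟨f, 1⟩` of `U`. -/
def counit : U ⟶ 𝟙_ C := (ρ_ U).inv ≫ U ◁ η[H] ≫ P.ev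

/-- The unit `1 # 1` of the smash product. -/
def smashOne : 𝟙_ C ⟶ H ⊠ U := P.one ≫ unitT η[H] U

variable {P}

theorem splitInv_lamT (hj : j ▷ H ≫ P.lamMap = P.rhoMap) (Y : C) :
    splitT (P.splitInv j) (H ⊠ Y) ≫ P.lamT Y =
      U ◁ splitT Δ[H] Y ≫ U ◁ P.antipodeInv ▷ (H ⊠ Y) ≫ capT P.ev (H ⊠ Y) := by
  have h₁ : splitT (P.splitInv j) (H ⊠ Y) = P.doubleAntipodeInv j ▷ (H ⊠ Y) ≫
      P.antipode ▷ (H ⊠ Y) ≫ splitT j (H ⊠ Y) := by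
    simp only [splitInv, splitT]; monoidal
  have h₂ : U ◁ 𝒮[H] ▷ (H ⊠ Y) ≫ U ◁ P.antipodeInv ▷ (H ⊠ Y) = 𝟙 _ := by
    rw [← whiskerLeft_comp, ← comp_whiskerRight, P.antipode_antipodeInv, id_whiskerRight,
      whiskerLeft_id]
  rw [h₁, Category.assoc, Category.assoc, P.split_lamT hj, rhoMap_tail, comp₂₂ (strand_nat _ _),
    comp₂₂ (strand_nat _ _), antipode_cap, comp₂₂ (strand_nat _ _), P.doubleAntipodeInv_cap hj,
    reassoc_of% h₂]

theorem counit_tail (Y : C) : counitT P.counit Y = U ◁ unitT η[H] Y ≫ capT P.ev Y := by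
  simp only [counitT, counit, unitT, capT]; monoidal

theorem smashOne_lamT (Y : C) : unitT P.one (H ⊠ Y) ≫ unitT η[H] (U ⊠ H ⊠ Y) ≫ P.lamT Y = 𝟙 _ :=
  P.one_lamT Y

/-- The morphism `splitInv j` is right inverse to `j` for the convolution:
`j(f₁) splitInv(f₂) = ε(f) (1 # 1)`. -/
theorem comul_split_splitInv (hj : j ▷ H ≫ P.lamMap = P.rhoMap) (Y : C) :
    splitT P.comul Y ≫ U ◁ splitT (P.splitInv j) Y ≫ splitT j (H ⊠ U ⊠ Y) ≫ P.smashT Y =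
      counitT P.counit Y ≫ unitT P.one Y ≫ unitT η[H] (U ⊠ Y) := by
  have h₁ (Y : C) : splitT P.comul Y ≫ U ◁ splitT (P.splitInv j) Y ≫ splitT j (H ⊠ U ⊠ Y) ≫
      P.smashT Y = splitT (P.comul ≫ U ◁ P.splitInv j ≫ j ▷ (H ⊠ U) ≫ P.smashMul) Y := by
    simp only [smashT, smashMul, squareT, mergeT, splitT]; monoidal
  have h₂ (Y : C) : counitT P.counit Y ≫ unitT P.one Y ≫ unitT η[H] (U ⊠ Y) =
      splitT (P.counit ≫ P.one ≫ unitT η[H] U) Y := by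
    simp only [splitT, counitT, unitT]; monoidal
  rw [h₁, h₂]
  congr 1
  have h₃ := congrArg (U ◁ ·) (antipode_left_op P.symm_HH P.antipodeInv_antipode
    P.antipode_antipodeInv (H ⊠ 𝟙_ C))
  have h₄ := congrArg (U ◁ ·) (comul_counit_left (H := H) (𝟙_ C))
  simp only [whiskerLeft_comp, whiskerLeft_id] at h₃ h₄
  apply P.splitT_ext
  simp only [← h₁, ← h₂, Category.assoc]
  rw [P.split_smashT_lamT hj, smashOne_lamT, Category.comp_id,
    ← reassoc_of% whisk₁₂ U (splitInv_lamT hj (𝟙_ C)).symm, counit_tail]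
  simp only [rhoMap_tail, whiskerLeft_comp, Category.assoc]
  rw [comp₂₂ (whisk₂₂ U (capT_nat P.ev _)),
    comp₂₂ (whisk₂₂ U (whisk₂₂ U (strand_nat P.antipodeInv _))),
    comp₂₂ (splitT_nat _ _), comp₂₂ (splitT_nat _ _), comp₂₂ (splitT_nat _ _), comul_cap,
    ← comp₂₂ (whisk₂₂ U (comul_comul _)), reassoc_of% h₃, reassoc_of% h₄]

/-- The morphism `splitInv j` is left inverse to `j` for the convolution:
`splitInv(f₁) j(f₂) = ε(f) (1 # 1)`. -/
theorem comul_splitInv_split (hj : j ▷ H ≫ P.lamMap = P.rhoMap) (Y : C) :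
    splitT P.comul Y ≫ U ◁ splitT j Y ≫ splitT (P.splitInv j) (H ⊠ U ⊠ Y) ≫ P.smashT Y =
      counitT P.counit Y ≫ unitT P.one Y ≫ unitT η[H] (U ⊠ Y) := by
  have h₁ (Y : C) : splitT P.comul Y ≫ U ◁ splitT j Y ≫ splitT (P.splitInv j) (H ⊠ U ⊠ Y) ≫
      P.smashT Y = splitT (P.comul ≫ U ◁ j ≫ P.splitInv j ▷ (H ⊠ U) ≫ P.smashMul) Y := by
    simp only [smashT, smashMul, squareT, mergeT, splitT]; monoidal
  have h₂ (Y : C) : counitT P.counit Y ≫ unitT P.one Y ≫ unitT η[H] (U ⊠ Y) =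
      splitT (P.counit ≫ P.one ≫ unitT η[H] U) Y := by
    simp only [splitT, counitT, unitT]; monoidal
  rw [h₁, h₂]
  congr 1
  have h₃ := congrArg (U ◁ ·) (antipode_right_op P.symm_HH P.antipodeInv_antipode
    P.antipode_antipodeInv (H ⊠ 𝟙_ C))
  have h₄ := congrArg (U ◁ ·) (comul_counit_left (H := H) (𝟙_ C))
  simp only [whiskerLeft_comp, whiskerLeft_id] at h₃ h₄
  apply P.splitT_ext
  simp only [← h₁, ← h₂, Category.assoc]
  rw [smashT_lamT, comp₂₂ (splitT_nat _ _), smashOne_lamT, Category.comp_id, splitInv_lamT hj,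
    ← reassoc_of% whisk₁₂ U (P.split_lamT hj (𝟙_ C)).symm, counit_tail]
  simp only [rhoMap_tail, whiskerLeft_comp, Category.assoc]
  rw [comp₂₂ (whisk₂₂ U (capT_nat P.ev _)), comp₂₂ (whisk₂₂ U (capT_nat P.ev _)),
    comp₂₂ (splitT_nat _ _), comp₂₂ (splitT_nat _ _), comp₂₂ (splitT_nat _ _), comul_cap,
    ← comp₂₂ (whisk₂₂ U (comul_comul _)), reassoc_of% h₃, reassoc_of% h₄]

end HopfPairing

end RL

end BraidedDuality

/-! ### Comodule algebras -/

namespace BraidedDuality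

section Comodule

open CategoryTheory MonoidalCategory MonObj ComonObj HopfObj

local infixr:70 " ⊠ " => MonoidalCategoryStruct.tensorObj

universe v u

variable {C : Type u} [Category.{v} C] [MonoidalCategory C] [BraidedCategory C]

namespace HopfPairing

variable {H U : C} [HopfObj H] (P : HopfPairing H U)

/-- The smash product `H # U` is associative, because it acts faithfully on `H`. -/
theorem smashT_smashT (Y : C) : P.smashT (H ⊠ U ⊠ Y) ≫ P.smashT Y =
    H ◁ U ◁ P.smashT Y ≫ P.smashT Y := by
  let e (Y : C) : (((H ⊠ U) ⊠ (H ⊠ U)) ⊠ (H ⊠ U)) ⊠ Y ≅ H ⊠ U ⊠ H ⊠ U ⊠ H ⊠ U ⊠ Y := ⊗𝟙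
  have h₁ (Y : C) : (e Y).hom ≫ P.smashT (H ⊠ U ⊠ Y) ≫ P.smashT Y =
      splitT (P.smashMul ▷ (H ⊠ U) ≫ P.smashMul) Y := by
    simp only [e, smashT, smashMul, squareT, mergeT, splitT]; monoidal
  have h₂ (Y : C) : (e Y).hom ≫ H ◁ U ◁ P.smashT Y ≫ P.smashT Y =
      splitT ((α_ _ _ _).hom ≫ (H ⊠ U) ◁ P.smashMul ≫ P.smashMul) Y := by
    simp only [e, smashT, smashMul, squareT, mergeT, splitT]; monoidal
  rw [← cancel_epi (e Y).hom, h₁, h₂]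
  congr 1
  apply P.splitT_ext
  simp only [← h₁, ← h₂, Category.assoc]
  rw [smashT_lamT, comp₂₂ (P.smashT_nat _), smashT_lamT,
    comp₂₂ (whisk₂₂ H (whisk₂₂ U (P.smashT_lamT (𝟙_ C))))]

theorem one_smashT (Y : C) :
    unitT P.one (H ⊠ U ⊠ Y) ≫ unitT η[H] (U ⊠ H ⊠ U ⊠ Y) ≫ P.smashT Y = 𝟙 _ := by
  have h₁ (Y : C) : unitT P.one (H ⊠ U ⊠ Y) ≫ unitT η[H] (U ⊠ H ⊠ U ⊠ Y) ≫ P.smashT Y =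
      squareT (unitT P.one (H ⊠ U) ≫ unitT η[H] (U ⊠ H ⊠ U) ≫ (α_ _ _ _).inv ≫ P.smashMul) Y := by
    simp only [smashT, smashMul, squareT, mergeT, unitT]; monoidal
  have h₂ (Y : C) : 𝟙 (H ⊠ U ⊠ Y) = squareT (𝟙 (H ⊠ U)) Y := by
    simp only [squareT]; monoidal
  rw [h₁, h₂]
  congr 1
  apply P.squareT_ext
  simp only [← h₁, ← h₂, Category.assoc]
  rw [smashT_lamT, comp₂₂ (unitT_nat _ _), comp₂₂ (unitT_nat _ _), one_lamT, Category.comp_id,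
    Category.id_comp]

theorem smashT_one (Y : C) :
    H ◁ U ◁ unitT P.one Y ≫ H ◁ U ◁ unitT η[H] (U ⊠ Y) ≫ P.smashT Y = 𝟙 _ := by
  have h₁ (Y : C) : H ◁ U ◁ unitT P.one Y ≫ H ◁ U ◁ unitT η[H] (U ⊠ Y) ≫ P.smashT Y =
      squareT ((ρ_ _).inv ≫ (H ⊠ U) ◁ (P.one ≫ unitT η[H] U) ≫ P.smashMul) Y := by
    simp only [smashT, smashMul, squareT, mergeT, unitT]; monoidal
  have h₂ (Y : C) : 𝟙 (H ⊠ U ⊠ Y) = squareT (𝟙 (H ⊠ U)) Y := by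
    simp only [squareT]; monoidal
  have h₃ := congrArg (fun t => H ◁ U ◁ t) (P.one_lamT (𝟙_ C))
  simp only [whiskerLeft_comp, whiskerLeft_id] at h₃
  rw [h₁, h₂]
  congr 1
  apply P.squareT_ext
  simp only [← h₁, ← h₂, Category.assoc]
  rw [smashT_lamT, reassoc_of% h₃, Category.id_comp]

theorem smashT_under (X Y : C) :
    P.smashT (X ⊠ Y) ≫ H ◁ swapT U X Y ≫ swapT H X (U ⊠ Y) =
      H ◁ U ◁ H ◁ swapT U X Y ≫ H ◁ U ◁ swapT H X (U ⊠ Y) ≫ H ◁ swapT U X (H ⊠ U ⊠ Y) ≫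
        swapT H X (U ⊠ H ⊠ U ⊠ Y) ≫ X ◁ P.smashT Y := by
  have h₁ := congrArg (H ◁ ·) (merge_under P.mul X Y)
  have h₂ := congrArg (H ◁ ·) (square_under P.twist X (U ⊠ Y))
  simp only [whiskerLeft_comp] at h₁ h₂
  simp only [smashT, whiskerLeft_comp, Category.assoc]
  rw [← reassoc_of% h₁, ← swapT_nat H X, comp₂₂ (swapT_nat H X _), reassoc_of% h₂,
    reassoc_of% merge_under, comp₂₂ (mergeT_nat _ _), comp₂₂ (mergeT_nat _ _),
    ← comp₂₂ (whisk₂₂ H (squareT_nat _ _))]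

end HopfPairing

variable {H U R : C} [HopfObj H] [MonObj R]

/-- A right comodule algebra over the object `U` of a Hopf pairing. -/
structure ComoduleAlgebra (P : HopfPairing H U) (R : C) [MonObj R] where
  coact : R ⟶ R ⊠ U
  coassoc : coact ≫ coact ▷ U ≫ (α_ R U U).hom = coact ≫ R ◁ P.comul
  counit : coact ≫ R ◁ P.counit ≫ (ρ_ R).hom = 𝟙 _
  map_mul : μ[R] ≫ coact = (coact ⊗ₘ coact) ≫ (α_ R U (R ⊠ U)).hom ≫
    R ◁ squareT (β_ U R).hom U ≫ (α_ R R (U ⊠ U)).inv ≫ (μ[R] ⊗ₘ P.mul)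
  map_one : η[R] ≫ coact = (λ_ _).inv ≫ (η[R] ⊗ₘ P.one)

namespace ComoduleAlgebra

variable {P : HopfPairing H U} (Q : ComoduleAlgebra P R)

theorem coact_coact (Y : C) : splitT Q.coact Y ≫ splitT Q.coact (U ⊠ Y) =
    splitT Q.coact Y ≫ R ◁ splitT P.comul Y := by
  calc _ = 𝟙 _ ⊗≫ (Q.coact ≫ Q.coact ▷ U ≫ (α_ R U U).hom) ▷ Y ⊗≫ 𝟙 _ := by
        simp only [splitT]; monoidal
    _ = _ := by rw [Q.coassoc]; simp only [splitT]; monoidal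

theorem coact_counit (Y : C) : splitT Q.coact Y ≫ R ◁ counitT P.counit Y = 𝟙 _ := by
  calc _ = 𝟙 _ ⊗≫ (Q.coact ≫ R ◁ P.counit ≫ (ρ_ R).hom) ▷ Y ⊗≫ 𝟙 _ := by
        simp only [splitT, counitT]; monoidal
    _ = _ := by rw [Q.counit]; monoidal

theorem mul_coact (Y : C) : mergeT μ[R] Y ≫ splitT Q.coact Y =
    splitT Q.coact (R ⊠ Y) ≫ R ◁ U ◁ splitT Q.coact Y ≫ R ◁ swapT U R (U ⊠ Y) ≫
      mergeT μ[R] (U ⊠ U ⊠ Y) ≫ R ◁ mergeT P.mul Y := by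
  calc _ = 𝟙 _ ⊗≫ (μ[R] ≫ Q.coact) ▷ Y ⊗≫ 𝟙 _ := by
        simp only [splitT, mergeT]; monoidal
    _ = _ := by
      rw [Q.map_mul, MonoidalCategory.tensorHom_def, MonoidalCategory.tensorHom_def]
      simp only [splitT, mergeT, swapT, squareT]; monoidal

theorem one_coact (Y : C) : unitT η[R] Y ≫ splitT Q.coact Y =
    unitT P.one Y ≫ unitT η[R] (U ⊠ Y) := by
  calc _ = 𝟙 _ ⊗≫ (η[R] ≫ Q.coact) ▷ Y ⊗≫ 𝟙 _ := by
        simp only [splitT, unitT]; monoidal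
    _ = _ := by
      rw [Q.map_one, MonoidalCategory.tensorHom_def']
      simp only [unitT]; monoidal

/-- The action of `H` on a right `U`-comodule `R` through the pairing: `h · r = r₀ ⟨r₁, h⟩` up to
the braiding. -/
def act : H ⊠ R ⟶ R :=
  H ◁ Q.coact ≫ squareT (β_ H R).hom U ≫ R ◁ ((β_ H U).hom ≫ P.ev) ≫ (ρ_ R).hom

theorem act_tail (Y : C) : mergeT Q.act Y = H ◁ splitT Q.coact Y ≫ swapT H R (U ⊠ Y) ≫
    R ◁ swapT H U Y ≫ R ◁ capT P.ev Y := by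
  simp only [mergeT, act, squareT, swapT, splitT, capT]; monoidal

/-- The commutation rule `h ⊗ r ↦ (h₁ · r) ⊗ h₂` of the smash product `R # H`. -/
def twist : H ⊠ R ⟶ R ⊠ H :=
  Δ[H] ▷ R ≫ (α_ H H R).hom ≫ H ◁ (β_ H R).hom ≫ (α_ H R H).inv ≫ Q.act ▷ H

theorem twist_tail (Y : C) : squareT Q.twist Y =
    splitT Δ[H] (R ⊠ Y) ≫ H ◁ swapT H R Y ≫ mergeT Q.act (H ⊠ Y) := by
  simp only [squareT, twist, splitT, swapT, mergeT]; monoidal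

/-- The elements `r₀ ⊗ j(r₁)` commute with those of `H`, up to the braiding. -/
theorem coact_twist_split {j : U ⟶ H ⊠ U} (hj : j ▷ H ≫ P.lamMap = P.rhoMap) (Y : C) :
    H ◁ splitT Q.coact Y ≫ squareT Q.twist (U ⊠ Y) ≫ R ◁ H ◁ splitT j Y ≫
      R ◁ mergeT μ[H] (U ⊠ Y) =
    swapT H R Y ≫ splitT Q.coact (H ⊠ Y) ≫ R ◁ splitT j (H ⊠ Y) ≫ R ◁ H ◁ squareT P.twist Y ≫
      R ◁ mergeT μ[H] (U ⊠ Y) := by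
  have h₁ := congrArg (R ◁ ·) (P.comul_comul_cap_split hj Y)
  simp only [whiskerLeft_comp] at h₁
  rw [comp₂₃ (split_over _ _ _), ← h₁, twist_tail]
  simp only [act_tail, Category.assoc]
  rw [comp₂₃ (whisk₂₃ H (split_over Q.coact H (U ⊠ Y))),
    ← comp₂₂ (swapT_nat H R (swapT H U (U ⊠ Y))),
    ← comp₂₂ (splitT_nat Δ[H] _), comp₂₂ (whisk₂₂ H (whisk₂₂ H (Q.coact_coact _))),
    comp₂₃ (split_under Δ[H] R (U ⊠ Y)), comp₂₂ (swapT_nat H R (H ◁ splitT P.comul Y)),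
    comp₂₂ (whisk₂₂ H (swapT_nat H R (splitT P.comul Y))), ← comp₂₂ (splitT_nat Δ[H] _)]

/-- The commutation rule of `H # U` with `R` in the iterated smash product `(R # H) # U`: the letter
`U` acts trivially on `R`, so that it is only braided past `R`. -/
def tauT (Y : C) : H ⊠ U ⊠ R ⊠ Y ⟶ R ⊠ H ⊠ U ⊠ Y :=
  H ◁ swapT U R Y ≫ squareT Q.twist (U ⊠ Y)

theorem tauT_nat {Y Z : C} (g : Y ⟶ Z) :
    Q.tauT Y ≫ R ◁ H ◁ U ◁ g = H ◁ U ◁ R ◁ g ≫ Q.tauT Z := by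
  simp only [tauT, Category.assoc]
  rw [squareT_nat, comp₂₂ (whisk₂₂ H (swapT_nat U R _))]

/-- The elements `r₀ ⊗ j(r₁)` of the iterated smash product commute with those of `H # U`, up to the
braiding. -/
theorem tauT_smashT {j : U ⟶ H ⊠ U} (hj : j ▷ H ≫ P.lamMap = P.rhoMap) (Y : C) :
    H ◁ U ◁ splitT Q.coact Y ≫ H ◁ U ◁ R ◁ splitT j Y ≫ Q.tauT (H ⊠ U ⊠ Y) ≫ R ◁ P.smashT Y =
    H ◁ swapT U R Y ≫ swapT H R (U ⊠ Y) ≫ splitT Q.coact (H ⊠ U ⊠ Y) ≫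
      R ◁ splitT j (H ⊠ U ⊠ Y) ≫ R ◁ P.smashT Y := by
  have h₁ := congrArg (fun t => R ◁ H ◁ t) (P.swap_split_mul hj Y)
  simp only [whiskerLeft_comp] at h₁
  have h₃ := congrArg (H ◁ ·) (split_over Q.coact U Y)
  simp only [whiskerLeft_comp] at h₃
  simp only [tauT, HopfPairing.smashT, whiskerLeft_comp, Category.assoc]
  rw [← comp₂₂ (whisk₂₂ H (swapT_nat U R _)), ← comp₂₂ (squareT_nat _ _),
    whisk₂₂ R (mergeT_nat μ[H] _),
    ← reassoc_of% h₁, comp₂₂ (squareT_nat _ (swapT U U Y)), ← reassoc_of% h₃,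
    ← whisk₂₂ R (mergeT_nat μ[H] (mergeT P.mul Y)), reassoc_of% Q.coact_twist_split hj (U ⊠ Y)]

/-- The map `r ↦ r₀ ⊗ j(r₁)` from `R` to the iterated smash product is multiplicative. -/
theorem mul_coact_split {j : U ⟶ H ⊠ U} (hj : j ▷ H ≫ P.lamMap = P.rhoMap) (Y : C) :
    mergeT μ[R] Y ≫ splitT Q.coact Y ≫ R ◁ splitT j Y =
    splitT Q.coact (R ⊠ Y) ≫ R ◁ splitT j (R ⊠ Y) ≫ R ◁ H ◁ U ◁ splitT Q.coact Y ≫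
      R ◁ H ◁ U ◁ R ◁ splitT j Y ≫ R ◁ Q.tauT (H ⊠ U ⊠ Y) ≫ mergeT μ[R] (H ⊠ U ⊠ H ⊠ U ⊠ Y) ≫
      R ◁ P.smashT Y := by
  have h₁ := congrArg (fun t => R ◁ t) (P.swap_mul_split hj Y)
  have h₂ := congrArg (fun t => R ◁ t) (swapT_swapT P.symm_UU Y)
  have h₃ := congrArg (R ◁ ·) (split_over Q.coact U Y)
  have h₄ := congrArg (R ◁ ·) (Q.tauT_smashT hj Y)
  have h₅ := congrArg (R ◁ ·) (split_under j R Y)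
  simp only [whiskerLeft_comp, whiskerLeft_id] at h₁ h₂ h₃ h₄ h₅
  rw [reassoc_of% Q.mul_coact]
  rw [mergeT_nat μ[R] (P.smashT Y), reassoc_of% h₄, ← reassoc_of% h₅]
  rw [← Category.id_comp (R ◁ mergeT P.mul Y), ← h₂]
  simp only [Category.assoc]
  rw [h₁, comp₂₂ (mergeT_nat μ[R] (swapT U U Y)), ← reassoc_of% h₃, comp₂₂ (mergeT_nat μ[R] _),
    comp₂₂ (mergeT_nat μ[R] (splitT j (H ⊠ U ⊠ Y))), mergeT_nat μ[R],
    comp₂₂ (whisk₂₂ R (splitT_nat Q.coact _))]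

end ComoduleAlgebra

end Comodule

end BraidedDuality

/-! ### The duality isomorphism -/

namespace BraidedDuality

section Iso

open CategoryTheory MonoidalCategory MonObj ComonObj HopfObj

local infixr:70 " ⊠ " => MonoidalCategoryStruct.tensorObj

universe v u

variable {C : Type u} [Category.{v} C] [MonoidalCategory C] [BraidedCategory C]

variable {H U R : C} [HopfObj H] [MonObj R] {P : HopfPairing H U}

/-- `j(1) = 1 # 1`. -/
theorem HopfPairing.one_split {j : U ⟶ H ⊠ U} (hj : j ▷ H ≫ P.lamMap = P.rhoMap) (Y : C) :
    unitT P.one Y ≫ splitT j Y = unitT P.one Y ≫ unitT η[H] (U ⊠ Y) := by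
  have h₁ (Y : C) : splitT (P.one ≫ j) Y = (λ_ _).hom ≫ unitT P.one Y ≫ splitT j Y := by
    simp only [splitT, unitT]; monoidal
  have h₂ (Y : C) : splitT P.smashOne Y =
      (λ_ _).hom ≫ unitT P.one Y ≫ unitT η[H] (U ⊠ Y) := by
    simp only [HopfPairing.smashOne, splitT, unitT]; monoidal
  rw [← cancel_epi (λ_ Y).hom, ← h₁, ← h₂]
  congr 1
  apply P.splitT_ext
  simp only [h₁, h₂, Category.assoc]
  rw [P.smashOne_lamT, P.split_lamT hj, P.rhoMap_tail, comp₂₂ (unitT_nat _ _), P.one_cap,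
    comul_counit_left]

namespace ComoduleAlgebra

variable (Q : ComoduleAlgebra P R)

/-- The map `r ⊗ e ↦ r₀ ⊗ j(r₁) e` in front of a word, where `e` is an element of `H # U`. -/
def shearT (j : U ⟶ H ⊠ U) (Y : C) : R ⊠ H ⊠ U ⊠ Y ⟶ R ⊠ H ⊠ U ⊠ Y :=
  splitT Q.coact (H ⊠ U ⊠ Y) ≫ R ◁ splitT j (H ⊠ U ⊠ Y) ≫ R ◁ P.smashT Y

/-- Morphisms that are inverse to each other for the convolution give inverse maps
`r ⊗ e ↦ r₀ ⊗ j(r₁) e`. -/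
theorem shearT_shearT {i j : U ⟶ H ⊠ U} (h : ∀ Y, splitT P.comul Y ≫ U ◁ splitT i Y ≫
      splitT j (H ⊠ U ⊠ Y) ≫ P.smashT Y =
      counitT P.counit Y ≫ unitT P.one Y ≫ unitT η[H] (U ⊠ Y)) (Y : C) :
    Q.shearT i Y ≫ Q.shearT j Y = 𝟙 _ := by
  have h₁ := congrArg (R ◁ ·) (h (H ⊠ U ⊠ Y))
  have h₂ := congrArg (R ◁ ·) (P.one_smashT Y)
  have h₃ := congrArg (R ◁ ·) (P.smashT_smashT Y)
  simp only [whiskerLeft_comp, whiskerLeft_id] at h₁ h₂ h₃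
  simp only [shearT, Category.assoc]
  rw [← comp₂₂ (splitT_nat Q.coact _), ← comp₂₂ (splitT_nat Q.coact (splitT i (H ⊠ U ⊠ Y))),
    reassoc_of% Q.coact_coact, ← comp₂₂ (whisk₂₂ R (splitT_nat j _)), ← h₃, reassoc_of% h₁, h₂,
    Category.comp_id, Q.coact_counit]

/-- The map `r ⊗ e ↦ r₀ ⊗ j(r₁) e` is multiplicative from `R ⊗ (H # U)` to `(R # H) # U`. -/
theorem mul_shearT {j : U ⟶ H ⊠ U} (hj : j ▷ H ≫ P.lamMap = P.rhoMap) (Y : C) :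
    R ◁ H ◁ swapT U R (H ⊠ U ⊠ Y) ≫ R ◁ swapT H R (U ⊠ H ⊠ U ⊠ Y) ≫
      mergeT μ[R] (H ⊠ U ⊠ H ⊠ U ⊠ Y) ≫ R ◁ P.smashT Y ≫ Q.shearT j Y =
    Q.shearT j (R ⊠ H ⊠ U ⊠ Y) ≫ R ◁ H ◁ U ◁ Q.shearT j Y ≫ R ◁ Q.tauT (H ⊠ U ⊠ Y) ≫
      mergeT μ[R] (H ⊠ U ⊠ H ⊠ U ⊠ Y) ≫ R ◁ P.smashT Y := by
  have h₁ := congrArg (R ◁ ·) (P.smashT_smashT Y)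
  have h₂ := congrArg (fun t => R ◁ R ◁ t) (P.smashT_smashT Y)
  have h₃ := congrArg (fun t => R ◁ R ◁ t) (P.smashT_smashT (H ⊠ U ⊠ Y))
  have h₄ := congrArg (R ◁ ·) (Q.tauT_smashT hj (H ⊠ U ⊠ Y))
  have h₅ := congrArg (R ◁ ·) (Q.tauT_smashT hj (H ⊠ U ⊠ H ⊠ U ⊠ Y))
  have h₆ := congrArg (R ◁ ·) (P.smashT_under R (H ⊠ U ⊠ Y))
  simp only [whiskerLeft_comp] at h₁ h₂ h₃ h₄ h₅ h₆
  simp only [shearT, whiskerLeft_comp, Category.assoc]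
  rw [← comp₂₂ (splitT_nat Q.coact (P.smashT Y)), ← comp₂₂ (whisk₂₂ R (splitT_nat j (P.smashT Y))),
    ← h₁,
    reassoc_of% Q.mul_coact_split hj, comp₂₂ (mergeT_nat μ[R] _), comp₂₂ (mergeT_nat μ[R] _),
    mergeT_nat μ[R], reassoc_of% h₅]
  rw [← comp₂₂ (whisk₂₂ R (Q.tauT_nat (P.smashT Y))), ← reassoc_of% h₂,
    reassoc_of% h₄, reassoc_of% h₆]
  rw [comp₂₂ (whisk₂₂ R (splitT_nat Q.coact (P.smashT (H ⊠ U ⊠ Y))).symm),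
    comp₂₂ (whisk₂₂ R (whisk₂₂ R (splitT_nat j (P.smashT (H ⊠ U ⊠ Y))).symm)), ← reassoc_of% h₃,
    ← comp₂₂ (splitT_nat Q.coact (swapT H R (U ⊠ H ⊠ U ⊠ Y))),
    ← comp₂₂ (splitT_nat Q.coact (H ◁ swapT U R (H ⊠ U ⊠ Y))),
    ← comp₂₂ (whisk₂₂ R (splitT_nat j (swapT H R (U ⊠ H ⊠ U ⊠ Y)))),
    ← comp₂₂ (whisk₂₂ R (splitT_nat j (H ◁ swapT U R (H ⊠ U ⊠ Y))))]

theorem one_shearT {j : U ⟶ H ⊠ U} (hj : j ▷ H ≫ P.lamMap = P.rhoMap) (Y : C) :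
    unitT P.one Y ≫ unitT η[H] (U ⊠ Y) ≫ unitT η[R] (H ⊠ U ⊠ Y) ≫ Q.shearT j Y =
    unitT P.one Y ≫ unitT η[H] (U ⊠ Y) ≫ unitT η[R] (H ⊠ U ⊠ Y) := by
  rw [shearT, reassoc_of% Q.one_coact, comp₂₂ (unitT_nat η[R] _), unitT_nat η[R] (P.smashT Y),
    reassoc_of% P.one_split hj, reassoc_of% P.one_smashT]

end ComoduleAlgebra

/-- The multiplication `(m ⊗ m′) (id ⊗ t ⊗ id)` on `V ⊗ W`. -/
def twistedMul {V W : C} (m : V ⊠ V ⟶ V) (m' : W ⊠ W ⟶ W) (t : W ⊠ V ⟶ V ⊠ W) :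
    (V ⊠ W) ⊠ (V ⊠ W) ⟶ V ⊠ W :=
  (α_ V W (V ⊠ W)).hom ≫ V ◁ squareT t W ≫ (α_ V V (W ⊠ W)).inv ≫ (m ⊗ₘ m')

/-- The commutation rule `w ⊗ v ↦ a(w₁ ⊗ v) ⊗ w₂` of a smash product `V # W`, where `d` is the
comultiplication of `W` and `a` its action on `V`. -/
def smashTwistMap {V W : C} (d : W ⟶ W ⊠ W) (a : W ⊠ V ⟶ V) : W ⊠ V ⟶ V ⊠ W :=
  d ▷ V ≫ (α_ W W V).hom ≫ W ◁ (β_ W V).hom ≫ (α_ W V W).inv ≫ a ▷ W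

/-- The element `e ⊗ e′` of `V ⊗ W`. -/
def tensorOne {V W : C} (e : 𝟙_ C ⟶ V) (e' : 𝟙_ C ⟶ W) : 𝟙_ C ⟶ V ⊠ W :=
  (λ_ (𝟙_ C)).inv ≫ (e ⊗ₘ e')

namespace HopfPairing

variable (P)

/-- The smash product `H # U` as a monoid object. -/
@[reducible] def smashMonObj : MonObj (H ⊠ U) where
  mul := twistedMul μ[H] P.mul (smashTwistMap P.comul P.arrow)
  one := tensorOne η[H] P.one
  mul_assoc := by
    rw [← whiskerRight_iff]
    have h := P.smashT_smashT (𝟙_ C)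
    calc _ = 𝟙 _ ⊗≫ (P.smashT (H ⊠ U ⊠ 𝟙_ C) ≫ P.smashT (𝟙_ C)) ⊗≫ 𝟙 _ := by
          simp only [twistedMul, MonoidalCategory.tensorHom_def, HopfPairing.smashT,
            smashTwistMap, HopfPairing.twist, squareT, mergeT]
          monoidal
      _ = _ := by
          rw [h]
          simp only [twistedMul, MonoidalCategory.tensorHom_def, HopfPairing.smashT,
            smashTwistMap, HopfPairing.twist, squareT, mergeT]
          monoidal
  one_mul := by
    rw [← whiskerRight_iff]
    have h := P.one_smashT (𝟙_ C)
    calc _ = 𝟙 _ ⊗≫ (unitT P.one (H ⊠ U ⊠ 𝟙_ C) ≫ unitT η[H] (U ⊠ H ⊠ U ⊠ 𝟙_ C) ≫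
            P.smashT (𝟙_ C)) ⊗≫ 𝟙 _ := by
          simp only [twistedMul, MonoidalCategory.tensorHom_def, HopfPairing.smashT,
            smashTwistMap, HopfPairing.twist, squareT, mergeT, unitT]
          simp only [tensorOne, MonoidalCategory.tensorHom_def']
          monoidal
      _ = _ := by rw [h]; monoidal
  mul_one := by
    rw [← whiskerRight_iff]
    have h := P.smashT_one (𝟙_ C)
    calc _ = 𝟙 _ ⊗≫ (H ◁ U ◁ unitT P.one (𝟙_ C) ≫ H ◁ U ◁ unitT η[H] (U ⊠ 𝟙_ C) ≫
            P.smashT (𝟙_ C)) ⊗≫ 𝟙 _ := by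
          simp only [twistedMul, MonoidalCategory.tensorHom_def, HopfPairing.smashT,
            smashTwistMap, HopfPairing.twist, squareT, mergeT, unitT]
          simp only [tensorOne, MonoidalCategory.tensorHom_def']
          monoidal
      _ = _ := by rw [h]; monoidal

/-- The action of `U` on `R ⊗ H`, trivial on `R` and `⇀` on `H`. -/
def arrowExt (R : C) : U ⊠ (R ⊠ H) ⟶ R ⊠ H := squareT (β_ U R).hom H ≫ R ◁ P.arrow

end HopfPairing

namespace ComoduleAlgebra

variable (Q : ComoduleAlgebra P R)

/-- The multiplication of the braided tensor product `R ⊗ (H # U)`. -/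
def tensorSmashMul (P : HopfPairing H U) (R : C) [MonObj R] :
    (R ⊠ (H ⊠ U)) ⊠ (R ⊠ (H ⊠ U)) ⟶ R ⊠ (H ⊠ U) :=
  twistedMul μ[R] (twistedMul μ[H] P.mul (smashTwistMap P.comul P.arrow)) (β_ (H ⊠ U) R).hom

/-- The multiplication of the iterated smash product `(R # H) # U`. -/
def iterSmashMul : ((R ⊠ H) ⊠ U) ⊠ ((R ⊠ H) ⊠ U) ⟶ (R ⊠ H) ⊠ U :=
  twistedMul (twistedMul μ[R] μ[H] (smashTwistMap Δ[H] Q.act)) P.mul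
    (smashTwistMap P.comul (P.arrowExt R))

theorem tensorSmashMul_tail (P : HopfPairing H U) (R : C) [MonObj R] (Y : C) :
    tensorSmashMul P R ▷ Y = 𝟙 _ ⊗≫ (R ◁ H ◁ swapT U R (H ⊠ U ⊠ Y) ≫
      R ◁ swapT H R (U ⊠ H ⊠ U ⊠ Y) ≫
      mergeT μ[R] (H ⊠ U ⊠ H ⊠ U ⊠ Y) ≫ R ◁ P.smashT Y) ⊗≫ 𝟙 _ := by
  simp only [tensorSmashMul, twistedMul, MonoidalCategory.tensorHom_def, HopfPairing.smashT,
    BraidedCategory.braiding_tensor_left_hom, smashTwistMap, HopfPairing.twist, swapT, squareT,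
    mergeT]
  monoidal

theorem iterSmashMul_tail (Y : C) :
    Q.iterSmashMul ▷ Y = 𝟙 _ ⊗≫ (R ◁ Q.tauT (H ⊠ U ⊠ Y) ≫
      mergeT μ[R] (H ⊠ U ⊠ H ⊠ U ⊠ Y) ≫ R ◁ P.smashT Y) ⊗≫ 𝟙 _ := by
  have h : R ◁ Q.tauT (H ⊠ U ⊠ Y) ≫ mergeT μ[R] (H ⊠ U ⊠ H ⊠ U ⊠ Y) ≫ R ◁ P.smashT Y =
      R ◁ H ◁ splitT P.comul (R ⊠ H ⊠ U ⊠ Y) ≫ R ◁ H ◁ U ◁ swapT U R (H ⊠ U ⊠ Y) ≫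
      R ◁ H ◁ U ◁ R ◁ swapT U H (U ⊠ Y) ≫ R ◁ H ◁ swapT U R (H ⊠ U ⊠ U ⊠ Y) ≫
      R ◁ H ◁ R ◁ mergeT P.arrow (U ⊠ U ⊠ Y) ≫ R ◁ squareT Q.twist (H ⊠ U ⊠ U ⊠ Y) ≫
      mergeT μ[R] (H ⊠ H ⊠ U ⊠ U ⊠ Y) ≫ R ◁ mergeT μ[H] (U ⊠ U ⊠ Y) ≫
      R ◁ H ◁ mergeT P.mul Y := by
    have h₁ := congrArg (fun t => R ◁ H ◁ t) (split_under P.comul R (H ⊠ U ⊠ Y))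
    have h₂ := congrArg (fun t => R ◁ H ◁ R ◁ t) (P.twist_tail (U ⊠ Y))
    have h₃ := congrArg (fun t => R ◁ H ◁ t) (swapT_nat U R (swapT U H (U ⊠ Y)))
    simp only [whiskerLeft_comp] at h₁ h₂ h₃
    rw [← reassoc_of% h₃, ← reassoc_of% h₁, ← reassoc_of% h₂]
    simp only [tauT, HopfPairing.smashT, whiskerLeft_comp, Category.assoc]
    rw [← comp₂₂ (whisk₂₂ R (squareT_nat Q.twist (squareT P.twist (U ⊠ Y)))),
      comp₂₂ (mergeT_nat μ[R] (H ◁ squareT P.twist (U ⊠ Y)))]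
  rw [h]
  simp only [iterSmashMul, twistedMul, MonoidalCategory.tensorHom_def, HopfPairing.arrowExt,
    BraidedCategory.braiding_tensor_right_hom, smashTwistMap, ComoduleAlgebra.twist, swapT, squareT,
    mergeT, splitT]
  monoidal

/-- The braided tensor product `R ⊗ (H # U)` as a monoid object. -/
@[reducible] def tensorSmashMonObj (P : HopfPairing H U) (R : C) [MonObj R] :
    MonObj (R ⊠ (H ⊠ U)) :=
  letI := P.smashMonObj
  inferInstanceAs (MonObj (R ⊗ (H ⊗ U)))

/-- The duality isomorphism `r ⊗ e ↦ r₀ ⊗ j(r₁) e` from `R ⊗ (H # U)` to `(R # H) # U`. -/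
def shear (j : U ⟶ H ⊠ U) : R ⊠ (H ⊠ U) ⟶ (R ⊠ H) ⊠ U :=
  Q.coact ▷ (H ⊠ U) ≫ (α_ _ _ _).hom ≫ R ◁ (j ▷ (H ⊠ U) ≫
    twistedMul μ[H] P.mul (smashTwistMap P.comul P.arrow)) ≫ (α_ _ _ _).inv

theorem shear_tail (j : U ⟶ H ⊠ U) (Y : C) : Q.shear j ▷ Y = 𝟙 _ ⊗≫ Q.shearT j Y ⊗≫ 𝟙 _ := by
  simp only [shear, shearT, twistedMul, MonoidalCategory.tensorHom_def, HopfPairing.smashT,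
    smashTwistMap, HopfPairing.twist, squareT, mergeT, splitT]
  monoidal

theorem tensorSmashMonObj_mul (P : HopfPairing H U) (R : C) [MonObj R] :
    (tensorSmashMonObj P R).mul = tensorSmashMul P R := by
  have key (m : (H ⊠ U) ⊠ (H ⊠ U) ⟶ H ⊠ U) : tensorμ R (H ⊠ U) R (H ⊠ U) ≫ (μ[R] ⊗ₘ m) =
      twistedMul μ[R] m (β_ (H ⊠ U) R).hom := by
    simp only [tensorμ, twistedMul, squareT]
    monoidal
  exact key _

theorem tensorSmashMonObj_one (P : HopfPairing H U) (R : C) [MonObj R] :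
    (tensorSmashMonObj P R).one = tensorOne η[R] (tensorOne η[H] P.one) := rfl

/-- The isomorphism `shear j`; its inverse comes from the convolution inverse of `j`. -/
def shearIso {j : U ⟶ H ⊠ U} (hj : j ▷ H ≫ P.lamMap = P.rhoMap) :
    R ⊠ (H ⊠ U) ≅ (R ⊠ H) ⊠ U where
  hom := Q.shear j
  inv := (α_ _ _ _).hom ≫ Q.shear (P.splitInv j) ≫ (α_ _ _ _).hom
  hom_inv_id := by
    rw [← whiskerRight_iff]
    simp only [comp_whiskerRight, shear_tail]
    calc _ = 𝟙 _ ⊗≫ (Q.shearT j (𝟙_ C) ≫ Q.shearT (P.splitInv j) (𝟙_ C)) ⊗≫ 𝟙 _ := by monoidal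
      _ = _ := by
        rw [Q.shearT_shearT (HopfPairing.comul_splitInv_split hj)]; monoidal
  inv_hom_id := by
    rw [← whiskerRight_iff]
    simp only [comp_whiskerRight, shear_tail]
    calc _ = 𝟙 _ ⊗≫ (Q.shearT (P.splitInv j) (𝟙_ C) ≫ Q.shearT j (𝟙_ C)) ⊗≫ 𝟙 _ := by monoidal
      _ = _ := by
        rw [Q.shearT_shearT (HopfPairing.comul_split_splitInv hj)]; monoidal

theorem mul_shear {j : U ⟶ H ⊠ U} (hj : j ▷ H ≫ P.lamMap = P.rhoMap) :
    tensorSmashMul P R ≫ Q.shear j = (Q.shear j ⊗ₘ Q.shear j) ≫ Q.iterSmashMul := by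
  have key {A D E : C} (f : A ⟶ D) (g : R ⊠ (H ⊠ U) ⟶ E) : (f ⊗ₘ g) ▷ 𝟙_ C =
      𝟙 _ ⊗≫ f ▷ (R ⊠ H ⊠ U ⊠ 𝟙_ C) ⊗≫ D ◁ (g ▷ 𝟙_ C) ⊗≫ 𝟙 _ := by
    rw [MonoidalCategory.tensorHom_def]; monoidal
  rw [← whiskerRight_iff]
  simp only [comp_whiskerRight, key, shear_tail, tensorSmashMul_tail, iterSmashMul_tail]
  calc _ = 𝟙 _ ⊗≫ (R ◁ H ◁ swapT U R (H ⊠ U ⊠ 𝟙_ C) ≫ R ◁ swapT H R (U ⊠ H ⊠ U ⊠ 𝟙_ C) ≫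
      mergeT μ[R] (H ⊠ U ⊠ H ⊠ U ⊠ 𝟙_ C) ≫ R ◁ P.smashT (𝟙_ C) ≫ Q.shearT j (𝟙_ C)) ⊗≫ 𝟙 _ := by
        monoidal
    _ = _ := by rw [Q.mul_shearT hj]; monoidal

theorem one_shear {j : U ⟶ H ⊠ U} (hj : j ▷ H ≫ P.lamMap = P.rhoMap) :
    tensorOne η[R] (tensorOne η[H] P.one) ≫ Q.shear j =
      tensorOne (tensorOne η[R] η[H]) P.one := by
  rw [← whiskerRight_iff]
  simp only [comp_whiskerRight, shear_tail]
  calc _ = 𝟙 _ ⊗≫ (unitT P.one (𝟙_ C) ≫ unitT η[H] (U ⊠ 𝟙_ C) ≫ unitT η[R] (H ⊠ U ⊠ 𝟙_ C) ≫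
        Q.shearT j (𝟙_ C)) ⊗≫ 𝟙 _ := by
        simp only [tensorOne, MonoidalCategory.tensorHom_def', unitT]
        monoidal
    _ = _ := by
      rw [Q.one_shearT hj]
      simp only [tensorOne, MonoidalCategory.tensorHom_def', unitT]
      monoidal

/-- The iterated smash product `(R # H) # U` as a monoid object. Its axioms are transported along
the isomorphism `shear j`, which is multiplicative and preserves the unit. -/
@[reducible] def iterSmashMonObj {j : U ⟶ H ⊠ U} (hj : j ▷ H ≫ P.lamMap = P.rhoMap) :
    MonObj ((R ⊠ H) ⊠ U) :=
  letI := tensorSmashMonObj P R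
  MonObj.ofIso (Q.shearIso hj)

theorem iterSmashMonObj_mul {j : U ⟶ H ⊠ U} (hj : j ▷ H ≫ P.lamMap = P.rhoMap) :
    (Q.iterSmashMonObj hj).mul = Q.iterSmashMul := by
  let := tensorSmashMonObj P R
  rw [iterSmashMonObj, MonObj.ofIso_mul, tensorSmashMonObj_mul]
  have h := Q.mul_shear hj
  change _ ≫ _ ≫ Q.shear j = _
  rw [h, ← Category.assoc]
  convert Category.id_comp _
  change (_ ⊗ₘ _) ≫ ((Q.shearIso hj).hom ⊗ₘ (Q.shearIso hj).hom) = _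
  simp

theorem iterSmashMonObj_one {j : U ⟶ H ⊠ U} (hj : j ▷ H ≫ P.lamMap = P.rhoMap) :
    (Q.iterSmashMonObj hj).one = tensorOne (tensorOne η[R] η[H]) P.one := by
  let := tensorSmashMonObj P R
  rw [iterSmashMonObj, MonObj.ofIso_one, tensorSmashMonObj_one]
  exact Q.one_shear hj

end ComoduleAlgebra

end Iso

end BraidedDuality

/-! ### Yetter–Drinfeld modules: actions, coactions and tensor products -/

namespace BraidedDuality

section YetterDrinfeldCalculus

open TensorProduct Coalgebra

variable {k B V W Z : Type*} [Field k] [Ring B] [HopfAlgebra k B]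
  [AddCommMonoid V] [Module k V] [AddCommMonoid W] [Module k W] [AddCommMonoid Z] [Module k Z]

/-- Right multiplication on the first factor of `B ⊗ V`. -/
def rightMul (k B V : Type*) [Field k] [Ring B] [HopfAlgebra k B] [AddCommMonoid V] [Module k V] :
    B →ₗ[k] B ⊗[k] V →ₗ[k] B ⊗[k] V :=
  LinearMap.rTensorHom V ∘ₗ (LinearMap.mul k B).flip

@[simp] lemma rightMul_tmul (c b : B) (v : V) : rightMul k B V c (b ⊗ₜ v) = (b * c) ⊗ₜ v := by
  simp [rightMul]

lemma rightMul_one (t : B ⊗[k] V) : rightMul k B V 1 t = t := by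
  induction t with
  | zero => simp
  | tmul b v => simp
  | add s t hs ht => simp only [map_add, hs, ht]

lemma rightMul_rightMul (c d : B) (t : B ⊗[k] V) :
    rightMul k B V d (rightMul k B V c t) = rightMul k B V (c * d) t := by
  induction t with
  | zero => simp
  | tmul b v => simp [mul_assoc]
  | add s t hs ht => simp only [map_add, hs, ht]

/-- `a ⊗ c ↦ φ(a) f(c)`, where `B` acts on `B ⊗ V` by right multiplication; composed with the
comultiplication this is the convolution of `φ` and `f`. -/
def rightConv (φ : B →ₗ[k] B ⊗[k] V) (f : B →ₗ[k] B) : B ⊗[k] B →ₗ[k] B ⊗[k] V :=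
  TensorProduct.lift ((rightMul k B V ∘ₗ f).flip ∘ₗ φ)

@[simp] lemma rightConv_tmul (φ : B →ₗ[k] B ⊗[k] V) (f : B →ₗ[k] B) (a c : B) :
    rightConv φ f (a ⊗ₜ c) = rightMul k B V (f c) (φ a) := by
  simp [rightConv]

/-- If `f * g = ε` for the convolution, then `(φ * f) * g = φ`. -/
lemma rightConv_cancel (φ : B →ₗ[k] B ⊗[k] V) (f g : B →ₗ[k] B)
    (h : ∀ b : B, LinearMap.mul' k B (TensorProduct.map f g (comul (R := k) b)) =
      algebraMap k B (counit b)) (b : B) :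
    rightConv (rightConv φ f ∘ₗ comul) g (comul (R := k) b) = φ b := by
  have h₁ (t : B ⊗[k] B) : rightConv (rightConv φ f ∘ₗ comul) g t =
      TensorProduct.lift ((rightMul k B V).flip ∘ₗ φ)
        ((LinearMap.mul' k B ∘ₗ TensorProduct.map f g).lTensor B
          (TensorProduct.assoc k B B B ((comul (R := k)).rTensor B t))) := by
    induction t with
    | zero => simp
    | add s t hs ht => simp only [map_add, hs, ht]
    | tmul a c =>
      have h₂ (s : B ⊗[k] B) : rightMul k B V (g c) (rightConv φ f s) =
          TensorProduct.lift ((rightMul k B V).flip ∘ₗ φ)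
            ((LinearMap.mul' k B ∘ₗ TensorProduct.map f g).lTensor B
              (TensorProduct.assoc k B B B (s ⊗ₜ c))) := by
        induction s with
        | zero => simp
        | add s t hs ht => simp only [map_add, add_tmul, hs, ht]
        | tmul a d => simp [rightMul_rightMul]
      simpa using h₂ (comul a)
  rw [h₁, Coalgebra.coassoc_apply, ← LinearMap.lTensor_comp_apply]
  have h₃ : (LinearMap.mul' k B ∘ₗ TensorProduct.map f g) ∘ₗ comul (R := k) =
      Algebra.linearMap k B ∘ₗ counit := LinearMap.ext h
  rw [h₃, LinearMap.lTensor_comp, LinearMap.comp_apply, Coalgebra.lTensor_counit_comul]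
  simp [rightMul_one]

namespace Ops

variable (X : Ops k B V) (Y : Ops k B W)

/-- The orbit map `b ↦ b · v`. -/
def actAt (v : V) : B →ₗ[k] V := (TensorProduct.curry X.act).flip v

@[simp] lemma actAt_apply (v : V) (b : B) : X.actAt v b = X.act (b ⊗ₜ v) := rfl

/-- The action of `B ⊗ B` on `B ⊗ V` by left multiplication and the action on `V`. -/
def diagAct : B ⊗[k] B →ₗ[k] B ⊗[k] V →ₗ[k] B ⊗[k] V :=
  TensorProduct.homTensorHomMap (RingHom.id k) B V B V ∘ₗ
    TensorProduct.map (LinearMap.mul k B) (TensorProduct.curry X.act)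

@[simp] lemma diagAct_tmul (a c d : B) (v : V) :
    X.diagAct (a ⊗ₜ c) (d ⊗ₜ v) = (a * d) ⊗ₜ X.act (c ⊗ₜ v) := by
  simp [diagAct]

lemma diag_tmul (b : B) (v : V) : X.diag (b ⊗ₜ v) = X.diagAct (comul b) (X.coact v) := by
  have h (s : B ⊗[k] B) (t : B ⊗[k] V) : TensorProduct.map (LinearMap.mul' k B) X.act
      (tensorTensorTensorComm k B B B V (s ⊗ₜ t)) = X.diagAct s t := by
    induction s with
    | zero => simp
    | add s t hs ht => simp only [map_add, add_tmul, LinearMap.add_apply, hs, ht]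
    | tmul a c =>
      induction t with
      | zero => simp
      | add s t hs ht => simp only [map_add, tmul_add, hs, ht]
      | tmul d v => simp
  simpa [Ops.diag] using h (comul b) (X.coact v)

/-- The compatibility of action and coaction at `v`, in the form without the antipode:
`b₁ v₍₋₁₎ ⊗ b₂ · v₍₀₎ = (b₁ · v)₍₋₁₎ b₂ ⊗ (b₁ · v)₍₀₎` for all `b`. -/
def Compatible (v : V) : Prop := ∀ b : B,
  X.diagAct (comul b) (X.coact v) = rightConv (X.coact ∘ₗ X.actAt v) LinearMap.id (comul b)

lemma ydMap_tmul (b : B) (v : V) : X.ydMap (b ⊗ₜ v) =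
    rightConv (TensorProduct.curry X.diag |>.flip v) (HopfAlgebra.antipode k) (comul b) := by
  have h (s : B ⊗[k] B) : (LinearMap.mul' k B).rTensor V (TensorProduct.rightComm k B V B
      (TensorProduct.map X.diag (HopfAlgebra.antipode k (A := B))
        (TensorProduct.rightComm k B B V (s ⊗ₜ v)))) =
      rightConv (TensorProduct.curry X.diag |>.flip v) (HopfAlgebra.antipode k) s := by
    induction s with
    | zero => simp
    | add s t hs ht => simp only [map_add, add_tmul, hs, ht]
    | tmul a c =>
      have h₂ (t : B ⊗[k] V) (d : B) : (LinearMap.mul' k B).rTensor V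
          (TensorProduct.rightComm k B V B (t ⊗ₜ d)) = rightMul k B V d t := by
        induction t with
        | zero => simp
        | add s t hs ht => simp only [map_add, add_tmul, hs, ht]
        | tmul a c => simp
      simp [h₂]
  simpa [Ops.ydMap] using h (comul b)

lemma IsYD.compatible {X : Ops k B V} (hX : X.IsYD) (v : V) : X.Compatible v := by
  intro b
  have h : X.coact ∘ₗ X.actAt v =
      rightConv (TensorProduct.curry X.diag |>.flip v) (HopfAlgebra.antipode k) ∘ₗ comul := by
    ext b
    have := LinearMap.congr_fun hX.compat (b ⊗ₜ v)
    simpa [ydMap_tmul] using this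
  rw [h, rightConv_cancel]
  · simp [diag_tmul]
  · exact HopfAlgebra.mul_antipode_rTensor_comul_apply

lemma Compatible.coact_act {X : Ops k B V} {v : V} (hX : X.Compatible v) (b : B) :
    X.coact (X.act (b ⊗ₜ v)) = X.ydMap (b ⊗ₜ v) := by
  have h : (TensorProduct.curry X.diag).flip v =
      rightConv (X.coact ∘ₗ X.actAt v) LinearMap.id ∘ₗ comul := by
    ext b
    simp [diag_tmul, hX b]
  rw [ydMap_tmul, h, rightConv_cancel]
  · simp
  · exact HopfAlgebra.mul_antipode_lTensor_comul_apply

/-- The action of `B ⊗ B` on `V ⊗ W`. -/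
def pairAct : B ⊗[k] B →ₗ[k] V ⊗[k] W →ₗ[k] V ⊗[k] W :=
  TensorProduct.homTensorHomMap (RingHom.id k) V W V W ∘ₗ
    TensorProduct.map (TensorProduct.curry X.act) (TensorProduct.curry Y.act)

@[simp] lemma pairAct_tmul (a c : B) (v : V) (w : W) :
    X.pairAct Y (a ⊗ₜ c) (v ⊗ₜ w) = X.act (a ⊗ₜ v) ⊗ₜ Y.act (c ⊗ₜ w) := by
  simp [pairAct]

lemma tensor_act (b : B) (t : V ⊗[k] W) :
    (X.tensor Y).act (b ⊗ₜ t) = X.pairAct Y (comul b) t := by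
  have h (s : B ⊗[k] B) (t : V ⊗[k] W) : TensorProduct.map X.act Y.act
      (tensorTensorTensorComm k B B V W (s ⊗ₜ t)) = X.pairAct Y s t := by
    induction s with
    | zero => simp
    | add s t hs ht => simp only [map_add, add_tmul, LinearMap.add_apply, hs, ht]
    | tmul a c =>
      induction t with
      | zero => simp
      | add s t hs ht => simp only [map_add, tmul_add, hs, ht]
      | tmul d v => simp
  simpa [Ops.tensor] using h (comul b) t

/-- The multiplication `(a ⊗ v) ⊗ (c ⊗ w) ↦ a c ⊗ (v ⊗ w)` behind the codiagonal coaction. -/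
def coMul (k B V W : Type*) [Field k] [Ring B] [HopfAlgebra k B] [AddCommMonoid V] [Module k V]
    [AddCommMonoid W] [Module k W] : B ⊗[k] V →ₗ[k] B ⊗[k] W →ₗ[k] B ⊗[k] (V ⊗[k] W) :=
  TensorProduct.curry ((LinearMap.mul' k B).rTensor (V ⊗[k] W) ∘ₗ
    (tensorTensorTensorComm k B V B W).toLinearMap)

@[simp] lemma coMul_tmul (a c : B) (v : V) (w : W) :
    coMul k B V W (a ⊗ₜ v) (c ⊗ₜ w) = (a * c) ⊗ₜ (v ⊗ₜ w) := by
  simp [coMul]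

lemma tensor_coact (v : V) (w : W) :
    (X.tensor Y).coact (v ⊗ₜ w) = coMul k B V W (X.coact v) (Y.coact w) := rfl

lemma rightMul_coMul (c : B) (s : B ⊗[k] V) (t : B ⊗[k] W) :
    rightMul k B _ c (coMul k B V W s t) = coMul k B V W s (rightMul k B W c t) := by
  induction s with
  | zero => simp
  | add s t hs ht => simp only [map_add, LinearMap.add_apply, hs, ht]
  | tmul a v =>
    induction t with
    | zero => simp
    | add s t hs ht => simp only [map_add, hs, ht]
    | tmul d w => simp [mul_assoc]

lemma coMul_rightMul (c d : B) (s : B ⊗[k] V) (t : B ⊗[k] W) :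
    coMul k B V W (rightMul k B V c s) ((TensorProduct.curry Y.act d).lTensor B t) =
      coMul k B V W s (Y.diagAct (c ⊗ₜ d) t) := by
  induction s with
  | zero => simp
  | add s t hs ht => simp only [map_add, LinearMap.add_apply, hs, ht]
  | tmul a v =>
    induction t with
    | zero => simp
    | add s t hs ht => simp only [map_add, hs, ht]
    | tmul d w => simp [mul_assoc]

lemma Compatible.tensor {X : Ops k B V} {Y : Ops k B W} {v : V} {w : W} (hX : X.Compatible v)
    (hY : Y.Compatible w) : (X.tensor Y).Compatible (v ⊗ₜ w) := by
  intro b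
  -- `a ⊗ (c ⊗ d)` acts on `e ⊗ (v ⊗ w)` by `ae ⊗ (cv ⊗ dw)`
  let T : B ⊗[k] (B ⊗[k] B) →ₗ[k] B ⊗[k] (V ⊗[k] W) →ₗ[k] B ⊗[k] (V ⊗[k] W) :=
    TensorProduct.homTensorHomMap (RingHom.id k) B (V ⊗[k] W) B (V ⊗[k] W) ∘ₗ
      TensorProduct.map (LinearMap.mul k B) (X.pairAct Y)
  have hT (a : B) (p : B ⊗[k] B) (e : B) (u : V ⊗[k] W) :
      T (a ⊗ₜ p) (e ⊗ₜ u) = (a * e) ⊗ₜ X.pairAct Y p u := by simp [T]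
  have h₁ (s : B ⊗[k] B) (t : B ⊗[k] (V ⊗[k] W)) :
      (X.tensor Y).diagAct s t = T (comul.lTensor B s) t := by
    induction s with
    | zero => simp
    | add s t hs ht => simp only [map_add, LinearMap.add_apply, hs, ht]
    | tmul a c =>
      induction t with
      | zero => simp
      | add s t hs ht => simp only [map_add, hs, ht]
      | tmul d v => rw [LinearMap.lTensor_tmul, hT, diagAct_tmul, tensor_act]
  have h₂ (p : B ⊗[k] B) (c : B) (s : B ⊗[k] V) (t : B ⊗[k] W) :
      T (TensorProduct.assoc k B B B (p ⊗ₜ c)) (coMul k B V W s t) =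
        coMul k B V W (X.diagAct p s) ((TensorProduct.curry Y.act c).lTensor B t) := by
    induction p with
    | zero => simp
    | add s t hs ht => simp only [map_add, add_tmul, LinearMap.add_apply, hs, ht]
    | tmul a d =>
      induction s with
      | zero => simp
      | add s t hs ht => simp only [map_add, LinearMap.add_apply, hs, ht]
      | tmul e v =>
        induction t with
        | zero => simp
        | add s t hs ht => simp only [map_add, hs, ht]
        | tmul f w => simp [hT, mul_assoc]
  let N : B ⊗[k] (B ⊗[k] B) →ₗ[k] B ⊗[k] (V ⊗[k] W) := TensorProduct.lift (coMul k B V W) ∘ₗ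
    TensorProduct.map (X.coact ∘ₗ X.actAt v) (Y.diagAct.flip (Y.coact w))
  have h₃ (p : B ⊗[k] B) (d : B) :
      coMul k B V W (rightConv (X.coact ∘ₗ X.actAt v) LinearMap.id p)
        ((TensorProduct.curry Y.act d).lTensor B (Y.coact w)) =
      N (TensorProduct.assoc k B B B (p ⊗ₜ d)) := by
    induction p with
    | zero => simp
    | add s t hs ht => simp only [map_add, add_tmul, LinearMap.add_apply, hs, ht]
    | tmul a c => simp [N, coMul_rightMul]
  have h₄ (q : B ⊗[k] B) : T (TensorProduct.assoc k B B B (comul.rTensor B q))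
      ((X.tensor Y).coact (v ⊗ₜ w)) = N (TensorProduct.assoc k B B B (comul.rTensor B q)) := by
    induction q with
    | zero => simp
    | add s t hs ht => simp only [map_add, LinearMap.add_apply, hs, ht]
    | tmul a c => rw [LinearMap.rTensor_tmul, tensor_coact, h₂, hX a, h₃]
  let N' : B ⊗[k] (B ⊗[k] B) →ₗ[k] B ⊗[k] (V ⊗[k] W) := TensorProduct.lift (coMul k B V W) ∘ₗ
    TensorProduct.map (X.coact ∘ₗ X.actAt v) (rightConv (Y.coact ∘ₗ Y.actAt w) LinearMap.id)
  have h₅ (q : B ⊗[k] B) : N (comul.lTensor B q) = N' (comul.lTensor B q) := by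
    induction q with
    | zero => simp
    | add s t hs ht => simp only [map_add, hs, ht]
    | tmul a c => simp [N, N', hY c]
  have h₆ (p : B ⊗[k] B) (c : B) : N' (TensorProduct.assoc k B B B (p ⊗ₜ c)) =
      rightMul k B _ c ((X.tensor Y).coact (X.pairAct Y p (v ⊗ₜ w))) := by
    induction p with
    | zero => simp
    | add s t hs ht => simp only [map_add, add_tmul, LinearMap.add_apply, hs, ht]
    | tmul a d => simp [N', tensor_coact, rightMul_coMul]
  have h₇ (q : B ⊗[k] B) : N' (TensorProduct.assoc k B B B (comul.rTensor B q)) =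
      rightConv ((X.tensor Y).coact ∘ₗ (X.tensor Y).actAt (v ⊗ₜ w)) LinearMap.id q := by
    induction q with
    | zero => simp
    | add s t hs ht => simp only [map_add, hs, ht]
    | tmul a c => simp [h₆, tensor_act]
  rw [h₁, ← Coalgebra.coassoc_apply, h₄, Coalgebra.coassoc_apply, h₅, ← Coalgebra.coassoc_apply,
    h₇]

lemma coMul_counit (s : B ⊗[k] V) (t : B ⊗[k] W) :
    TensorProduct.lid k _ ((counit (R := k)).rTensor _ (coMul k B V W s t)) =
      TensorProduct.lid k V ((counit (R := k)).rTensor _ s) ⊗ₜ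
        TensorProduct.lid k W ((counit (R := k)).rTensor _ t) := by
  induction s with
  | zero => simp
  | add s t hs ht => simp only [map_add, LinearMap.add_apply, add_tmul, hs, ht]
  | tmul a v =>
    induction t with
    | zero => simp
    | add s t hs ht => simp only [map_add, tmul_add, hs, ht]
    | tmul d w => simp [← smul_tmul', mul_smul, tmul_smul, smul_comm (counit (R := k) a)]

lemma pairAct_mul {X : Ops k B V} {Y : Ops k B W} (hX : X.IsYD) (hY : Y.IsYD)
    (p q : B ⊗[k] B) (u : V ⊗[k] W) :
    X.pairAct Y (p * q) u = X.pairAct Y p (X.pairAct Y q u) := by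
  induction p with
  | zero => simp
  | add s t hs ht => simp only [map_add, add_mul, LinearMap.add_apply, hs, ht]
  | tmul a c =>
    induction q with
    | zero => simp
    | add s t hs ht => simp only [map_add, mul_add, LinearMap.add_apply, hs, ht]
    | tmul d e =>
      induction u with
      | zero => simp
      | add s t hs ht => simp only [map_add, hs, ht]
      | tmul v w => simp [hX.mul_act, hY.mul_act]

lemma coMul_coassoc (s : B ⊗[k] V) (t : B ⊗[k] W)
    (s' : B ⊗[k] (B ⊗[k] V)) (t' : B ⊗[k] (B ⊗[k] W))
    (hs : TensorProduct.assoc k B B V (comul.rTensor V s) = s')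
    (ht : TensorProduct.assoc k B B W (comul.rTensor W t) = t') :
    TensorProduct.assoc k B B _ (comul.rTensor _ (coMul k B V W s t)) =
      (TensorProduct.lift (coMul k B V W)).lTensor B
        (coMul k B (B ⊗[k] V) (B ⊗[k] W) s' t') := by
  have key (p q : B ⊗[k] B) (v : V) (w : W) : TensorProduct.assoc k B B _ ((p * q) ⊗ₜ (v ⊗ₜ w)) =
      (TensorProduct.lift (coMul k B V W)).lTensor B
        (coMul k B (B ⊗[k] V) (B ⊗[k] W) (TensorProduct.assoc k B B V (p ⊗ₜ v))
          (TensorProduct.assoc k B B W (q ⊗ₜ w))) := by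
    induction p with
    | zero => simp
    | add s t hs ht => simp only [map_add, add_mul, add_tmul, LinearMap.add_apply, hs, ht]
    | tmul a c =>
      induction q with
      | zero => simp
      | add s t hs ht => simp only [map_add, mul_add, add_tmul, hs, ht]
      | tmul d e => simp
  subst hs ht
  induction s with
  | zero => simp
  | add s t hs ht => simp only [map_add, LinearMap.add_apply, hs, ht]
  | tmul a v =>
    induction t with
    | zero => simp
    | add s t hs ht => simp only [map_add, hs, ht]
    | tmul d w => simp [key]

lemma lTensor_coact_coMul (s : B ⊗[k] V) (t : B ⊗[k] W) :
    (X.tensor Y).coact.lTensor B (coMul k B V W s t) =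
      (TensorProduct.lift (coMul k B V W)).lTensor B
        (coMul k B (B ⊗[k] V) (B ⊗[k] W) (X.coact.lTensor B s) (Y.coact.lTensor B t)) := by
  induction s with
  | zero => simp
  | add s t hs ht => simp only [map_add, LinearMap.add_apply, hs, ht]
  | tmul a v =>
    induction t with
    | zero => simp
    | add s t hs ht => simp only [map_add, hs, ht]
    | tmul d w => simp [tensor_coact]

/-- Tensor products of Yetter–Drinfeld modules are Yetter–Drinfeld modules. -/
theorem IsYD.tensor {X : Ops k B V} {Y : Ops k B W} (hX : X.IsYD) (hY : Y.IsYD) :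
    (X.tensor Y).IsYD where
  one_act u := by
    induction u with
    | zero => simp
    | add s t hs ht => rw [tmul_add, map_add, hs, ht]
    | tmul v w => rw [tensor_act, Bialgebra.comul_one, Algebra.TensorProduct.one_def,
        pairAct_tmul, hX.one_act, hY.one_act]
  mul_act a b u := by
    simp only [tensor_act, Bialgebra.comul_mul, pairAct_mul hX hY]
  counit_coact u := by
    induction u with
    | zero => simp
    | add s t hs ht => simp only [map_add, hs, ht]
    | tmul v w => rw [tensor_coact, coMul_counit, hX.counit_coact, hY.counit_coact]
  coassoc u := by
    induction u with
    | zero => simp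
    | add s t hs ht => simp only [map_add, hs, ht]
    | tmul v w =>
      rw [tensor_coact, lTensor_coact_coMul, coMul_coassoc _ _ _ _ (hX.coassoc v) (hY.coassoc w)]
  compat := by
    apply TensorProduct.ext'
    intro b u
    induction u with
    | zero => simp
    | add s t hs ht => simp only [map_add, tmul_add, hs, ht]
    | tmul v w => exact ((hX.compatible v).tensor (hY.compatible w)).coact_act b

end Ops

end YetterDrinfeldCalculus

end BraidedDuality

/-! ### Morphisms of Yetter–Drinfeld modules -/

namespace BraidedDuality

section Morphisms

open TensorProduct Coalgebra Ops

variable {k B V W Z V' W' : Type*} [Field k] [Ring B] [HopfAlgebra k B]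
  [AddCommMonoid V] [Module k V] [AddCommMonoid W] [Module k W] [AddCommMonoid Z] [Module k Z]
  [AddCommMonoid V'] [Module k V'] [AddCommMonoid W'] [Module k W']
  {X : Ops k B V} {Y : Ops k B W} {T : Ops k B Z} {X' : Ops k B V'} {Y' : Ops k B W'}

lemma IsHom.act_apply {f : V →ₗ[k] W} (hf : IsHom X Y f) (b : B) (v : V) :
    f (X.act (b ⊗ₜ v)) = Y.act (b ⊗ₜ f v) := by
  simpa using LinearMap.congr_fun hf.map_act (b ⊗ₜ v)

lemma IsHom.coact_apply {f : V →ₗ[k] W} (hf : IsHom X Y f) (v : V) :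
    Y.coact (f v) = f.lTensor B (X.coact v) := LinearMap.congr_fun hf.map_coact v

lemma IsHom.of_apply {f : V →ₗ[k] W} (h₁ : ∀ b v, f (X.act (b ⊗ₜ v)) = Y.act (b ⊗ₜ f v))
    (h₂ : ∀ v, Y.coact (f v) = f.lTensor B (X.coact v)) : IsHom X Y f :=
  ⟨TensorProduct.ext' fun b v => by simpa using h₁ b v, LinearMap.ext h₂⟩

lemma IsHom.id (X : Ops k B V) : IsHom X X LinearMap.id :=
  .of_apply (fun _ _ => rfl) fun _ => by simp

lemma IsHom.comp {f : V →ₗ[k] W} {g : W →ₗ[k] Z} (hg : IsHom Y T g) (hf : IsHom X Y f) :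
    IsHom X T (g ∘ₗ f) :=
  .of_apply (fun b v => by simp [hf.act_apply, hg.act_apply])
    fun v => by simp [hf.coact_apply, hg.coact_apply, LinearMap.lTensor_comp_apply]

lemma IsHom.symm {e : V ≃ₗ[k] W} (h : IsHom X Y e.toLinearMap) : IsHom Y X e.symm.toLinearMap := by
  refine .of_apply (fun b w => e.injective ?_) fun w =>
    (e.lTensor B).injective ?_
  · have := h.act_apply b (e.symm w)
    simpa using this.symm
  · have := h.coact_apply (e.symm w)
    simp only [LinearEquiv.coe_coe, LinearEquiv.apply_symm_apply] at this
    rw [← LinearEquiv.coe_toLinearMap, LinearEquiv.coe_lTensor, ← LinearMap.lTensor_comp_apply]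
    simpa using this.symm

lemma pairAct_map {f : V →ₗ[k] V'} {g : W →ₗ[k] W'} (hf : IsHom X X' f) (hg : IsHom Y Y' g)
    (p : B ⊗[k] B) (u : V ⊗[k] W) :
    TensorProduct.map f g (X.pairAct Y p u) = X'.pairAct Y' p (TensorProduct.map f g u) := by
  induction p with
  | zero => simp
  | add s t hs ht => simp only [map_add, LinearMap.add_apply, hs, ht]
  | tmul a c =>
    induction u with
    | zero => simp
    | add s t hs ht => simp only [map_add, hs, ht]
    | tmul v w => simp [hf.act_apply, hg.act_apply]

lemma coMul_map (f : V →ₗ[k] V') (g : W →ₗ[k] W') (s : B ⊗[k] V) (t : B ⊗[k] W) :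
    coMul k B V' W' (f.lTensor B s) (g.lTensor B t) =
      (TensorProduct.map f g).lTensor B (coMul k B V W s t) := by
  induction s with
  | zero => simp
  | add s t hs ht => simp only [map_add, LinearMap.add_apply, hs, ht]
  | tmul a v =>
    induction t with
    | zero => simp
    | add s t hs ht => simp only [map_add, hs, ht]
    | tmul d w => simp

lemma IsHom.map {f : V →ₗ[k] V'} {g : W →ₗ[k] W'} (hf : IsHom X X' f) (hg : IsHom Y Y' g) :
    IsHom (X.tensor Y) (X'.tensor Y') (TensorProduct.map f g) :=
  .of_apply (fun b u => by rw [tensor_act, tensor_act, pairAct_map hf hg]) fun u => by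
    induction u with
    | zero => simp
    | add s t hs ht => simp only [map_add, hs, ht]
    | tmul v w => rw [map_tmul, tensor_coact, tensor_coact, hf.coact_apply, hg.coact_apply,
        coMul_map]

lemma isHom_assoc (X : Ops k B V) (Y : Ops k B W) (T : Ops k B Z) :
    IsHom ((X.tensor Y).tensor T) (X.tensor (Y.tensor T))
      (TensorProduct.assoc k V W Z).toLinearMap := by
  have h₂ (s : B ⊗[k] V) (t : B ⊗[k] W) (u : B ⊗[k] Z) :
      (TensorProduct.assoc k V W Z).toLinearMap.lTensor B
        (coMul k B _ _ (coMul k B _ _ s t) u) = coMul k B _ _ s (coMul k B _ _ t u) := by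
    induction s with
    | zero => simp
    | add s t hs ht => simp only [map_add, LinearMap.add_apply, hs, ht]
    | tmul a v =>
      induction t with
      | zero => simp
      | add s t hs ht => simp only [map_add, LinearMap.add_apply, hs, ht]
      | tmul b w =>
        induction u with
        | zero => simp
        | add s t hs ht => simp only [map_add, hs, ht]
        | tmul c z => simp [mul_assoc]
  let F : B ⊗[k] (B ⊗[k] B) →ₗ[k] V ⊗[k] (W ⊗[k] Z) →ₗ[k] V ⊗[k] (W ⊗[k] Z) :=
    TensorProduct.homTensorHomMap (RingHom.id k) V (W ⊗[k] Z) V (W ⊗[k] Z) ∘ₗ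
      TensorProduct.map (TensorProduct.curry X.act) (Y.pairAct T)
  have hF (a : B) (p : B ⊗[k] B) (v : V) (u : W ⊗[k] Z) :
      F (a ⊗ₜ p) (v ⊗ₜ u) = X.act (a ⊗ₜ v) ⊗ₜ Y.pairAct T p u := by simp [F]
  have h₃ (p : B ⊗[k] B) (c : B) (v : V) (w : W) (z : Z) : TensorProduct.assoc k V W Z
      (X.pairAct Y p (v ⊗ₜ w) ⊗ₜ T.act (c ⊗ₜ z)) =
        F (TensorProduct.assoc k B B B (p ⊗ₜ c)) (v ⊗ₜ (w ⊗ₜ z)) := by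
    induction p with
    | zero => simp
    | add s t hs ht => simp only [map_add, add_tmul, LinearMap.add_apply, hs, ht]
    | tmul a d => simp [hF]
  have h₄ (q : B ⊗[k] B) (v : V) (w : W) (z : Z) : TensorProduct.assoc k V W Z
      ((X.tensor Y).pairAct T q ((v ⊗ₜ w) ⊗ₜ z)) =
        F (TensorProduct.assoc k B B B (comul.rTensor B q)) (v ⊗ₜ (w ⊗ₜ z)) := by
    induction q with
    | zero => simp
    | add s t hs ht => simp only [map_add, LinearMap.add_apply, hs, ht]
    | tmul a c => simp [tensor_act, h₃]
  have h₅ (q : B ⊗[k] B) (v : V) (w : W) (z : Z) :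
      X.pairAct (Y.tensor T) q (v ⊗ₜ (w ⊗ₜ z)) = F (comul.lTensor B q) (v ⊗ₜ (w ⊗ₜ z)) := by
    induction q with
    | zero => simp
    | add s t hs ht => simp only [map_add, LinearMap.add_apply, hs, ht]
    | tmul a c => simp [tensor_act, hF]
  constructor
  · apply TensorProduct.ext'
    intro b u
    induction u with
    | zero => simp
    | add s t hs ht => simp only [tmul_add, map_add, hs, ht]
    | tmul u z =>
    induction u with
    | zero => simp
    | add s t hs ht => simp only [tmul_add, add_tmul, map_add, hs, ht]
    | tmul v w =>
      simp only [LinearMap.comp_apply, LinearEquiv.coe_coe, LinearMap.lTensor_tmul,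
        TensorProduct.assoc_tmul]
      rw [tensor_act, tensor_act, h₄, h₅, Coalgebra.coassoc_apply]
  · apply TensorProduct.ext_threefold
    intro v w z
    simp [tensor_coact, h₂]

lemma unitOps_act (b : B) (c : k) : (unitOps k B).act (b ⊗ₜ c) = counit (R := k) b * c := by
  simp [unitOps]

lemma unitOps_coact (c : k) : (unitOps k B).coact c = 1 ⊗ₜ c := rfl

lemma isHom_lid (X : Ops k B V) :
    IsHom ((unitOps k B).tensor X) X (TensorProduct.lid k V).toLinearMap := by
  have h₁ (q : B ⊗[k] B) (c : k) (v : V) : TensorProduct.lid k V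
      ((unitOps k B).pairAct X q (c ⊗ₜ v)) =
        X.act (TensorProduct.lid k B ((counit (R := k)).rTensor B q) ⊗ₜ (c • v)) := by
    induction q with
    | zero => simp
    | add s t hs ht => simp only [map_add, LinearMap.add_apply, add_tmul, hs, ht]
    | tmul a d => simp [unitOps_act, TensorProduct.smul_tmul, mul_smul, smul_comm c]
  have h₂ (c : k) (t : B ⊗[k] V) : (TensorProduct.lid k V).toLinearMap.lTensor B
      (coMul k B k V (1 ⊗ₜ c) t) = c • t := by
    induction t with
    | zero => simp
    | add s t hs ht => simp only [map_add, smul_add, hs, ht]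
    | tmul a d => simp
  constructor
  · apply TensorProduct.ext'
    intro b u
    induction u with
    | zero => simp
    | add s t hs ht => simp only [tmul_add, map_add, hs, ht]
    | tmul c v => simp [tensor_act, h₁]
  · apply TensorProduct.ext'
    intro c v
    simp [tensor_coact, h₂, unitOps_coact]

lemma isHom_rid (X : Ops k B V) :
    IsHom (X.tensor (unitOps k B)) X (TensorProduct.rid k V).toLinearMap := by
  have h₁ (q : B ⊗[k] B) (c : k) (v : V) : TensorProduct.rid k V
      (X.pairAct (unitOps k B) q (v ⊗ₜ c)) =
        X.act (TensorProduct.rid k B ((counit (R := k)).lTensor B q) ⊗ₜ (c • v)) := by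
    induction q with
    | zero => simp
    | add s t hs ht => simp only [map_add, LinearMap.add_apply, add_tmul, hs, ht]
    | tmul a d => simp [unitOps_act, TensorProduct.smul_tmul, mul_smul, smul_comm c]
  have h₂ (c : k) (t : B ⊗[k] V) : (TensorProduct.rid k V).toLinearMap.lTensor B
      (coMul k B V k t (1 ⊗ₜ c)) = c • t := by
    induction t with
    | zero => simp
    | add s t hs ht => simp only [map_add, LinearMap.add_apply, smul_add, hs, ht]
    | tmul a d => simp
  constructor
  · apply TensorProduct.ext'
    intro b u
    induction u with
    | zero => simp
    | add s t hs ht => simp only [tmul_add, map_add, hs, ht]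
    | tmul c v => simp [tensor_act, h₁]
  · apply TensorProduct.ext'
    intro c v
    simp [tensor_coact, h₂, unitOps_coact]

/-- Being a Yetter–Drinfeld module is invariant under isomorphism. -/
lemma IsYD.of_equiv (hX : X.IsYD) {e : V ≃ₗ[k] W} (he : IsHom X Y e.toLinearMap) : Y.IsYD := by
  have ha (b : B) (v : V) : Y.act (b ⊗ₜ e v) = e (X.act (b ⊗ₜ v)) := (he.act_apply b v).symm
  have hc (v : V) : Y.coact (e v) = e.toLinearMap.lTensor B (X.coact v) := he.coact_apply v
  refine ⟨fun w => ?_, fun a b w => ?_, fun w => ?_, fun w => ?_, TensorProduct.ext' fun b w => ?_⟩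
    <;> obtain ⟨v, rfl⟩ := e.surjective w
  · rw [ha, hX.one_act]
  · rw [ha, ha, ha, hX.mul_act]
  · rw [hc]
    have h (t : B ⊗[k] V) : TensorProduct.lid k W ((counit (R := k)).rTensor W
        (e.toLinearMap.lTensor B t)) =
          e (TensorProduct.lid k V ((counit (R := k)).rTensor V t)) := by
      induction t with
      | zero => simp
      | add s t hs ht => simp only [map_add, hs, ht]
      | tmul a d => simp
    rw [h, hX.counit_coact]
  · rw [hc]
    have h₁ (p : B ⊗[k] B) (v : V) : TensorProduct.assoc k B B W (p ⊗ₜ e v) =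
        (e.toLinearMap.lTensor B).lTensor B (TensorProduct.assoc k B B V (p ⊗ₜ v)) := by
      induction p with
      | zero => simp
      | add s t hs ht => simp only [map_add, add_tmul, hs, ht]
      | tmul a d => simp
    have h₂ (t : B ⊗[k] V) : TensorProduct.assoc k B B W (comul.rTensor W
        (e.toLinearMap.lTensor B t)) = (e.toLinearMap.lTensor B).lTensor B
          (TensorProduct.assoc k B B V (comul.rTensor V t)) := by
      induction t with
      | zero => simp
      | add s t hs ht => simp only [map_add, hs, ht]
      | tmul a d => simp [h₁]
    have h₃ : Y.coact ∘ₗ e.toLinearMap = e.toLinearMap.lTensor B ∘ₗ X.coact := he.map_coact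
    rw [h₂, hX.coassoc, ← LinearMap.lTensor_comp_apply, ← LinearMap.lTensor_comp_apply, h₃]
  · refine Compatible.coact_act (fun b => ?_) b
    have h₁ (p : B ⊗[k] B) (t : B ⊗[k] V) : Y.diagAct p (e.toLinearMap.lTensor B t) =
        e.toLinearMap.lTensor B (X.diagAct p t) := by
      induction p with
      | zero => simp
      | add s t hs ht => simp only [map_add, LinearMap.add_apply, hs, ht]
      | tmul a d =>
        induction t with
        | zero => simp
        | add s t hs ht => simp only [map_add, hs, ht]
        | tmul c v => simp [ha]
    have h₂ (c : B) (t : B ⊗[k] V) : rightMul k B W c (e.toLinearMap.lTensor B t) =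
        e.toLinearMap.lTensor B (rightMul k B V c t) := by
      induction t with
      | zero => simp
      | add s t hs ht => simp only [map_add, hs, ht]
      | tmul c v => simp
    have h₃ (p : B ⊗[k] B) : rightConv (Y.coact ∘ₗ Y.actAt (e v)) LinearMap.id p =
        e.toLinearMap.lTensor B (rightConv (X.coact ∘ₗ X.actAt v) LinearMap.id p) := by
      induction p with
      | zero => simp
      | add s t hs ht => simp only [map_add, hs, ht]
      | tmul c v => simp [ha, hc, h₂]
    rw [hc, h₁, hX.compatible, h₃]

end Morphisms

end BraidedDuality

/-! ### The braiding of Yetter–Drinfeld modules -/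

namespace BraidedDuality

section Braiding

open TensorProduct Coalgebra Ops

variable {k B V W Z V' W' : Type*} [Field k] [Ring B] [HopfAlgebra k B]
  [AddCommMonoid V] [Module k V] [AddCommMonoid W] [Module k W] [AddCommMonoid Z] [Module k Z]
  [AddCommMonoid V'] [Module k V'] [AddCommMonoid W'] [Module k W']
  {X : Ops k B V} {Y : Ops k B W} {T : Ops k B Z} {X' : Ops k B V'} {Y' : Ops k B W'}

lemma braiding_tmul (X : Ops k B V) (Y : Ops k B W) (v : V) (w : W) :
    braiding X Y (v ⊗ₜ w) = (Y.actAt w).rTensor V (X.coact v) := by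
  have h (t : B ⊗[k] V) : Y.act.rTensor V (TensorProduct.rightComm k B V W (t ⊗ₜ w)) =
      (Y.actAt w).rTensor V t := by
    induction t with
    | zero => simp
    | add s t hs ht => simp only [map_add, add_tmul, hs, ht]
    | tmul c v => simp
  simpa [braiding] using h (X.coact v)

lemma braiding_natural {f : V →ₗ[k] V'} {g : W →ₗ[k] W'} (hf : IsHom X X' f) (hg : IsHom Y Y' g)
    (u : V ⊗[k] W) : braiding X' Y' (TensorProduct.map f g u) =
      TensorProduct.map g f (braiding X Y u) := by
  induction u with
  | zero => simp
  | add s t hs ht => simp only [map_add, hs, ht]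
  | tmul v w =>
    rw [map_tmul, braiding_tmul, braiding_tmul, hf.coact_apply]
    generalize X.coact v = t
    induction t with
    | zero => simp
    | add s t hs ht => simp only [map_add, hs, ht]
    | tmul c v => simp [hg.act_apply]

/-- The braiding is a morphism; this is the compatibility of action and coaction. -/
theorem isHom_braiding (hX : X.IsYD) (hY : Y.IsYD) :
    IsHom (X.tensor Y) (Y.tensor X) (braiding X Y) := by
  constructor
  · apply TensorProduct.ext'
    intro b u
    induction u with
    | zero => simp
    | add s t hs ht => simp only [tmul_add, map_add, hs, ht]
    | tmul v w =>
    have h₁ (c : B) (t : B ⊗[k] V) : (Y.actAt (Y.act (c ⊗ₜ w))).rTensor V t =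
        (Y.actAt w).rTensor V (rightMul k B V c t) := by
      induction t with
      | zero => simp
      | add s t hs ht => simp only [map_add, hs, ht]
      | tmul d v => simp [hY.mul_act]
    have h₂ (p : B ⊗[k] B) : braiding X Y (X.pairAct Y p (v ⊗ₜ w)) =
        (Y.actAt w).rTensor V (rightConv (X.coact ∘ₗ X.actAt v) LinearMap.id p) := by
      induction p with
      | zero => simp
      | add s t hs ht => simp only [map_add, LinearMap.add_apply, hs, ht]
      | tmul a c => simp [braiding_tmul, h₁]
    have h₃ (p : B ⊗[k] B) (t : B ⊗[k] V) : Y.pairAct X p ((Y.actAt w).rTensor V t) =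
        (Y.actAt w).rTensor V (X.diagAct p t) := by
      induction p with
      | zero => simp
      | add s t hs ht => simp only [map_add, LinearMap.add_apply, hs, ht]
      | tmul a c =>
        induction t with
        | zero => simp
        | add s t hs ht => simp only [map_add, hs, ht]
        | tmul d v => simp [hY.mul_act]
    simp only [LinearMap.comp_apply, LinearMap.lTensor_tmul]
    rw [tensor_act, h₂, tensor_act, braiding_tmul, h₃, hX.compatible]
  · apply TensorProduct.ext'
    intro v w
    let P : B ⊗[k] (B ⊗[k] V) →ₗ[k] B ⊗[k] (W ⊗[k] V) :=
      TensorProduct.lift (coMul k B W V ∘ₗ Y.coact ∘ₗ Y.actAt w)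
    have h₁ (t : B ⊗[k] V) : (Y.tensor X).coact ((Y.actAt w).rTensor V t) =
        P (X.coact.lTensor B t) := by
      induction t with
      | zero => simp
      | add s t hs ht => simp only [map_add, hs, ht]
      | tmul d v => simp [P, tensor_coact]
    let K : V →ₗ[k] B ⊗[k] W →ₗ[k] B ⊗[k] (W ⊗[k] V) :=
      LinearMap.lTensorHom B ∘ₗ (TensorProduct.mk k W V).flip
    have hK (v : V) (a : B) (w : W) : K v (a ⊗ₜ w) = a ⊗ₜ (w ⊗ₜ v) := by simp [K]
    have h₂ (c : B) (v : V) (s : B ⊗[k] W) : coMul k B W V s (c ⊗ₜ v) =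
        K v (rightMul k B W c s) := by
      induction s with
      | zero => simp
      | add s t hs ht => simp only [map_add, LinearMap.add_apply, hs, ht]
      | tmul d w => simp [hK]
    have h₃ (p : B ⊗[k] B) (v : V) : P (TensorProduct.assoc k B B V (p ⊗ₜ v)) =
        K v (rightConv (Y.coact ∘ₗ Y.actAt w) LinearMap.id p) := by
      induction p with
      | zero => simp
      | add s t hs ht => simp only [map_add, add_tmul, hs, ht]
      | tmul a c => simp [P, h₂]
    let Q : B ⊗[k] (B ⊗[k] V) →ₗ[k] B ⊗[k] W →ₗ[k] B ⊗[k] (W ⊗[k] V) :=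
      TensorProduct.lift ((LinearMap.llcomp k _ _ _ ∘ₗ K).flip ∘ₗ Y.diagAct) ∘ₗ
        (TensorProduct.assoc k B B V).symm.toLinearMap
    have hQ (p : B ⊗[k] B) (v : V) (s : B ⊗[k] W) :
        Q (TensorProduct.assoc k B B V (p ⊗ₜ v)) s = K v (Y.diagAct p s) := by
      simp [Q]
    have h₄ (b c : B) (r : B ⊗[k] V) (w : W) : Q (b ⊗ₜ r) (c ⊗ₜ w) =
        (b * c) ⊗ₜ (Y.actAt w).rTensor V r := by
      induction r with
      | zero => simp
      | add s t hs ht => simp only [map_add, tmul_add, LinearMap.add_apply, hs, ht]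
      | tmul a v =>
        rw [← TensorProduct.assoc_tmul, hQ]
        simp [hK]
    have h₅ (t : B ⊗[k] V) (s : B ⊗[k] W) : (braiding X Y).lTensor B (coMul k B V W t s) =
        Q (X.coact.lTensor B t) s := by
      induction t with
      | zero => simp
      | add s t hs ht => simp only [map_add, LinearMap.add_apply, hs, ht]
      | tmul b v =>
        induction s with
        | zero => simp
        | add s t hs ht => simp only [map_add, hs, ht]
        | tmul c w => simp [h₄, braiding_tmul]
    have h₆ (t : B ⊗[k] V) : P (TensorProduct.assoc k B B V (comul.rTensor V t)) =
        Q (TensorProduct.assoc k B B V (comul.rTensor V t)) (Y.coact w) := by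
      induction t with
      | zero => simp
      | add s t hs ht => simp only [map_add, LinearMap.add_apply, hs, ht]
      | tmul b v => rw [LinearMap.rTensor_tmul, h₃, hQ, hY.compatible]
    simp only [LinearMap.comp_apply]
    rw [braiding_tmul, h₁, tensor_coact, h₅, ← hX.coassoc, h₆]

lemma braiding_tensor_right (hX : X.IsYD) (v : V) (w : W) (z : Z) :
    TensorProduct.assoc k W Z V (braiding X (Y.tensor T) (v ⊗ₜ (w ⊗ₜ z))) =
      (braiding X T).lTensor W (TensorProduct.assoc k W V Z (braiding X Y (v ⊗ₜ w) ⊗ₜ z)) := by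
  let F : B ⊗[k] (B ⊗[k] V) →ₗ[k] W ⊗[k] (Z ⊗[k] V) :=
    TensorProduct.map (Y.actAt w) ((T.actAt z).rTensor V)
  have h₁ (t : B ⊗[k] V) : (braiding X T).lTensor W (TensorProduct.assoc k W V Z
      ((Y.actAt w).rTensor V t ⊗ₜ z)) = F (X.coact.lTensor B t) := by
    induction t with
    | zero => simp
    | add s t hs ht => simp only [map_add, add_tmul, hs, ht]
    | tmul b v => simp [F, braiding_tmul]
  have h₂ (p : B ⊗[k] B) (v : V) : TensorProduct.assoc k W Z V
      (Y.pairAct T p (w ⊗ₜ z) ⊗ₜ v) = F (TensorProduct.assoc k B B V (p ⊗ₜ v)) := by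
    induction p with
    | zero => simp
    | add s t hs ht => simp only [map_add, add_tmul, LinearMap.add_apply, hs, ht]
    | tmul b v => simp [F]
  have h₃ (t : B ⊗[k] V) : TensorProduct.assoc k W Z V
      (((Y.tensor T).actAt (w ⊗ₜ z)).rTensor V t) =
        F (TensorProduct.assoc k B B V (comul.rTensor V t)) := by
    induction t with
    | zero => simp
    | add s t hs ht => simp only [map_add, hs, ht]
    | tmul b v => simp [← h₂, tensor_act]
  rw [braiding_tmul, braiding_tmul, h₁, h₃, hX.coassoc]

lemma braiding_tensor_left (hT : T.IsYD) (v : V) (w : W) (z : Z) :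
    (TensorProduct.assoc k Z V W).symm (braiding (X.tensor Y) T ((v ⊗ₜ w) ⊗ₜ z)) =
      (braiding X T).rTensor W
        ((TensorProduct.assoc k V Z W).symm (v ⊗ₜ braiding Y T (w ⊗ₜ z))) := by
  rw [braiding_tmul, braiding_tmul, tensor_coact]
  generalize Y.coact w = t
  induction t with
  | zero => simp
  | add s t hs ht => simp only [map_add, tmul_add, hs, ht]
  | tmul c w =>
    have h (s : B ⊗[k] V) : (TensorProduct.assoc k Z V W).symm
        ((T.actAt z).rTensor (V ⊗[k] W) (coMul k B V W s (c ⊗ₜ w))) =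
          (T.actAt (T.act (c ⊗ₜ z))).rTensor V s ⊗ₜ w := by
      induction s with
      | zero => simp
      | add s t hs ht => simp only [map_add, LinearMap.add_apply, add_tmul, hs, ht]
      | tmul b v => simp [hT.mul_act]
    simp [h, braiding_tmul]

/-- The inverse `w ⊗ v ↦ v₍₀₎ ⊗ S⁻¹(v₍₋₁₎) · w` of the braiding. -/
noncomputable def braidingInv (X : Ops k B V) (Y : Ops k B W) : W ⊗[k] V →ₗ[k] V ⊗[k] W :=
  (TensorProduct.comm k W V).toLinearMap ∘ₗ Y.act.rTensor V ∘ₗ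
    (TensorProduct.rightComm k B V W).toLinearMap ∘ₗ
      ((antipodeInv k B).rTensor V ∘ₗ X.coact).rTensor W ∘ₗ
        (TensorProduct.comm k W V).toLinearMap

lemma braidingInv_tmul (X : Ops k B V) (Y : Ops k B W) (v : V) (w : W) :
    braidingInv X Y (w ⊗ₜ v) =
      TensorProduct.comm k W V ((Y.actAt w ∘ₗ antipodeInv k B).rTensor V (X.coact v)) := by
  have h (t : B ⊗[k] V) : Y.act.rTensor V (TensorProduct.rightComm k B V W
      ((antipodeInv k B).rTensor V t ⊗ₜ w)) = (Y.actAt w ∘ₗ antipodeInv k B).rTensor V t := by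
    induction t with
    | zero => simp
    | add s t hs ht => simp only [map_add, add_tmul, hs, ht]
    | tmul c v => simp
  simp [braidingInv, h]

/-- `b₂ S⁻¹(b₁) = ε(b)`. -/
lemma mul_antipodeInv_comul (hB : Function.Bijective (HopfAlgebra.antipode k (A := B))) (b : B) :
    LinearMap.mul' k B (TensorProduct.comm k B B ((antipodeInv k B).rTensor B
      (comul (R := k) b))) = algebraMap k B (counit b) := by
  apply hB.1
  rw [Algebra.algebraMap_eq_smul_one, map_smul, HopfAlgebra.antipode_one,
    ← Algebra.algebraMap_eq_smul_one, ← HopfAlgebra.mul_antipode_lTensor_comul_apply]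
  have h : ∀ t : B ⊗[k] B, HopfAlgebra.antipode k (LinearMap.mul' k B
      (TensorProduct.comm k B B ((antipodeInv k B).rTensor B t))) =
      LinearMap.mul' k B ((HopfAlgebra.antipode k).lTensor B t) := by
    intro t
    induction t with
    | zero => simp
    | add s t hs ht => simp only [map_add, hs, ht]
    | tmul a c =>
      simp [HopfAlgebra.antipode_mul_antidistrib, antipodeInv_apply hB]
  exact h _

lemma braiding_braidingInv (hB : Function.Bijective (HopfAlgebra.antipode k (A := B)))
    (hX : X.IsYD) (hY : Y.IsYD) (v : V) (w : W) :
    braiding X Y (braidingInv X Y (w ⊗ₜ v)) = w ⊗ₜ v := by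
  let F : (B ⊗[k] B) ⊗[k] V →ₗ[k] W ⊗[k] V :=
    (Y.actAt w ∘ₗ LinearMap.mul' k B ∘ₗ (TensorProduct.comm k B B).toLinearMap ∘ₗ
      (antipodeInv k B).rTensor B).rTensor V
  have h₁ (b : B) (t : B ⊗[k] V) : (Y.actAt (Y.act (antipodeInv k B b ⊗ₜ w))).rTensor V t =
      F ((TensorProduct.assoc k B B V).symm (b ⊗ₜ t)) := by
    induction t with
    | zero => simp
    | add s t hs ht => simp only [map_add, tmul_add, hs, ht]
    | tmul c v => simp [F, hY.mul_act]
  have h₂ (t : B ⊗[k] V) : braiding X Y (TensorProduct.comm k W V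
      ((Y.actAt w ∘ₗ antipodeInv k B).rTensor V t)) =
        F ((TensorProduct.assoc k B B V).symm (X.coact.lTensor B t)) := by
    induction t with
    | zero => simp
    | add s t hs ht => simp only [map_add, hs, ht]
    | tmul c v => simp [braiding_tmul, h₁]
  have h₃ (t : B ⊗[k] V) : F (comul.rTensor V t) =
      w ⊗ₜ TensorProduct.lid k V ((counit (R := k)).rTensor V t) := by
    induction t with
    | zero => simp
    | add s t hs ht => simp only [map_add, tmul_add, hs, ht]
    | tmul c v =>
      simp [F, mul_antipodeInv_comul hB, Algebra.algebraMap_eq_smul_one, ← smul_tmul', hY.one_act]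
  rw [braidingInv_tmul, h₂, ← hX.coassoc, LinearEquiv.symm_apply_apply, h₃, hX.counit_coact]

lemma braidingInv_braiding (hB : Function.Bijective (HopfAlgebra.antipode k (A := B)))
    (hX : X.IsYD) (hY : Y.IsYD) (v : V) (w : W) :
    braidingInv X Y (braiding X Y (v ⊗ₜ w)) = v ⊗ₜ w := by
  let F : (B ⊗[k] B) ⊗[k] V →ₗ[k] V ⊗[k] W := (TensorProduct.comm k W V).toLinearMap ∘ₗ
    (Y.actAt w ∘ₗ LinearMap.mul' k B ∘ₗ (antipodeInv k B).rTensor B ∘ₗ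
      (TensorProduct.comm k B B).toLinearMap).rTensor V
  have h₁ (b : B) (t : B ⊗[k] V) : TensorProduct.comm k W V
      ((Y.actAt (Y.act (b ⊗ₜ w)) ∘ₗ antipodeInv k B).rTensor V t) =
      F ((TensorProduct.assoc k B B V).symm (b ⊗ₜ t)) := by
    induction t with
    | zero => simp
    | add s t hs ht => simp only [map_add, tmul_add, hs, ht]
    | tmul c v => simp [F, hY.mul_act]
  have h₂ (t : B ⊗[k] V) : braidingInv X Y ((Y.actAt w).rTensor V t) =
        F ((TensorProduct.assoc k B B V).symm (X.coact.lTensor B t)) := by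
    induction t with
    | zero => simp
    | add s t hs ht => simp only [map_add, hs, ht]
    | tmul c v => simp [braidingInv_tmul, h₁]
  have h₃ (t : B ⊗[k] V) : F (comul.rTensor V t) =
      TensorProduct.lid k V ((counit (R := k)).rTensor V t) ⊗ₜ w := by
    induction t with
    | zero => simp
    | add s t hs ht => simp only [map_add, add_tmul, hs, ht]
    | tmul c v =>
      simp [F, antipodeInv_mul hB, Algebra.algebraMap_eq_smul_one, ← smul_tmul', hY.one_act]
  rw [braiding_tmul, h₂, ← hX.coassoc, LinearEquiv.symm_apply_apply, h₃, hX.counit_coact]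

/-- The braiding as a linear equivalence. -/
noncomputable def braidingEquiv (hB : Function.Bijective (HopfAlgebra.antipode k (A := B)))
    (hX : X.IsYD) (hY : Y.IsYD) : V ⊗[k] W ≃ₗ[k] W ⊗[k] V :=
  LinearEquiv.ofLinearMap (braiding X Y) (braidingInv X Y)
    (TensorProduct.ext' fun w v => by simp [braiding_braidingInv hB hX hY])
    (TensorProduct.ext' fun v w => by simp [braidingInv_braiding hB hX hY])

end Braiding

end BraidedDuality

/-! ### The braided monoidal category of Yetter–Drinfeld modules -/

namespace BraidedDuality

section Category

open TensorProduct Coalgebra CategoryTheory MonoidalCategory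

universe u v w

/-- The operations transported along a linear isomorphism. -/
noncomputable def Ops.transport {k B V W : Type*} [Field k] [Ring B] [HopfAlgebra k B]
    [AddCommMonoid V] [Module k V] [AddCommMonoid W] [Module k W] (X : Ops k B V) (e : V ≃ₗ[k] W) :
    Ops k B W where
  act := e.toLinearMap ∘ₗ X.act ∘ₗ e.symm.toLinearMap.lTensor B
  coact := e.toLinearMap.lTensor B ∘ₗ X.coact ∘ₗ e.symm.toLinearMap

lemma isHom_transport {k B V W : Type*} [Field k] [Ring B] [HopfAlgebra k B]
    [AddCommMonoid V] [Module k V] [AddCommMonoid W] [Module k W] (X : Ops k B V) (e : V ≃ₗ[k] W) :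
    IsHom X (X.transport e) e.toLinearMap :=
  .of_apply (fun b v => by simp [Ops.transport]) fun v => by simp [Ops.transport]

lemma isYD_unitOps (k B : Type*) [Field k] [Ring B] [HopfAlgebra k B] : (unitOps k B).IsYD where
  one_act c := by simp [unitOps_act]
  mul_act a b c := by simp [unitOps_act, mul_assoc]
  counit_coact c := by simp [unitOps_coact]
  coassoc c := by simp [unitOps_coact, Algebra.TensorProduct.one_def]
  compat := by
    refine TensorProduct.ext' fun b c =>
      Ops.Compatible.coact_act (X := unitOps k B) (fun b => ?_) b
    have h (p : B ⊗[k] B) : (unitOps k B).diagAct p (1 ⊗ₜ c) =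
        TensorProduct.rid k B ((counit (R := k)).lTensor B p) ⊗ₜ c := by
      induction p with
      | zero => simp
      | add s t hs ht => simp only [map_add, LinearMap.add_apply, add_tmul, hs, ht]
      | tmul a d => simp [unitOps_act, TensorProduct.smul_tmul]
    have h' (p : B ⊗[k] B) : rightConv ((unitOps k B).coact ∘ₗ (unitOps k B).actAt c)
        LinearMap.id p = TensorProduct.lid k B ((counit (R := k)).rTensor B p) ⊗ₜ c := by
      induction p with
      | zero => simp
      | add s t hs ht => simp only [map_add, add_tmul, hs, ht]
      | tmul a d => simp [unitOps_act, unitOps_coact, TensorProduct.smul_tmul]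
    rw [h', unitOps_coact, h]
    simp

/-- The objects of the category of left-left Yetter–Drinfeld modules over `B`. The carriers live in
a universe that contains that of `k`, so that the unit object can be a lift of `k`. -/
structure YDModule (k : Type u) (B : Type v) [Field k] [Ring B] [HopfAlgebra k B] where
  carrier : Type (max u w)
  [group : AddCommGroup carrier]
  [module : Module k carrier]
  ops : Ops k B carrier
  isYD : ops.IsYD

namespace YDModule

attribute [instance] YDModule.group YDModule.module

variable {k : Type u} {B : Type v} [Field k] [Ring B] [HopfAlgebra k B]

/-- The morphisms of Yetter–Drinfeld modules. -/
@[ext]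
structure Hom (X Y : YDModule.{u, v, w} k B) where
  lin : X.carrier →ₗ[k] Y.carrier
  isHom : IsHom X.ops Y.ops lin

instance : Category (YDModule.{u, v, w} k B) where
  Hom := Hom
  id X := ⟨LinearMap.id, .id _⟩
  comp f g := ⟨g.lin ∘ₗ f.lin, g.isHom.comp f.isHom⟩

variable {X Y Z X' Y' : YDModule.{u, v, w} k B}

@[ext] lemma hom_ext {f g : X ⟶ Y} (h : f.lin = g.lin) : f = g := Hom.ext h

@[simp] lemma id_lin (X : YDModule.{u, v, w} k B) : Hom.lin (𝟙 X) = LinearMap.id := rfl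

@[simp] lemma comp_lin (f : X ⟶ Y) (g : Y ⟶ Z) : (f ≫ g).lin = g.lin ∘ₗ f.lin := rfl

/-- The isomorphism given by a linear isomorphism that is a morphism. -/
def isoOfEquiv (e : X.carrier ≃ₗ[k] Y.carrier) (he : IsHom X.ops Y.ops e.toLinearMap) :
    X ≅ Y where
  hom := ⟨e.toLinearMap, he⟩
  inv := ⟨e.symm.toLinearMap, he.symm⟩
  hom_inv_id := by ext; simp
  inv_hom_id := by ext; simp

variable (k B) in
/-- The unit object, a lift of `k` to the universe of the carriers. -/
noncomputable def unit : YDModule.{u, v, w} k B where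
  carrier := ULift.{w} k
  ops := (unitOps k B).transport ULift.moduleEquiv.symm
  isYD := IsYD.of_equiv (isYD_unitOps k B) (isHom_transport _ _)

variable (k B) in
lemma isHom_down : IsHom (unit.{u, v, w} k B).ops (unitOps k B)
    (ULift.moduleEquiv : ULift.{w} k ≃ₗ[k] k).toLinearMap :=
  (isHom_transport (unitOps k B) (ULift.moduleEquiv : ULift.{w} k ≃ₗ[k] k).symm).symm

noncomputable instance : MonoidalCategoryStruct (YDModule.{u, v, w} k B) where
  tensorObj X Y := ⟨X.carrier ⊗[k] Y.carrier, X.ops.tensor Y.ops, X.isYD.tensor Y.isYD⟩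
  whiskerLeft X _ _ f := ⟨f.lin.lTensor X.carrier, (IsHom.id X.ops).map f.isHom⟩
  whiskerRight f Y := ⟨f.lin.rTensor Y.carrier, f.isHom.map (IsHom.id Y.ops)⟩
  tensorHom f g := ⟨TensorProduct.map f.lin g.lin, f.isHom.map g.isHom⟩
  tensorUnit := unit k B
  associator X Y Z := isoOfEquiv (TensorProduct.assoc k _ _ _) (isHom_assoc X.ops Y.ops Z.ops)
  leftUnitor X := isoOfEquiv
    ((TensorProduct.congr ULift.moduleEquiv (.refl k _)).trans (TensorProduct.lid k X.carrier))
    ((isHom_lid X.ops).comp ((isHom_down k B).map (IsHom.id X.ops)))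
  rightUnitor X := isoOfEquiv
    ((TensorProduct.congr (.refl k _) ULift.moduleEquiv).trans (TensorProduct.rid k X.carrier))
    ((isHom_rid X.ops).comp ((IsHom.id X.ops).map (isHom_down k B)))

lemma hom_ext_tensor {f g : X ⊗ Y ⟶ Z}
    (h : ∀ x y, f.lin (x ⊗ₜ[k] y) = g.lin (x ⊗ₜ[k] y)) : f = g :=
  hom_ext (TensorProduct.ext' h)

lemma hom_ext_tensor_right {W : YDModule.{u, v, w} k B} {f g : X ⊗ (Y ⊗ Z) ⟶ W}
    (h : ∀ x y z, f.lin (x ⊗ₜ[k] (y ⊗ₜ[k] z)) = g.lin (x ⊗ₜ[k] (y ⊗ₜ[k] z))) : f = g :=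
  hom_ext_tensor fun x t => LinearMap.congr_fun (f := f.lin ∘ₗ TensorProduct.mk k _ _ x)
    (g := g.lin ∘ₗ TensorProduct.mk k _ _ x) (TensorProduct.ext' fun y z => h x y z) t

noncomputable instance : MonoidalCategory (YDModule.{u, v, w} k B) where
  tensorHom_def f g := hom_ext_tensor fun x y => rfl
  id_tensorHom_id X Y := hom_ext_tensor fun x y => rfl
  tensorHom_comp_tensorHom f g h i := hom_ext_tensor fun x y => rfl
  whiskerLeft_id X Y := hom_ext_tensor fun x y => rfl
  id_whiskerRight X Y := hom_ext_tensor fun x y => rfl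
  associator_naturality f g h := hom_ext (TensorProduct.ext_threefold fun x y z => rfl)
  leftUnitor_naturality f := hom_ext_tensor fun x y => by
    exact (map_smul f.lin x.down y).symm
  rightUnitor_naturality f := hom_ext_tensor fun x y => by
    exact (map_smul f.lin y.down x).symm
  pentagon W X Y Z := hom_ext (TensorProduct.ext_fourfold fun w x y z => rfl)
  triangle X Y := hom_ext (TensorProduct.ext_threefold fun x y z => by
    exact (TensorProduct.smul_tmul y.down x z).symm)

variable [hB : Fact (Function.Bijective (HopfAlgebra.antipode k (A := B)))]

noncomputable instance : BraidedCategory (YDModule.{u, v, w} k B) where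
  braiding X Y := isoOfEquiv (braidingEquiv hB.out X.isYD Y.isYD) (isHom_braiding X.isYD Y.isYD)
  braiding_naturality_right X _ _ f := hom_ext (LinearMap.ext fun u =>
    braiding_natural (IsHom.id X.ops) f.isHom u)
  braiding_naturality_left f Z := hom_ext (LinearMap.ext fun u =>
    braiding_natural f.isHom (IsHom.id Z.ops) u)
  hexagon_forward X _ _ := hom_ext (TensorProduct.ext_threefold fun x y z =>
    braiding_tensor_right X.isYD x y z)
  hexagon_reverse _ _ Z := hom_ext_tensor_right fun x y z => braiding_tensor_left Z.isYD x y z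

end YDModule

end Category

end BraidedDuality

/-! ### Models of Yetter–Drinfeld modules -/

namespace BraidedDuality

section Models

open TensorProduct Coalgebra CategoryTheory MonoidalCategory YDModule

universe u v w x

variable {k : Type u} {B : Type v} [Field k] [Ring B] [HopfAlgebra k B]

/-- An isomorphism of a space `V` with action and coaction, in an arbitrary universe, with an
object of the category of Yetter–Drinfeld modules. Models let `H`, `U` and `R` live in different
universes. -/
structure Model {V : Type*} [AddCommMonoid V] [Module k V] (X : YDModule.{u, v, w} k B)
    (X₀ : Ops k B V) where
  e : V ≃ₗ[k] X.carrier
  isHom : IsHom X₀ X.ops e.toLinearMap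

/-- The Yetter–Drinfeld module on a lift of `V`. -/
noncomputable def YDModule.lift {V : Type x} [AddCommGroup V] [Module k V] {X₀ : Ops k B V}
    (h : X₀.IsYD) : YDModule.{u, v, max u w x} k B where
  carrier := ULift.{max u w} V
  ops := X₀.transport ULift.moduleEquiv.symm
  isYD := IsYD.of_equiv h (isHom_transport _ _)

namespace Model

/-- The model of a Yetter–Drinfeld module by its lift. -/
noncomputable def lift {V : Type x} [AddCommGroup V] [Module k V] {X₀ : Ops k B V} (h : X₀.IsYD) :
    Model (YDModule.lift.{u, v, w, x} h) X₀ := ⟨ULift.moduleEquiv.symm, isHom_transport _ _⟩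

variable (k B) in
/-- The model of the unit object by `k`. -/
noncomputable def unit : Model (𝟙_ (YDModule.{u, v, w} k B)) (unitOps k B) :=
  ⟨ULift.moduleEquiv.symm, isHom_transport _ _⟩

variable {V W P V' W' : Type*} [AddCommMonoid V] [Module k V] [AddCommMonoid W] [Module k W]
  [AddCommMonoid P] [Module k P] [AddCommMonoid V'] [Module k V'] [AddCommMonoid W'] [Module k W']
  {X Y Z X' Y' : YDModule.{u, v, w} k B}
  {X₀ : Ops k B V} {Y₀ : Ops k B W} {Z₀ : Ops k B P} {X₀' : Ops k B V'} {Y₀' : Ops k B W'}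

/-- The model of a tensor product. -/
noncomputable def tensor (mX : Model X X₀) (mY : Model Y Y₀) : Model (X ⊗ Y) (X₀.tensor Y₀) :=
  ⟨TensorProduct.congr mX.e mY.e, mX.isHom.map mY.isHom⟩

lemma isYD (mX : Model X X₀) : X₀.IsYD :=
  IsYD.of_equiv X.isYD (e := mX.e.symm) (mX.isHom.symm)

/-- The morphism of Yetter–Drinfeld modules modelled by a linear map. -/
def mkHom (mX : Model X X₀) (mY : Model Y Y₀) {f₀ : V →ₗ[k] W} (h : IsHom X₀ Y₀ f₀) : X ⟶ Y :=
  ⟨mY.e.toLinearMap ∘ₗ f₀ ∘ₗ mX.e.symm.toLinearMap, mY.isHom.comp (h.comp mX.isHom.symm)⟩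

/-- The morphism `f` is modelled by the linear map `f₀`. -/
def Rel (mX : Model X X₀) (mY : Model Y Y₀) (f : X ⟶ Y) (f₀ : V →ₗ[k] W) : Prop :=
  ∀ v, f.lin (mX.e v) = mY.e (f₀ v)

variable {mX : Model X X₀} {mY : Model Y Y₀} {mZ : Model Z Z₀} {mX' : Model X' X₀'}
  {mY' : Model Y' Y₀'}

lemma rel_mkHom {f₀ : V →ₗ[k] W} (h : IsHom X₀ Y₀ f₀) : Rel mX mY (mkHom mX mY h) f₀ :=
  fun v => by simp [mkHom]

/-! The following lemmas compute the linear maps that model composite morphisms. -/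

namespace Rel

variable {f : X ⟶ Y} {f' : X ⟶ Y} {g : X' ⟶ Y'} {h : Y ⟶ Z} {f₀ f₀' : V →ₗ[k] W}
  {g₀ : V' →ₗ[k] W'} {h₀ : W →ₗ[k] P}

lemma eq (hf : Rel mX mY f f₀) (hf' : Rel mX mY f' f₀') (h : f₀ = f₀') : f = f' := by
  subst h
  refine YDModule.hom_ext (LinearMap.ext fun y => ?_)
  obtain ⟨v, rfl⟩ := mX.e.surjective y
  rw [hf, hf']

lemma eq_lin (hf : Rel mX mY f f₀) (hf' : Rel mX mY f' f₀') (h : f = f') : f₀ = f₀' := by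
  subst h
  refine LinearMap.ext fun v => mY.e.injective ?_
  rw [← hf, ← hf']

lemma congr (hf : Rel mX mY f f₀) (h : f₀ = f₀') : Rel mX mY f f₀' := h ▸ hf

lemma isHom (hf : Rel mX mY f f₀) : IsHom X₀ Y₀ f₀ := by
  have h : f₀ = mY.e.symm.toLinearMap ∘ₗ f.lin ∘ₗ mX.e.toLinearMap :=
    LinearMap.ext fun v => mY.e.injective (by simp [hf v])
  rw [h]
  exact mY.isHom.symm.comp (f.isHom.comp mX.isHom)

lemma id : Rel mX mX (𝟙 X) LinearMap.id := fun _ => rfl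

lemma comp (hf : Rel mX mY f f₀) (hh : Rel mY mZ h h₀) : Rel mX mZ (f ≫ h) (h₀ ∘ₗ f₀) :=
  fun v => by simp [hf v, hh _]

lemma tensorHom (hf : Rel mX mY f f₀) (hg : Rel mX' mY' g g₀) :
    Rel (mX.tensor mX') (mY.tensor mY') (f ⊗ₘ g) (TensorProduct.map f₀ g₀) := by
  intro t
  induction t with
  | zero => simp
  | add s t hs ht => simp only [map_add, hs, ht]
  | tmul v w => exact congrArg₂ (· ⊗ₜ[k] ·) (hf v) (hg w)

lemma whiskerLeft (mZ : Model Z Z₀) (hf : Rel mX mY f f₀) :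
    Rel (mZ.tensor mX) (mZ.tensor mY) (Z ◁ f) (f₀.lTensor P) := by
  rw [← id_tensorHom]
  exact id.tensorHom hf

lemma whiskerRight (mZ : Model Z Z₀) (hf : Rel mX mY f f₀) :
    Rel (mX.tensor mZ) (mY.tensor mZ) (f ▷ Z) (f₀.rTensor P) := by
  rw [← tensorHom_id]
  exact hf.tensorHom id

lemma of_inv {e : X ≅ Y} {e₀ : V ≃ₗ[k] W} (h : Rel mX mY e.hom e₀.toLinearMap) :
    Rel mY mX e.inv e₀.symm.toLinearMap := by
  intro w
  have h₁ := h (e₀.symm w)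
  rw [LinearEquiv.coe_coe, LinearEquiv.apply_symm_apply] at h₁
  rw [← h₁]
  exact LinearMap.congr_fun (congrArg Hom.lin e.hom_inv_id) _

variable (mX mY mZ)

lemma assoc : Rel ((mX.tensor mY).tensor mZ) (mX.tensor (mY.tensor mZ)) (α_ X Y Z).hom
    (TensorProduct.assoc k V W P).toLinearMap := by
  have h : (α_ X Y Z).hom.lin ∘ₗ ((mX.tensor mY).tensor mZ).e.toLinearMap =
      (mX.tensor (mY.tensor mZ)).e.toLinearMap ∘ₗ (TensorProduct.assoc k V W P).toLinearMap :=
    TensorProduct.ext_threefold fun v w z => rfl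
  exact LinearMap.congr_fun h

lemma assoc_inv : Rel (mX.tensor (mY.tensor mZ)) ((mX.tensor mY).tensor mZ) (α_ X Y Z).inv
    (TensorProduct.assoc k V W P).symm.toLinearMap := (assoc mX mY mZ).of_inv

lemma lid : Rel ((unit k B).tensor mX) mX (λ_ X).hom (TensorProduct.lid k V).toLinearMap := by
  have h : (λ_ X).hom.lin ∘ₗ ((unit k B).tensor mX).e.toLinearMap =
      mX.e.toLinearMap ∘ₗ (TensorProduct.lid k V).toLinearMap :=
    TensorProduct.ext' fun c v => (map_smul mX.e c v).symm
  exact LinearMap.congr_fun h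

lemma lid_inv : Rel mX ((unit k B).tensor mX) (λ_ X).inv
    (TensorProduct.lid k V).symm.toLinearMap := (lid mX).of_inv

lemma rid : Rel (mX.tensor (unit k B)) mX (ρ_ X).hom (TensorProduct.rid k V).toLinearMap := by
  have h : (ρ_ X).hom.lin ∘ₗ (mX.tensor (unit k B)).e.toLinearMap =
      mX.e.toLinearMap ∘ₗ (TensorProduct.rid k V).toLinearMap :=
    TensorProduct.ext' fun v c => (map_smul mX.e c v).symm
  exact LinearMap.congr_fun h

lemma rid_inv : Rel mX (mX.tensor (unit k B)) (ρ_ X).inv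
    (TensorProduct.rid k V).symm.toLinearMap := (rid mX).of_inv

lemma braiding [Fact (Function.Bijective (HopfAlgebra.antipode k (A := B)))] :
    Rel (mX.tensor mY) (mY.tensor mX) (β_ X Y).hom (BraidedDuality.braiding X₀ Y₀) :=
  fun t => braiding_natural mX.isHom mY.isHom t

end Rel

end Model

end Models

end BraidedDuality

/-! ### The antipode of `B` and its inverse -/

namespace BraidedDuality

section Antipode

open TensorProduct Coalgebra HopfAlgebra

variable {k B : Type*} [Field k] [Ring B] [HopfAlgebra k B]

/-- `S(b₁) b₂ ⊗ b₃ = 1 ⊗ b`. -/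
lemma antipode_mul_comul (b : B) :
    LinearMap.mul' k (B ⊗[k] B) (TensorProduct.map
      ((TensorProduct.mk k B B).flip 1 ∘ₗ antipode k) comul (comul (R := k) b)) = 1 ⊗ₜ b := by
  have h₁ (q : B ⊗[k] B) : LinearMap.mul' k (B ⊗[k] B) (TensorProduct.map
      ((TensorProduct.mk k B B).flip 1 ∘ₗ antipode k) comul q) =
      (LinearMap.mul' k B ∘ₗ (antipode k).rTensor B).rTensor B
        ((TensorProduct.assoc k B B B).symm (comul.lTensor B q)) := by
    induction q with
    | zero => simp
    | add s t hs ht => simp only [map_add, hs, ht]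
    | tmul a c =>
      have h₂ (p : B ⊗[k] B) : (antipode k a ⊗ₜ[k] (1 : B)) * p =
          (LinearMap.mul' k B ∘ₗ (antipode k).rTensor B).rTensor B
            ((TensorProduct.assoc k B B B).symm (a ⊗ₜ p)) := by
        induction p with
        | zero => simp
        | add s t hs ht => simp only [map_add, mul_add, tmul_add, hs, ht]
        | tmul d e => simp
      simpa using h₂ (comul c)
  have h₃ : (LinearMap.mul' k B ∘ₗ (antipode k).rTensor B) ∘ₗ comul =
      Algebra.linearMap k B ∘ₗ counit :=
    LinearMap.ext fun b => mul_antipode_rTensor_comul_apply b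
  rw [h₁, ← Coalgebra.coassoc_apply, LinearEquiv.symm_apply_apply, ← LinearMap.rTensor_comp_apply,
    h₃, LinearMap.rTensor_comp_apply, Coalgebra.rTensor_counit_comul]
  simp

/-- The antipode is an anti-homomorphism of coalgebras. -/
theorem comul_antipode (b : B) : comul (R := k) (antipode k b) =
    TensorProduct.map (antipode k) (antipode k) (TensorProduct.comm k B B (comul (R := k) b)) := by
  let G : B →ₗ[k] B ⊗[k] B := TensorProduct.map (antipode k) (antipode k) ∘ₗ
    (TensorProduct.comm k B B).toLinearMap ∘ₗ comul
  have h₁ (b : B) : LinearMap.mul' k (B ⊗[k] B) (TensorProduct.map G comul (comul (R := k) b)) =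
      algebraMap k _ (counit b) := by
    have h₂ (q : B ⊗[k] B) : LinearMap.mul' k (B ⊗[k] B) (TensorProduct.map G comul q) =
        LinearMap.mul' k (B ⊗[k] B) (TensorProduct.map (TensorProduct.mk k B B 1 ∘ₗ antipode k)
          (LinearMap.mul' k (B ⊗[k] B) ∘ₗ TensorProduct.map
            ((TensorProduct.mk k B B).flip 1 ∘ₗ antipode k) comul)
          (TensorProduct.assoc k B B B (comul.rTensor B q))) := by
      induction q with
      | zero => simp
      | add s t hs ht => simp only [map_add, hs, ht]
      | tmul a c =>
        have h₃ (p : B ⊗[k] B) : TensorProduct.map (antipode k) (antipode k)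
            (TensorProduct.comm k B B p) * comul c =
            LinearMap.mul' k (B ⊗[k] B) (TensorProduct.map (TensorProduct.mk k B B 1 ∘ₗ antipode k)
          (LinearMap.mul' k (B ⊗[k] B) ∘ₗ TensorProduct.map
            ((TensorProduct.mk k B B).flip 1 ∘ₗ antipode k) comul)
            (TensorProduct.assoc k B B B (p ⊗ₜ c))) := by
          induction p with
          | zero => simp
          | add s t hs ht => simp only [map_add, add_mul, add_tmul, hs, ht]
          | tmul d e => simp [← mul_assoc]
        simpa [G] using h₃ (comul a)
    have h₄ : (LinearMap.mul' k (B ⊗[k] B) ∘ₗ TensorProduct.map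
        ((TensorProduct.mk k B B).flip 1 ∘ₗ antipode k) comul) ∘ₗ comul =
        TensorProduct.mk k B B 1 := LinearMap.ext antipode_mul_comul
    have h₅ (q : B ⊗[k] B) : LinearMap.mul' k (B ⊗[k] B) (TensorProduct.map
        (TensorProduct.mk k B B 1 ∘ₗ antipode k) (TensorProduct.mk k B B 1) q) =
        1 ⊗ₜ LinearMap.mul' k B ((antipode k).rTensor B q) := by
      induction q with
      | zero => simp
      | add s t hs ht => simp only [map_add, tmul_add, hs, ht]
      | tmul a c => simp
    have h₆ (q : B ⊗[k] B) (F : B →ₗ[k] B ⊗[k] B) (K : B ⊗[k] B →ₗ[k] B ⊗[k] B) :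
        TensorProduct.map F K (comul.lTensor B q) = TensorProduct.map F (K ∘ₗ comul) q := by
      rw [← LinearMap.comp_apply, LinearMap.map_comp_lTensor]
    rw [h₂, Coalgebra.coassoc_apply, h₆, h₄, h₅, mul_antipode_rTensor_comul_apply,
      Algebra.algebraMap_eq_smul_one, Algebra.algebraMap_eq_smul_one, tmul_smul,
      Algebra.TensorProduct.one_def]
  -- `G` and `Δ ∘ S` are a left and a right inverse of `Δ` for the convolution
  have h₇ : WithConv.toConv G * WithConv.toConv (comul (R := k) (A := B)) = 1 :=
    WithConv.ext (LinearMap.ext h₁)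
  exact LinearMap.congr_fun (congrArg WithConv.ofConv
    (left_inv_eq_right_inv h₇ LinearMap.comul_right_inv).symm) b

lemma antipodeInv_antipode_apply (hB : Function.Bijective (antipode k (A := B))) (b : B) :
    antipodeInv k B (antipode k b) = b :=
  hB.1 (antipodeInv_apply hB _)

lemma counit_antipodeInv (hB : Function.Bijective (antipode k (A := B))) (b : B) :
    counit (R := k) (antipodeInv k B b) = counit b := by
  obtain ⟨b, rfl⟩ := hB.2 b
  rw [antipodeInv_antipode_apply hB, counit_antipode]

lemma comul_antipodeInv (hB : Function.Bijective (antipode k (A := B))) (b : B) :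
    comul (R := k) (antipodeInv k B b) =
    TensorProduct.map (antipodeInv k B) (antipodeInv k B)
      (TensorProduct.comm k B B (comul (R := k) b)) := by
  obtain ⟨b, rfl⟩ := hB.2 b
  have h : antipodeInv k B ∘ₗ antipode k = LinearMap.id :=
    LinearMap.ext (antipodeInv_antipode_apply hB)
  rw [antipodeInv_antipode_apply hB, comul_antipode, TensorProduct.map_comm,
    ← LinearMap.comp_apply, ← TensorProduct.map_comp, h]
  simp

lemma antipodeInv_mul_antidistrib (hB : Function.Bijective (antipode k (A := B))) (a b : B) :
    antipodeInv k B (a * b) = antipodeInv k B b * antipodeInv k B a := by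
  apply hB.1
  rw [HopfAlgebra.antipode_mul_antidistrib]
  simp only [antipodeInv_apply hB]

end Antipode

end BraidedDuality

/-! ### The dual as a Yetter–Drinfeld module -/

namespace BraidedDuality

section Contraction

open TensorProduct Coalgebra HopfAlgebra Ops

variable {k B H : Type*} [Field k] [Ring B] [HopfAlgebra k B] [AddCommGroup H] [Module k H]
  {U : Submodule k (Module.Dual k H)}

/-- Evaluation of the second factor of `M ⊗ U` at an element of `H`. -/
noncomputable def contract (U : Submodule k (Module.Dual k H)) (M : Type*) [AddCommMonoid M]
    [Module k M] (x : H) : M ⊗[k] U →ₗ[k] M :=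
  (TensorProduct.rid k M).toLinearMap ∘ₗ ((TensorProduct.curry (ev U)).flip x).lTensor M

variable {M N : Type*} [AddCommMonoid M] [Module k M] [AddCommMonoid N] [Module k N]

@[simp] lemma contract_tmul (x : H) (m : M) (f : U) : contract U M x (m ⊗ₜ f) = f.1 x • m := by
  simp [contract, ev]

/-- The elements of `H` separate the points of `M ⊗ U`. -/
theorem contract_ext {s t : M ⊗[k] U} (h : ∀ x, contract U M x s = contract U M x t) : s = t := by
  let : AddCommGroup M := Module.addCommMonoidToAddCommGroup k
  have h₁ : Function.Injective (U.subtype.lTensor M) :=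
    Module.Flat.lTensor_preserves_injective_linearMap U.subtype U.injective_subtype
  have h₂ (t : M ⊗[k] U) (x : H) : dualTensorHom k H M
      (TensorProduct.comm k M (Module.Dual k H) (U.subtype.lTensor M t)) x = contract U M x t := by
    induction t with
    | zero => simp
    | add s t hs ht => simp only [map_add, LinearMap.add_apply, hs, ht]
    | tmul m f => simp
  apply h₁
  apply (TensorProduct.comm k M _).injective
  apply dualTensorHom_injective H M
  ext x
  rw [h₂, h₂, h]

lemma contract_rTensor (φ : M →ₗ[k] N) (x : H) (t : M ⊗[k] U) :
    contract U N x (φ.rTensor U t) = φ (contract U M x t) := by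
  induction t with
  | zero => simp
  | add s t hs ht => simp only [map_add, hs, ht]
  | tmul m f => simp

lemma contract_assoc_symm (x : H) (t : M ⊗[k] (N ⊗[k] U)) :
    contract U (M ⊗[k] N) x ((TensorProduct.assoc k M N U).symm t) =
      (contract U N x).lTensor M t := by
  induction t with
  | zero => simp
  | add s t hs ht => simp only [map_add, hs, ht]
  | tmul m t =>
    induction t with
    | zero => simp
    | add s t hs ht => simp only [map_add, tmul_add, hs, ht]
    | tmul m f => simp

lemma coactPairing_apply (t : B ⊗[k] U) (x : H) : coactPairing B U t x = contract U B x t := by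
  induction t with
  | zero => simp
  | add s t hs ht => simp only [map_add, LinearMap.add_apply, hs, ht]
  | tmul m f => simp [coactPairing_tmul]

/-- `b ⊗ h ↦ f(h) S⁻¹(b)`. -/
noncomputable def invPairing (B : Type*) [Ring B] [HopfAlgebra k B] (f : Module.Dual k H) :
    B ⊗[k] H →ₗ[k] B :=
  (TensorProduct.rid k B).toLinearMap ∘ₗ TensorProduct.map (antipodeInv k B) f

@[simp] lemma invPairing_tmul (f : Module.Dual k H) (b : B) (x : H) :
    invPairing B f (b ⊗ₜ x) = f x • antipodeInv k B b := by
  simp [invPairing]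

variable {𝓗 : Ops k B H}

lemma contract_coact (hU : IsYDSubobject 𝓗 U) (f : U) (x : H) :
    contract U B x ((dualOps 𝓗 U).coact f) = invPairing B f.1 (𝓗.coact x) := by
  rw [← coactPairing_apply, dualOps_coact hU]
  rfl

lemma contract_act (hU : IsYDSubobject 𝓗 U) (b c : B) (x : H) (t : B ⊗[k] U) :
    contract U B x ((dualOps 𝓗 U).diagAct (b ⊗ₜ c) t) =
      b * contract U B (𝓗.act (antipode k c ⊗ₜ x)) t := by
  induction t with
  | zero => simp
  | add s t hs ht => simp only [map_add, mul_add, hs, ht]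
  | tmul m f => simp [dualOps_act hU]

lemma contract_rightMul (c : B) (x : H) (t : B ⊗[k] U) :
    contract U B x (rightMul k B U c t) = contract U B x t * c := by
  induction t with
  | zero => simp
  | add s t hs ht => simp only [map_add, add_mul, hs, ht]
  | tmul m f => simp

/-- A space of functionals closed under action and coaction is a Yetter–Drinfeld module. -/
theorem isYD_dualOps (hB : Function.Bijective (antipode k (A := B))) (h𝓗 : 𝓗.IsYD)
    (hU : IsYDSubobject 𝓗 U) : (dualOps 𝓗 U).IsYD where
  one_act f := by
    ext x
    rw [dualOps_act hU, antipode_one, h𝓗.one_act]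
  mul_act a b f := by
    ext x
    rw [dualOps_act hU, dualOps_act hU, dualOps_act hU, antipode_mul_antidistrib, h𝓗.mul_act]
  counit_coact f := by
    ext x
    have h₁ (t : B ⊗[k] U) : (TensorProduct.lid k U ((counit (R := k)).rTensor U t)).1 x =
        counit (R := k) (contract U B x t) := by
      induction t with
      | zero => simp
      | add s t hs ht => simp only [map_add, Submodule.coe_add, LinearMap.add_apply, hs, ht]
      | tmul b f => simp [mul_comm]
    have h₂ (t : B ⊗[k] H) : counit (R := k) (invPairing B f.1 t) =
        f.1 (TensorProduct.lid k H ((counit (R := k)).rTensor H t)) := by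
      induction t with
      | zero => simp
      | add s t hs ht => simp only [map_add, hs, ht]
      | tmul b x => simp [counit_antipodeInv hB, mul_comm]
    rw [h₁, contract_coact hU, h₂, h𝓗.counit_coact]
  coassoc f := by
    apply (TensorProduct.assoc k B B U).symm.injective
    refine contract_ext fun x => ?_
    rw [LinearEquiv.symm_apply_apply, contract_rTensor, contract_coact hU, contract_assoc_symm,
      ← LinearMap.lTensor_comp_apply]
    let F : B ⊗[k] (B ⊗[k] H) →ₗ[k] B ⊗[k] B := (TensorProduct.comm k B B).toLinearMap ∘ₗ
      TensorProduct.map (antipodeInv k B) (invPairing B f.1)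
    have h₁ (t : B ⊗[k] H) : comul (R := k) (invPairing B f.1 t) =
        F (TensorProduct.assoc k B B H (comul.rTensor H t)) := by
      induction t with
      | zero => simp
      | add s t hs ht => simp only [map_add, hs, ht]
      | tmul b y =>
        have h₂ (p : B ⊗[k] B) : f.1 y • TensorProduct.map (antipodeInv k B) (antipodeInv k B)
            (TensorProduct.comm k B B p) = F (TensorProduct.assoc k B B H (p ⊗ₜ y)) := by
          induction p with
          | zero => simp
          | add s t hs ht => simp only [map_add, smul_add, add_tmul, hs, ht]
          | tmul a c => simp [F, smul_tmul']
        simpa [comul_antipodeInv hB] using h₂ (comul b)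
    let K (t : B ⊗[k] H) : U →ₗ[k] B :=
      { toFun := fun g => invPairing B g.1 t
        map_add' := fun g h => by simp [invPairing, TensorProduct.map_add_right]
        map_smul' := fun c g => by simp [invPairing, TensorProduct.map_smul_right] }
    have h₃ : contract U B x ∘ₗ (dualOps 𝓗 U).coact = K (𝓗.coact x) :=
      LinearMap.ext fun g => contract_coact hU g x
    have h₄ (t : B ⊗[k] H) : (K t).lTensor B ((dualOps 𝓗 U).coact f) =
        F (𝓗.coact.lTensor B t) := by
      induction t with
      | zero =>
        have : K 0 = 0 := LinearMap.ext fun g => by simp [K]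
        simp [this]
      | add s t hs ht =>
        have : K (s + t) = K s + K t := LinearMap.ext fun g => map_add (invPairing B g.1) s t
        simp only [this, LinearMap.lTensor_add, LinearMap.add_apply, map_add, hs, ht]
      | tmul b y =>
        have h₅ (s : B ⊗[k] U) : (K (b ⊗ₜ y)).lTensor B s =
            contract U B y s ⊗ₜ antipodeInv k B b := by
          induction s with
          | zero => simp
          | add s t hs ht => simp only [map_add, add_tmul, hs, ht]
          | tmul a g => simp [K, smul_tmul]
        rw [h₅, contract_coact hU]
        simp [F]
    rw [h₁, h₃, h₄, h𝓗.coassoc]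
  compat := by
    refine TensorProduct.ext' fun b f =>
      Ops.Compatible.coact_act (X := dualOps 𝓗 U) (fun b => contract_ext fun x => ?_) b
    -- the compatibility for `x` and `S(b)`, read through `S⁻¹ ⊗ f`
    have key := congrArg (invPairing B f.1) (h𝓗.compatible x (antipode k b))
    rw [comul_antipode] at key
    have h₁ (q : B ⊗[k] B) : invPairing B f.1 (𝓗.diagAct (TensorProduct.map (antipode k)
        (antipode k) (TensorProduct.comm k B B q)) (𝓗.coact x)) =
        contract U B x (rightConv ((dualOps 𝓗 U).coact ∘ₗ (dualOps 𝓗 U).actAt f)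
          LinearMap.id q) := by
      induction q with
      | zero => simp
      | add s t hs ht => simp only [map_add, LinearMap.add_apply, hs, ht]
      | tmul a c =>
        have h₂ (t : B ⊗[k] H) : invPairing B f.1 (𝓗.diagAct (antipode k c ⊗ₜ antipode k a) t) =
            invPairing B ((dualOps 𝓗 U).act (a ⊗ₜ f)).1 t * c := by
          induction t with
          | zero => simp
          | add s t hs ht => simp only [map_add, add_mul, hs, ht]
          | tmul d y => simp [dualOps_act hU, antipodeInv_mul_antidistrib hB,
              antipodeInv_antipode_apply hB]
        simp [h₂, contract_rightMul, contract_coact hU]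
    have h₂ (q : B ⊗[k] B) : invPairing B f.1 (rightConv (𝓗.coact ∘ₗ 𝓗.actAt x) LinearMap.id
        (TensorProduct.map (antipode k) (antipode k) (TensorProduct.comm k B B q))) =
        contract U B x ((dualOps 𝓗 U).diagAct q ((dualOps 𝓗 U).coact f)) := by
      induction q with
      | zero => simp
      | add s t hs ht => simp only [map_add, LinearMap.add_apply, hs, ht]
      | tmul a c =>
        have h₃ (t : B ⊗[k] H) : invPairing B f.1 (rightMul k B H (antipode k a) t) =
            a * invPairing B f.1 t := by
          induction t with
          | zero => simp
          | add s t hs ht => simp only [map_add, mul_add, hs, ht]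
          | tmul d y => simp [antipodeInv_mul_antidistrib hB, antipodeInv_antipode_apply hB]
        simp [h₃, contract_act hU, contract_coact hU]
    rw [← h₂, ← h₁, key]

end Contraction

end BraidedDuality

/-! ### Morphisms into the dual -/

namespace BraidedDuality

section Criterion

open TensorProduct Coalgebra HopfAlgebra Ops

variable {k B H : Type*} [Field k] [Ring B] [HopfAlgebra k B] [AddCommGroup H] [Module k H]
  {U : Submodule k (Module.Dual k H)} {𝓗 : Ops k B H}
  {V W : Type*} [AddCommMonoid V] [Module k V] [AddCommMonoid W] [Module k W]
  {X : Ops k B V} {Y : Ops k B W}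

/-- The evaluation `U ⊗ H → k` is a morphism. -/
theorem isHom_ev (hB : Function.Bijective (antipode k (A := B))) (h𝓗 : 𝓗.IsYD)
    (hU : IsYDSubobject 𝓗 U) : IsHom ((dualOps 𝓗 U).tensor 𝓗) (unitOps k B) (ev U) := by
  constructor
  · refine TensorProduct.ext' fun b t => ?_
    induction t with
    | zero => simp
    | add s t hs ht => simp only [tmul_add, map_add, hs, ht]
    | tmul f x =>
      have h₁ (q : B ⊗[k] B) : ev U ((dualOps 𝓗 U).pairAct 𝓗 q (f ⊗ₜ x)) =
          f.1 (𝓗.act (LinearMap.mul' k B ((antipode k).rTensor B q) ⊗ₜ x)) := by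
        induction q with
        | zero => simp
        | add s t hs ht => simp only [map_add, add_tmul, LinearMap.add_apply, hs, ht]
        | tmul a c => simp [ev, dualOps_act hU, h𝓗.mul_act]
      simp only [LinearMap.comp_apply, LinearMap.lTensor_tmul]
      rw [tensor_act, h₁, mul_antipode_rTensor_comul_apply, Algebra.algebraMap_eq_smul_one,
        ← smul_tmul', map_smul, h𝓗.one_act, unitOps_act]
      simp [ev]
  · refine TensorProduct.ext' fun f x => ?_
    have h₁ (t : B ⊗[k] H) : TensorProduct.rid k B ((ev U).lTensor B
        (coMul k B U H ((dualOps 𝓗 U).coact f) t)) =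
        LinearMap.mul' k B (TensorProduct.comm k B B ((invPairing B f.1).lTensor B
          (𝓗.coact.lTensor B t))) := by
      induction t with
      | zero => simp
      | add s t hs ht => simp only [map_add, hs, ht]
      | tmul b y =>
        have h₂ (s : B ⊗[k] U) : TensorProduct.rid k B ((ev U).lTensor B
            (coMul k B U H s (b ⊗ₜ y))) = contract U B y s * b := by
          induction s with
          | zero => simp
          | add s t hs ht => simp only [map_add, add_mul, LinearMap.add_apply, hs, ht]
          | tmul a g => simp [ev]
        rw [h₂, contract_coact hU]
        simp
    have h₃ (t : B ⊗[k] H) : LinearMap.mul' k B (TensorProduct.comm k B B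
        ((invPairing B f.1).lTensor B (TensorProduct.assoc k B B H (comul.rTensor H t)))) =
        f.1 (TensorProduct.lid k H ((counit (R := k)).rTensor H t)) • 1 := by
      induction t with
      | zero => simp
      | add s t hs ht => simp only [map_add, add_smul, hs, ht]
      | tmul b y =>
        have h₄ (p : B ⊗[k] B) : LinearMap.mul' k B (TensorProduct.comm k B B
            ((invPairing B f.1).lTensor B (TensorProduct.assoc k B B H (p ⊗ₜ y)))) =
            f.1 y • LinearMap.mul' k B
              ((antipodeInv k B).rTensor B (TensorProduct.comm k B B p)) := by
          induction p with
          | zero => simp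
          | add s t hs ht => simp only [map_add, smul_add, add_tmul, hs, ht]
          | tmul a c => simp
        rw [LinearMap.rTensor_tmul, h₄, antipodeInv_mul hB, Algebra.algebraMap_eq_smul_one]
        simp [mul_smul, smul_comm (f.1 y)]
    apply (TensorProduct.rid k B).injective
    simp only [LinearMap.comp_apply]
    rw [tensor_coact, h₁, ← h𝓗.coassoc, h₃, h𝓗.counit_coact, unitOps_coact]
    simp [ev]

lemma contract_pairAct (hU : IsYDSubobject 𝓗 U) (x : H) (b c : B) (t : V ⊗[k] U) :
    contract U V x (X.pairAct (dualOps 𝓗 U) (b ⊗ₜ c) t) =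
      X.act (b ⊗ₜ contract U V (𝓗.act (antipode k c ⊗ₜ x)) t) := by
  induction t with
  | zero => simp
  | add s t hs ht => simp only [map_add, tmul_add, hs, ht]
  | tmul m f => simp [dualOps_act hU]

variable (V) in
/-- The pairing of `V ⊗ U` with `H` as a linear map with values in `Hom(H, V)`. -/
noncomputable def contractHom (U : Submodule k (Module.Dual k H)) : V ⊗[k] U →ₗ[k] (H →ₗ[k] V) :=
  dualTensorHom k H V ∘ₗ (TensorProduct.comm k V (Module.Dual k H)).toLinearMap ∘ₗ
    U.subtype.lTensor V

@[simp] lemma contractHom_apply (t : V ⊗[k] U) (x : H) :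
    contractHom V U t x = contract U V x t := by
  induction t with
  | zero => simp
  | add s t hs ht => simp only [map_add, LinearMap.add_apply, hs, ht]
  | tmul m f => simp [contractHom]

/-- `b ⊗ x ↦ φ(x) S⁻¹(b)`, where `B` acts on `B ⊗ W` by right multiplication. -/
noncomputable def invTranslate (φ : H →ₗ[k] B ⊗[k] W) : B ⊗[k] H →ₗ[k] B ⊗[k] W :=
  TensorProduct.lift (((rightMul k B W).compl₂ φ) ∘ₗ antipodeInv k B)

@[simp] lemma invTranslate_tmul (φ : H →ₗ[k] B ⊗[k] W) (b : B) (x : H) :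
    invTranslate φ (b ⊗ₜ x) = rightMul k B W (antipodeInv k B b) (φ x) := by
  simp [invTranslate]

lemma contract_coact_tensor (hU : IsYDSubobject 𝓗 U) (x : H) (t : W ⊗[k] U) :
    (contract U W x).lTensor B ((Y.tensor (dualOps 𝓗 U)).coact t) =
      invTranslate (Y.coact ∘ₗ contractHom W U t) (𝓗.coact x) := by
  have h₁ (s : B ⊗[k] W) (t : B ⊗[k] U) : (contract U W x).lTensor B (coMul k B W U s t) =
      rightMul k B W (contract U B x t) s := by
    induction s with
    | zero => simp
    | add s t hs ht => simp only [map_add, LinearMap.add_apply, hs, ht]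
    | tmul a w =>
      induction t with
      | zero => simp
      | add s t hs ht => simp only [map_add, LinearMap.add_apply, hs, ht]
      | tmul b f => simp [smul_tmul']
  induction t with
  | zero =>
    have : invTranslate (B := B) (W := W) (0 : H →ₗ[k] B ⊗[k] W) = 0 :=
      TensorProduct.ext' fun b x => by simp
    simp [this]
  | add s t hs ht =>
    have (φ χ : H →ₗ[k] B ⊗[k] W) : invTranslate (φ + χ) = invTranslate φ + invTranslate χ :=
      TensorProduct.ext' fun b x => by simp
    rw [map_add, map_add, hs, ht, map_add, LinearMap.comp_add, this, LinearMap.add_apply]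
  | tmul w f =>
    have h₂ (r : B ⊗[k] H) : invTranslate (Y.coact ∘ₗ contractHom W U (w ⊗ₜ f)) r =
        rightMul k B W (invPairing B f.1 r) (Y.coact w) := by
      induction r with
      | zero => simp
      | add s t hs ht => simp only [map_add, LinearMap.add_apply, hs, ht]
      | tmul b y => simp
    rw [tensor_coact, h₁, contract_coact hU, h₂]

/-- A linear map with values in `W ⊗ U` is a morphism as soon as its pairing with `H` is one. All
structure maps of `U`, and the map `j`, are recognized as morphisms in this way. -/
theorem isHom_of_pairing (hB : Function.Bijective (antipode k (A := B))) (h𝓗 : 𝓗.IsYD)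
    (hU : IsYDSubobject 𝓗 U) {F : V →ₗ[k] W ⊗[k] U} {G : V ⊗[k] H →ₗ[k] W}
    (hG : IsHom (X.tensor 𝓗) Y G) (hFG : ∀ v x, contract U W x (F v) = G (v ⊗ₜ x)) :
    IsHom X (Y.tensor (dualOps 𝓗 U)) F := by
  refine .of_apply (fun b v => contract_ext fun x => ?_) fun v => ?_
  · let M : B ⊗[k] (B ⊗[k] B) →ₗ[k] V ⊗[k] H := TensorProduct.map (X.actAt v)
      (𝓗.actAt x ∘ₗ LinearMap.mul' k B ∘ₗ (antipode k).lTensor B)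
    have h₁ (p : B ⊗[k] B) (c : B) : X.pairAct 𝓗 p (v ⊗ₜ 𝓗.act (antipode k c ⊗ₜ x)) =
        M (TensorProduct.assoc k B B B (p ⊗ₜ c)) := by
      induction p with
      | zero => simp
      | add s t hs ht => simp only [map_add, add_tmul, LinearMap.add_apply, hs, ht]
      | tmul a d => simp [M, h𝓗.mul_act]
    have h₂ (q : B ⊗[k] B) : contract U W x (Y.pairAct (dualOps 𝓗 U) q (F v)) =
        G (M (TensorProduct.assoc k B B B (comul.rTensor B q))) := by
      induction q with
      | zero => simp
      | add s t hs ht => simp only [map_add, LinearMap.add_apply, hs, ht]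
      | tmul a c =>
        rw [contract_pairAct hU, hFG, ← hG.act_apply, tensor_act, h₁, LinearMap.rTensor_tmul]
    have h₃ (q : B ⊗[k] B) : M (comul.lTensor B q) =
        X.act (TensorProduct.rid k B ((counit (R := k)).lTensor B q) ⊗ₜ v) ⊗ₜ x := by
      induction q with
      | zero => simp
      | add s t hs ht => simp only [map_add, add_tmul, hs, ht]
      | tmul a c =>
        have h₄ : LinearMap.mul' k B ((antipode k).lTensor B (comul (R := k) c)) =
            counit (R := k) c • 1 := by
          rw [mul_antipode_lTensor_comul_apply, Algebra.algebraMap_eq_smul_one]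
        simp [M, h₄, ← smul_tmul', h𝓗.one_act]
    rw [tensor_act, h₂, Coalgebra.coassoc_apply, h₃, hFG]
    simp
  · apply (TensorProduct.assoc k B W U).symm.injective
    refine contract_ext fun x => ?_
    rw [contract_assoc_symm, contract_assoc_symm, contract_coact_tensor hU,
      ← LinearMap.lTensor_comp_apply]
    let N (s : B ⊗[k] V) : B ⊗[k] (B ⊗[k] H) →ₗ[k] B ⊗[k] W :=
      TensorProduct.lift (((rightMul k B W).compl₂ (G.lTensor B ∘ₗ coMul k B V H s)) ∘ₗ
        antipodeInv k B)
    have hN (s : B ⊗[k] V) (b : B) (t : B ⊗[k] H) : N s (b ⊗ₜ t) =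
        rightMul k B W (antipodeInv k B b) (G.lTensor B (coMul k B V H s t)) := by simp [N]
    have h₁ (r : B ⊗[k] H) : invTranslate (Y.coact ∘ₗ contractHom W U (F v)) r =
        N (X.coact v) (𝓗.coact.lTensor B r) := by
      induction r with
      | zero => simp
      | add s t hs ht => simp only [map_add, hs, ht]
      | tmul b y =>
        rw [LinearMap.lTensor_tmul, hN, ← tensor_coact, ← hG.coact_apply]
        simp [hFG]
    have h₂ (r : B ⊗[k] H) (a : B) (u : V) : N (a ⊗ₜ u)
        (TensorProduct.assoc k B B H (comul.rTensor H r)) =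
          a ⊗ₜ G (u ⊗ₜ TensorProduct.lid k H ((counit (R := k)).rTensor H r)) := by
      induction r with
      | zero => simp
      | add s t hs ht => simp only [map_add, tmul_add, hs, ht]
      | tmul b y =>
        have h₃ (p : B ⊗[k] B) : N (a ⊗ₜ u) (TensorProduct.assoc k B B H (p ⊗ₜ y)) =
            (a * LinearMap.mul' k B (TensorProduct.comm k B B ((antipodeInv k B).rTensor B p))) ⊗ₜ
              G (u ⊗ₜ y) := by
          induction p with
          | zero => simp
          | add s t hs ht => simp only [map_add, add_tmul, mul_add, hs, ht]
          | tmul c d => simp [hN, mul_assoc]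
        rw [LinearMap.rTensor_tmul, h₃, mul_antipodeInv_comul hB, Algebra.algebraMap_eq_smul_one]
        simp [smul_tmul]
    have h₄ (s : B ⊗[k] V) : N s (𝓗.coact.lTensor B (𝓗.coact x)) =
        (contract U W x ∘ₗ F).lTensor B s := by
      induction s with
      | zero =>
        refine LinearMap.congr_fun (f := N 0) (g := 0) (TensorProduct.ext' fun b t => ?_) _
        simp [hN]
      | add s t hs ht =>
        have : N (s + t) = N s + N t := TensorProduct.ext' fun b t => by simp [hN]
        simp only [this, map_add, LinearMap.add_apply, hs, ht]
      | tmul a u =>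
        rw [← h𝓗.coassoc, h₂, h𝓗.counit_coact]
        simp [hFG]
    rw [h₁, h₄]

/-- A linear map with values in `U` is a morphism as soon as its pairing with `H` is one. -/
theorem isHom_of_pairing_dual (hB : Function.Bijective (antipode k (A := B))) (h𝓗 : 𝓗.IsYD)
    (hU : IsYDSubobject 𝓗 U) {F : V →ₗ[k] U} {G : V ⊗[k] H →ₗ[k] k}
    (hG : IsHom (X.tensor 𝓗) (unitOps k B) G) (hFG : ∀ v x, (F v).1 x = G (v ⊗ₜ x)) :
    IsHom X (dualOps 𝓗 U) F := by
  have h := isHom_of_pairing (F := (TensorProduct.lid k U).symm.toLinearMap ∘ₗ F) hB h𝓗 hU hG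
    fun v x => by simp [← hFG]
  have h' := (isHom_lid (dualOps 𝓗 U)).comp h
  have : F = (TensorProduct.lid k U).toLinearMap ∘ₗ
      (TensorProduct.lid k U).symm.toLinearMap ∘ₗ F := by ext; simp
  rwa [this]

end Criterion

end BraidedDuality

/-! ### The structure maps of the dual -/

namespace BraidedDuality

section DualStructure

open TensorProduct Coalgebra HopfAlgebra Ops

section Middle

variable {k B V W P Q : Type*} [Field k] [Ring B] [HopfAlgebra k B]
  [AddCommMonoid V] [Module k V] [AddCommMonoid W] [Module k W]
  [AddCommMonoid P] [Module k P] [AddCommMonoid Q] [Module k Q]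

lemma isHom_middle (X : Ops k B V) {Y : Ops k B W} {Z : Ops k B P} (T : Ops k B Q)
    {c : W ⊗[k] P →ₗ[k] P ⊗[k] W} (hc : IsHom (Y.tensor Z) (Z.tensor Y) c) :
    IsHom ((X.tensor Y).tensor (Z.tensor T)) ((X.tensor Z).tensor (Y.tensor T))
      (middle (V := V) (Q := Q) c) :=
  (isHom_assoc X Z (Y.tensor T)).symm.comp (((IsHom.id X).map ((isHom_assoc Z Y T).comp
    ((hc.map (IsHom.id T)).comp (isHom_assoc Y Z T).symm))).comp (isHom_assoc X Y (Z.tensor T)))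

end Middle

variable {k B H : Type*} [Field k] [Ring B] [HopfAlgebra k B] [AddCommGroup H] [Module k H]
  {U : Submodule k (Module.Dual k H)}

lemma braidingInv_eq_invTwist (𝓗 : Ops k B H) (z : H ⊗[k] H) :
    invTwist 𝓗 z = TensorProduct.comm k H H (braidingInv 𝓗 𝓗 z) := by
  induction z with
  | zero => simp
  | add s t hs ht => simp only [map_add, hs, ht]
  | tmul x y =>
    have h (t : B ⊗[k] H) : 𝓗.act.lTensor H (TensorProduct.leftComm k B H H
        (TensorProduct.assoc k B H H ((antipodeInv k B).rTensor H t ⊗ₜ x))) =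
        TensorProduct.comm k H H (𝓗.act.rTensor H (TensorProduct.rightComm k B H H
          ((antipodeInv k B).rTensor H t ⊗ₜ x))) := by
      induction t with
      | zero => simp
      | add s t hs ht => simp only [map_add, add_tmul, hs, ht]
      | tmul b y => simp
    simp [invTwist, braidingInv, h]

/-- Composed with the braiding of `H`, the pairing `ev₂` is the evaluation of nested factors,
`(f ⊗ g, x ⊗ y) ↦ f(y) g(x)`. -/
lemma ev₂_braiding (hB : Function.Bijective (antipode k (A := B))) {𝓗 : Ops k B H}
    (h𝓗 : 𝓗.IsYD) (hU : IsYDSubobject 𝓗 U) (t : U ⊗[k] U) (x y : H) :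
    ev₂ 𝓗 U t (braiding 𝓗 𝓗 (x ⊗ₜ y)) = (contract U U x t).1 y := by
  rw [ev₂_apply hU, braidingInv_eq_invTwist, braidingInv_braiding hB h𝓗 h𝓗]
  induction t with
  | zero => simp
  | add s t hs ht => simp only [map_add, LinearMap.add_apply, Submodule.coe_add, hs, ht]
  | tmul f g => simp [mul_comm]

/-- The pairing of `U ⊗ U` with `H ⊗ H` as a functional on the fourfold tensor product. -/
noncomputable def evPair (𝓗 : Ops k B H) (U : Submodule k (Module.Dual k H)) :
    (U ⊗[k] U) ⊗[k] (H ⊗[k] H) →ₗ[k] k :=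
  LinearMap.mul' k k ∘ₗ TensorProduct.map (ev U) (ev U) ∘ₗ middle (braiding (dualOps 𝓗 U) 𝓗)

lemma isHom_evPair (hB : Function.Bijective (antipode k (A := B))) {𝓗 : Ops k B H}
    (h𝓗 : 𝓗.IsYD) (hU : IsYDSubobject 𝓗 U) :
    IsHom (((dualOps 𝓗 U).tensor (dualOps 𝓗 U)).tensor (𝓗.tensor 𝓗)) (unitOps k B)
      (evPair 𝓗 U) := by
  have h := ((isHom_lid (unitOps k B)).comp ((isHom_ev hB h𝓗 hU).map (isHom_ev hB h𝓗 hU))).comp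
    (isHom_middle (dualOps 𝓗 U) 𝓗 (isHom_braiding (isYD_dualOps hB h𝓗 hU) h𝓗))
  have h' : (TensorProduct.lid k k).toLinearMap = LinearMap.mul' k k := by ext; simp
  rw [h'] at h
  exact h

lemma rid_ev_assoc {M : Type*} [AddCommMonoid M] [Module k M] (t : M ⊗[k] U) (x : H) :
    TensorProduct.rid k M ((ev U).lTensor M (TensorProduct.assoc k M U H (t ⊗ₜ x))) =
      contract U M x t := by
  induction t with
  | zero => simp
  | add s t hs ht => simp only [map_add, add_tmul, hs, ht]
  | tmul m f => simp [ev]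

lemma ev_tmul (f : U) (x : H) : ev U (f ⊗ₜ x) = f.1 x := by simp [ev]

section Hopf

variable {𝓗 : HopfOps k B H}

theorem isHom_dual_mul (hB : Function.Bijective (antipode k (A := B))) (h𝓗 : 𝓗.IsHopf)
    (hU : IsHopfSubalgebra 𝓗 U) :
    IsHom ((dualOps 𝓗.toOps U).tensor (dualOps 𝓗.toOps U)) (dualOps 𝓗.toOps U)
      (dualHopfOps 𝓗 U).mul :=
  isHom_of_pairing_dual hB h𝓗.isAlg.isYD hU.isSub
    ((isHom_evPair hB h𝓗.isAlg.isYD hU.isSub).comp ((IsHom.id _).map h𝓗.comul_isHom))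
    fun t x => dualHopfOps_mul hU t x

theorem isHom_dual_one (hB : Function.Bijective (antipode k (A := B))) (h𝓗 : 𝓗.IsHopf)
    (hU : IsHopfSubalgebra 𝓗 U) :
    IsHom (unitOps k B) (dualOps 𝓗.toOps U)
      (LinearMap.toSpanSingleton k U (dualHopfOps 𝓗 U).one) :=
  isHom_of_pairing_dual hB h𝓗.isAlg.isYD hU.isSub
    (h𝓗.counit_isHom.comp (isHom_lid 𝓗.toOps)) fun c x => by
      simp [dualHopfOps_one hU]

theorem isHom_dual_antipode (hB : Function.Bijective (antipode k (A := B))) (h𝓗 : 𝓗.IsHopf)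
    (hU : IsHopfSubalgebra 𝓗 U) :
    IsHom (dualOps 𝓗.toOps U) (dualOps 𝓗.toOps U) (dualHopfOps 𝓗 U).antipode :=
  isHom_of_pairing_dual hB h𝓗.isAlg.isYD hU.isSub
    ((isHom_ev hB h𝓗.isAlg.isYD hU.isSub).comp ((IsHom.id _).map h𝓗.antipode_isHom))
    fun f x => by
      rw [dualHopfOps_antipode hU]
      simp [ev]

theorem isHom_dual_comul (hB : Function.Bijective (antipode k (A := B))) (h𝓗 : 𝓗.IsHopf)
    (hU : IsHopfSubalgebra 𝓗 U) :
    IsHom (dualOps 𝓗.toOps U) ((dualOps 𝓗.toOps U).tensor (dualOps 𝓗.toOps U))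
      (dualHopfOps 𝓗 U).comul := by
  have hY := h𝓗.isAlg.isYD
  have hD := isYD_dualOps hB hY hU.isSub
  let G : U ⊗[k] H →ₗ[k] U := (TensorProduct.rid k U).toLinearMap ∘ₗ (ev U).lTensor U ∘ₗ
    (TensorProduct.assoc k U U H).toLinearMap ∘ₗ (dualHopfOps 𝓗 U).comul.rTensor H
  have hG (f : U) (x : H) : contract U U x ((dualHopfOps 𝓗 U).comul f) = G (f ⊗ₜ x) := by
    simp [G, rid_ev_assoc]
  refine isHom_of_pairing hB hY hU.isSub (isHom_of_pairing_dual hB hY hU.isSub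
    ((isHom_ev hB hY hU.isSub).comp (((IsHom.id _).map (h𝓗.isAlg.mul_isHom.comp
      (isHom_braiding hY hY))).comp (isHom_assoc _ _ _))) fun t y => ?_) hG
  induction t with
  | zero => simp
  | add s t hs ht => simp only [map_add, Submodule.coe_add, LinearMap.add_apply, add_tmul, hs, ht]
  | tmul f x =>
    rw [← hG, ← ev₂_braiding hB hY hU.isSub, dualHopfOps_comul hB h𝓗 hU]
    simp [ev]

end Hopf

section Symmetry

variable {V W V' W' : Type*} [AddCommMonoid V] [Module k V] [AddCommMonoid W] [Module k W]
  [AddCommMonoid V'] [Module k V'] [AddCommMonoid W'] [Module k W']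
  {X : Ops k B V} {Y : Ops k B W} {X' : Ops k B V'} {Y' : Ops k B W'}

/-- The symmetry of the braiding passes to subobjects. -/
lemma IsSymmetricPair.of_injective {f : V →ₗ[k] V'} {g : W →ₗ[k] W'} (hf : IsHom X X' f)
    (hg : IsHom Y Y' g) (hf' : Function.Injective f) (hg' : Function.Injective g)
    (h : IsSymmetricPair X' Y') : IsSymmetricPair X Y := by
  let : AddCommGroup V := Module.addCommMonoidToAddCommGroup k
  let : AddCommGroup W := Module.addCommMonoidToAddCommGroup k
  let : AddCommGroup V' := Module.addCommMonoidToAddCommGroup k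
  let : AddCommGroup W' := Module.addCommMonoidToAddCommGroup k
  refine LinearMap.ext fun t => TensorProduct.map_injective_of_flat_flat f g hf' hg' ?_
  rw [LinearMap.comp_apply, ← braiding_natural hg hf, ← braiding_natural hf hg]
  exact LinearMap.congr_fun h _

lemma isHom_inclusion {𝓗 : Ops k B H} {E : Submodule k (Module.Dual k H)}
    (hU : IsYDSubobject 𝓗 U) (hE : IsYDSubobject 𝓗 E) (h : U ≤ E) :
    IsHom (dualOps 𝓗 U) (dualOps 𝓗 E) (Submodule.inclusion h) := by
  refine .of_apply (fun b f => ?_) fun f => contract_ext fun x => ?_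
  · ext x
    rw [dualOps_act hE]
    exact dualOps_act hU b f x
  · have h₁ (t : B ⊗[k] U) : contract E B x ((Submodule.inclusion h).lTensor B t) =
        contract U B x t := by
      induction t with
      | zero => simp
      | add s t hs ht => simp only [map_add, hs, ht]
      | tmul b f => simp
    rw [contract_coact hE, h₁, contract_coact hU]
    rfl

end Symmetry

end DualStructure

end BraidedDuality

/-! ### Algebras and Hopf algebras as objects of the category -/

namespace BraidedDuality

section TensorAlgebra

open CategoryTheory MonoidalCategory

lemma twistedMul_braiding {C : Type*} [Category* C] [MonoidalCategory C] [BraidedCategory C]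
    {X Y : C} (m : X ⊗ X ⟶ X) (m' : Y ⊗ Y ⟶ Y) :
    twistedMul m m' (β_ Y X).hom = tensorμ X Y X Y ≫ (m ⊗ₘ m') := by
  simp only [twistedMul, squareT, tensorμ]
  monoidal

end TensorAlgebra

section Translation

open TensorProduct Coalgebra CategoryTheory MonoidalCategory YDModule MonObj ComonObj HopfObj

universe u v w

variable {k : Type u} {B : Type v} [Field k] [Ring B] [HopfAlgebra k B]

namespace Model

variable {V W P Q : Type*} [AddCommMonoid V] [Module k V] [AddCommMonoid W] [Module k W]
  [AddCommMonoid P] [Module k P] [AddCommMonoid Q] [Module k Q]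
  {X Y Z T : YDModule.{u, v, w} k B}

section Ops

variable {X₀ : Ops k B V} {Y₀ : Ops k B W} {Z₀ : Ops k B P} {T₀ : Ops k B Q}
  {mX : Model X X₀} {mY : Model Y Y₀} {mZ : Model Z Z₀} {mT : Model T T₀}

/-! The next lemmas match the constructions in the category with those on the modelling spaces. -/

lemma Rel.middle {c : Y ⊗ Z ⟶ Z ⊗ Y} {c₀ : W ⊗[k] P →ₗ[k] P ⊗[k] W}
    (mX : Model X X₀) (mT : Model T T₀) (hc : Rel (mY.tensor mZ) (mZ.tensor mY) c c₀) :
    Rel ((mX.tensor mY).tensor (mZ.tensor mT)) ((mX.tensor mZ).tensor (mY.tensor mT))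
      ((α_ X Y (Z ⊗ T)).hom ≫ X ◁ squareT c T ≫ (α_ X Z (Y ⊗ T)).inv)
      (BraidedDuality.middle (V := V) (Q := Q) c₀) :=
  (Rel.assoc mX mY (mZ.tensor mT)).comp ((((Rel.assoc_inv mY mZ mT).comp
    ((hc.whiskerRight mT).comp (Rel.assoc mZ mY mT))).whiskerLeft mX).comp
      (Rel.assoc_inv mX mZ (mY.tensor mT)))

lemma Rel.twistedMul {c : Y ⊗ X ⟶ X ⊗ Y} {c₀ : W ⊗[k] V →ₗ[k] V ⊗[k] W}
    {m : X ⊗ X ⟶ X} {m₀ : V ⊗[k] V →ₗ[k] V} {m' : Y ⊗ Y ⟶ Y} {m'₀ : W ⊗[k] W →ₗ[k] W}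
    (hm : Rel (mX.tensor mX) mX m m₀) (hm' : Rel (mY.tensor mY) mY m' m'₀)
    (hc : Rel (mY.tensor mX) (mX.tensor mY) c c₀) :
    Rel ((mX.tensor mY).tensor (mX.tensor mY)) (mX.tensor mY) (twistedMul m m' c)
      (TensorProduct.map m₀ m'₀ ∘ₗ BraidedDuality.middle c₀) := by
  have h := (Rel.middle mX mY hc).comp (hm.tensorHom hm')
  rw [Category.assoc, Category.assoc] at h
  exact h

lemma Rel.tensorOne {x : 𝟙_ _ ⟶ X} {x₀ : V} {y : 𝟙_ _ ⟶ Y} {y₀ : W}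
    (hx : Rel (unit k B) mX x (LinearMap.toSpanSingleton k V x₀))
    (hy : Rel (unit k B) mY y (LinearMap.toSpanSingleton k W y₀)) :
    Rel (unit k B) (mX.tensor mY) (tensorOne x y)
      (LinearMap.toSpanSingleton k (V ⊗[k] W) (x₀ ⊗ₜ y₀)) :=
  ((Rel.lid_inv (unit k B)).comp (hx.tensorHom hy)).congr (by ext; simp)

lemma Rel.smashTwistMap [Fact (Function.Bijective (HopfAlgebra.antipode k (A := B)))]
    {d : Y ⟶ Y ⊗ Y} {d₀ : W →ₗ[k] W ⊗[k] W} {a : Y ⊗ X ⟶ X} {a₀ : W ⊗[k] V →ₗ[k] V}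
    (hd : Rel mY (mY.tensor mY) d d₀) (ha : Rel (mY.tensor mX) mX a a₀) :
    Rel (mY.tensor mX) (mX.tensor mY) (smashTwistMap d a) (a₀.rTensor W ∘ₗ
      (TensorProduct.assoc k W V W).symm.toLinearMap ∘ₗ (BraidedDuality.braiding Y₀ X₀).lTensor W ∘ₗ
        (TensorProduct.assoc k W W V).toLinearMap ∘ₗ d₀.rTensor V) :=
  (hd.whiskerRight mX).comp ((Rel.assoc mY mY mX).comp (((Rel.braiding mY mX).whiskerLeft mY).comp
    ((Rel.assoc_inv mY mX mY).comp (ha.whiskerRight mY))))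

end Ops

section Algebra

variable {X₀ : AlgOps k B V} (mX : Model X X₀.toOps)

/-- The monoid object modelled by an algebra. -/
@[reducible] noncomputable def monObj (h : X₀.IsAlg) : MonObj X where
  mul := mkHom (mX.tensor mX) mX h.mul_isHom
  one := mkHom (unit k B) mX h.one_isHom
  one_mul := (((rel_mkHom h.one_isHom).whiskerRight mX).comp (rel_mkHom h.mul_isHom)).eq
    (Rel.lid mX) (TensorProduct.ext' fun c x => by
      simp [← smul_tmul', h.one_mul])
  mul_one := (((rel_mkHom h.one_isHom).whiskerLeft mX).comp (rel_mkHom h.mul_isHom)).eq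
    (Rel.rid mX) (TensorProduct.ext' fun c x => by
      simp [h.mul_one])
  mul_assoc := (((rel_mkHom h.mul_isHom).whiskerRight mX).comp (rel_mkHom h.mul_isHom)).eq
    ((Rel.assoc mX mX mX).comp (((rel_mkHom h.mul_isHom).whiskerLeft mX).comp
      (rel_mkHom h.mul_isHom))) (TensorProduct.ext_threefold fun x y z => by
        simp [h.mul_assoc])

variable {mX}

/-- An algebra that models a monoid object satisfies the axioms of an algebra. -/
lemma isAlg_of_rel [MonObj X] (hm : Rel (mX.tensor mX) mX μ[X] X₀.mul)
    (ho : Rel (unit k B) mX η[X] (LinearMap.toSpanSingleton k V X₀.one)) : X₀.IsAlg where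
  isYD := mX.isYD
  mul_assoc x y z := by
    have := ((hm.whiskerRight mX).comp hm).eq_lin
      ((Rel.assoc mX mX mX).comp ((hm.whiskerLeft mX).comp hm)) (MonObj.mul_assoc X)
    simpa using LinearMap.congr_fun this ((x ⊗ₜ y) ⊗ₜ z)
  one_mul x := by
    have := ((ho.whiskerRight mX).comp hm).eq_lin (Rel.lid mX) (MonObj.one_mul X)
    simpa using LinearMap.congr_fun this (1 ⊗ₜ x)
  mul_one x := by
    have := ((ho.whiskerLeft mX).comp hm).eq_lin (Rel.rid mX) (MonObj.mul_one X)
    simpa using LinearMap.congr_fun this (x ⊗ₜ 1)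
  mul_isHom := hm.isHom
  one_isHom := ho.isHom

end Algebra

section Hopf

variable [Fact (Function.Bijective (HopfAlgebra.antipode k (A := B)))]
  {X₀ : HopfOps k B V} (mX : Model X X₀.toOps)

/-- The Hopf monoid object modelled by a braided Hopf algebra. -/
@[reducible] noncomputable def hopfObj (h : X₀.IsHopf) : HopfObj X :=
  have hm := rel_mkHom (mX := mX.tensor mX) (mY := mX) h.isAlg.mul_isHom
  have ho := rel_mkHom (mX := unit k B) (mY := mX) h.isAlg.one_isHom
  have hd := rel_mkHom (mX := mX) (mY := mX.tensor mX) h.comul_isHom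
  have he := rel_mkHom (mX := mX) (mY := unit k B) h.counit_isHom
  have hs := rel_mkHom (mX := mX) (mY := mX) h.antipode_isHom
  { mX.monObj h.isAlg with
    comul := mkHom mX (mX.tensor mX) h.comul_isHom
    counit := mkHom mX (unit k B) h.counit_isHom
    counit_comul := (hd.comp (he.whiskerRight mX)).eq (Rel.lid_inv mX) (LinearMap.ext fun x => by
      apply (TensorProduct.lid k V).injective
      simp [h.counit_left])
    comul_counit := (hd.comp (he.whiskerLeft mX)).eq (Rel.rid_inv mX) (LinearMap.ext fun x => by
      apply (TensorProduct.rid k V).injective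
      simp [h.counit_right])
    comul_assoc := (hd.comp (hd.whiskerLeft mX)).eq
      (hd.comp ((hd.whiskerRight mX).comp (Rel.assoc mX mX mX))) (LinearMap.ext fun x => by
        simp [h.coassoc])
    mul_comul := by
      have h₁ := (hd.tensorHom hd).comp (Rel.twistedMul hm hm (Rel.braiding mX mX))
      have h₂ := (hm.comp hd).eq h₁ (TensorProduct.ext' fun x y => by
        exact h.comul_mul x y)
      rwa [twistedMul_braiding] at h₂
    one_comul := (ho.comp hd).eq (Rel.tensorOne ho ho) (by ext; simp [h.comul_one])
    mul_counit := (hm.comp he).eq ((he.tensorHom he).comp (Rel.lid (unit k B)))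
      (TensorProduct.ext' fun x y => by simp [h.counit_mul])
    one_counit := (ho.comp he).eq Rel.id (by ext; simp [h.counit_one])
    antipode := mkHom mX mX h.antipode_isHom
    antipode_left := (hd.comp ((hs.whiskerRight mX).comp hm)).eq (he.comp ho)
      (LinearMap.ext fun x => by simp [h.antipode_left])
    antipode_right := (hd.comp ((hs.whiskerLeft mX).comp hm)).eq (he.comp ho)
      (LinearMap.ext fun x => by simp [h.antipode_right]) }

end Hopf

end Model

end Translation

end BraidedDuality

/-! ### The Hopf pairing of the dual -/

namespace BraidedDuality

section DualPairing

open TensorProduct Coalgebra CategoryTheory MonoidalCategory YDModule MonObj ComonObj HopfObj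

universe u v w

variable {k : Type u} {B : Type v} [Field k] [Ring B] [HopfAlgebra k B]

namespace Model

section Exists

variable {V W : Type*} [AddCommMonoid V] [Module k V] [AddCommMonoid W] [Module k W]
  {X Y : YDModule.{u, v, w} k B} {X₀ : Ops k B V} {Y₀ : Ops k B W}

/-- A Yetter–Drinfeld module as a model of itself. -/
def self (X : YDModule.{u, v, w} k B) : Model X X.ops := ⟨.refl k _, IsHom.id _⟩

/-- Every morphism is modelled by a linear map. -/
lemma exists_rel (mX : Model X X₀) (mY : Model Y Y₀) (f : X ⟶ Y) :
    ∃ f₀ : V →ₗ[k] W, Rel mX mY f f₀ :=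
  ⟨mY.e.symm.toLinearMap ∘ₗ f.lin ∘ₗ mX.e.toLinearMap, fun v => by simp⟩

end Exists

variable [hB : Fact (Function.Bijective (HopfAlgebra.antipode k (A := B)))]
  {H : Type*} [AddCommGroup H] [Module k H] {𝓗 : HopfOps k B H}
  {U : Submodule k (Module.Dual k H)} {X Y : YDModule.{u, v, w} k B}
  (mX : Model X 𝓗.toOps) (mY : Model Y (dualOps 𝓗.toOps U))

variable {mX mY} in
lemma Rel.evTwo {e : Y ⊗ X ⟶ 𝟙_ _} (he : Rel (mY.tensor mX) (unit k B) e (ev U)) :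
    Rel ((mY.tensor mY).tensor (mX.tensor mX)) (unit k B) (evTwo e) (evPair 𝓗.toOps U) := by
  have h := (Rel.middle mY mX (Rel.braiding mY mX)).comp
    ((he.tensorHom he).comp (Rel.lid (unit k B)))
  have h' : (TensorProduct.lid k k).toLinearMap = LinearMap.mul' k k := by ext; simp
  rw [h', Category.assoc, Category.assoc] at h
  exact h

/-- The Hopf pairing of a Hopf subalgebra of the finite dual with the Hopf algebra. It is
nondegenerate because the elements of `H` separate the points of `M ⊗ U`, see `contract_ext`. -/
noncomputable def hopfPairing (h𝓗 : 𝓗.IsHopf) (hS : Function.Bijective 𝓗.antipode)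
    (hU : IsHopfSubalgebra 𝓗 U) (hHH : IsSymmetricPair 𝓗.toOps 𝓗.toOps)
    (hHU : IsSymmetricPair 𝓗.toOps (dualOps 𝓗.toOps U))
    (hUH : IsSymmetricPair (dualOps 𝓗.toOps U) 𝓗.toOps)
    (hUU : IsSymmetricPair (dualOps 𝓗.toOps U) (dualOps 𝓗.toOps U)) :
    letI := mX.hopfObj h𝓗
    HopfPairing X Y :=
  letI := mX.hopfObj h𝓗
  have he := rel_mkHom (mX := mY.tensor mX) (mY := unit k B)
    (isHom_ev hB.out h𝓗.isAlg.isYD hU.isSub)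
  have hm := rel_mkHom (mX := mY.tensor mY) (mY := mY) (isHom_dual_mul hB.out h𝓗 hU)
  have ho := rel_mkHom (mX := unit k B) (mY := mY) (isHom_dual_one hB.out h𝓗 hU)
  have hd := rel_mkHom (mX := mY) (mY := mY.tensor mY) (isHom_dual_comul hB.out h𝓗 hU)
  have hs := rel_mkHom (mX := mY) (mY := mY) (isHom_dual_antipode hB.out h𝓗 hU)
  have hi : IsHom 𝓗.toOps 𝓗.toOps (LinearEquiv.ofBijective 𝓗.antipode hS).symm.toLinearMap :=
    IsHom.symm (e := LinearEquiv.ofBijective 𝓗.antipode hS) h𝓗.antipode_isHom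
  have hS' : Rel mX mX 𝒮[X] 𝓗.antipode := rel_mkHom h𝓗.antipode_isHom
  { ev := mkHom (mY.tensor mX) (unit k B) (isHom_ev hB.out h𝓗.isAlg.isYD hU.isSub)
    mul := mkHom (mY.tensor mY) mY (isHom_dual_mul hB.out h𝓗 hU)
    one := mkHom (unit k B) mY (isHom_dual_one hB.out h𝓗 hU)
    comul := mkHom mY (mY.tensor mY) (isHom_dual_comul hB.out h𝓗 hU)
    antipode := mkHom mY mY (isHom_dual_antipode hB.out h𝓗 hU)
    antipodeInv := mkHom mX mX hi
    antipodeInv_antipode := ((rel_mkHom hi).comp hS').eq Rel.id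
      (LinearMap.ext (LinearEquiv.ofBijective 𝓗.antipode hS).apply_symm_apply)
    antipode_antipodeInv := (hS'.comp (rel_mkHom hi)).eq Rel.id
      (LinearMap.ext (LinearEquiv.ofBijective 𝓗.antipode hS).symm_apply_apply)
    symm_HH := ((Rel.braiding mX mX).comp (Rel.braiding mX mX)).eq Rel.id hHH
    symm_HU := ((Rel.braiding mX mY).comp (Rel.braiding mY mX)).eq Rel.id hHU
    symm_UH := ((Rel.braiding mY mX).comp (Rel.braiding mX mY)).eq Rel.id hUH
    symm_UU := ((Rel.braiding mY mY).comp (Rel.braiding mY mY)).eq Rel.id hUU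
    mul_ev := by
      have hΔ : Rel mX (mX.tensor mX) Δ[X] 𝓗.comul := rel_mkHom h𝓗.comul_isHom
      exact ((hm.whiskerRight mX).comp he).eq ((hΔ.whiskerLeft (mY.tensor mY)).comp he.evTwo)
        (TensorProduct.ext' fun t x => (ev_tmul _ _).trans (dualHopfOps_mul hU t x))
    one_ev := by
      have hε : Rel mX (unit k B) ε[X] 𝓗.counit := rel_mkHom h𝓗.counit_isHom
      exact ((ho.whiskerRight mX).comp he).eq ((Rel.lid mX).comp hε)
        (TensorProduct.ext' fun c x => by
          simp [ev_tmul, dualHopfOps_one hU])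
    comul_ev := by
      have hμ : Rel (mX.tensor mX) mX μ[X] 𝓗.mul := rel_mkHom h𝓗.isAlg.mul_isHom
      exact ((hd.whiskerRight (mX.tensor mX)).comp he.evTwo).eq ((hμ.whiskerLeft mY).comp he)
        (TensorProduct.ext' fun f z => (dualHopfOps_comul hB.out h𝓗 hU f z).trans
          (ev_tmul _ _).symm)
    antipode_ev := ((hs.whiskerRight mX).comp he).eq ((hS'.whiskerLeft mY).comp he)
      (TensorProduct.ext' fun f x => by
        simp [ev_tmul, dualHopfOps_antipode hU])
    nondeg := fun {S T} f g h => by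
      obtain ⟨f₀, hf⟩ := exists_rel (self S) ((self T).tensor mY) f
      obtain ⟨g₀, hg⟩ := exists_rel (self S) ((self T).tensor mY) g
      refine hf.eq hg (LinearMap.ext fun s => contract_ext fun x => ?_)
      have key {f : S ⟶ T ⊗ Y} {f₀ : S.carrier →ₗ[k] T.carrier ⊗[k] U}
          (hf : Rel (self S) ((self T).tensor mY) f f₀) :=
        (hf.whiskerRight mX).comp ((Rel.assoc (self T) mY mX).comp
          ((he.whiskerLeft (self T)).comp (Rel.rid (self T))))
      have h₁ := (key hf).eq_lin (key hg) (by
        simp only [← Category.assoc] at h ⊢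
        rw [h])
      have h₂ := LinearMap.congr_fun h₁ (s ⊗ₜ x)
      simpa [rid_ev_assoc] using h₂ }

end Model

end DualPairing

end BraidedDuality

/-! ### Translation of the smash products -/

namespace BraidedDuality

section ArrowForms

open CategoryTheory MonoidalCategory MonObj ComonObj HopfObj

local infixr:70 " ⊠ " => MonoidalCategoryStruct.tensorObj

variable {C : Type*} [Category* C] [MonoidalCategory C] [BraidedCategory C]
  {H U : C} [HopfObj H] (P : HopfPairing H U)

/-- The action `⇀` with the letters in the order `x₁ ⊗ f ⊗ x₂`, where `f` is braided past `x₁`. -/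
theorem HopfPairing.arrow_eq : U ◁ Δ[H] ≫ squareT (β_ U H).hom H ≫ H ◁ P.ev ≫ (ρ_ H).hom =
    P.arrow := by
  calc _ = 𝟙 _ ⊗≫ (U ◁ splitT Δ[H] (𝟙_ C) ≫ swapT U H (H ⊠ 𝟙_ C) ≫ H ◁ capT P.ev (𝟙_ C)) ⊗≫
        𝟙 _ := by
        simp only [swapT, squareT, splitT, capT]; monoidal
    _ = _ := by
        rw [P.cap_swap]
        simp only [HopfPairing.arrow, comulOp, swapT, squareT, splitT, capT]; monoidal

end ArrowForms

section Representation

open TensorProduct Coalgebra CategoryTheory MonoidalCategory YDModule MonObj ComonObj HopfObj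

universe u v w

variable {k : Type u} {B : Type v} [Field k] [Ring B] [HopfAlgebra k B]

lemma AlgOps.Isomorphic.symm {V W : Type*} [AddCommMonoid V] [Module k V] [AddCommMonoid W]
    [Module k W] {X : AlgOps k B V} {Y : AlgOps k B W} (h : X.Isomorphic Y) : Y.Isomorphic X := by
  obtain ⟨hX, hY, e, he, hm, ho⟩ := h
  refine ⟨hY, hX, e.symm, he.symm, fun x y => e.injective ?_, e.injective ?_⟩
  · simp [hm]
  · simp [ho]

namespace Model

/-- Algebras that model isomorphic monoid objects are isomorphic. -/
lemma isomorphic_of_rel {V W : Type*} [AddCommMonoid V] [Module k V] [AddCommMonoid W]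
    [Module k W] {X₀ : AlgOps k B V} {Y₀ : AlgOps k B W} {X Y : YDModule.{u, v, w} k B}
    {mX : Model X X₀.toOps} {mY : Model Y Y₀.toOps} [MonObj X] [MonObj Y]
    (hm : Rel (mX.tensor mX) mX μ[X] X₀.mul)
    (ho : Rel (unit k B) mX η[X] (LinearMap.toSpanSingleton k V X₀.one))
    (hm' : Rel (mY.tensor mY) mY μ[Y] Y₀.mul)
    (ho' : Rel (unit k B) mY η[Y] (LinearMap.toSpanSingleton k W Y₀.one)) (e : X ≅ Y)
    (hmul : μ[X] ≫ e.hom = (e.hom ⊗ₘ e.hom) ≫ μ[Y]) (hone : η[X] ≫ e.hom = η[Y]) :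
    X₀.Isomorphic Y₀ := by
  obtain ⟨f, hf⟩ := exists_rel mX mY e.hom
  obtain ⟨g, hg⟩ := exists_rel mY mX e.inv
  have h₁ : g ∘ₗ f = LinearMap.id := (hf.comp hg).eq_lin Rel.id e.hom_inv_id
  have h₂ : f ∘ₗ g = LinearMap.id := (hg.comp hf).eq_lin Rel.id e.inv_hom_id
  refine ⟨isAlg_of_rel hm ho, isAlg_of_rel hm' ho', LinearEquiv.ofLinearMap f g h₂ h₁, hf.isHom,
    fun x y => ?_, ?_⟩
  · exact LinearMap.congr_fun ((hm.comp hf).eq_lin ((hf.tensorHom hf).comp hm') hmul) (x ⊗ₜ y)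
  · simpa using LinearMap.congr_fun ((ho.comp hf).eq_lin ho' hone) 1

variable [hB : Fact (Function.Bijective (HopfAlgebra.antipode k (A := B)))]
  {H : Type*} [AddCommGroup H] [Module k H] {𝓗 : HopfOps k B H}
  {U : Submodule k (Module.Dual k H)} {X Y : YDModule.{u, v, w} k B}

/-- The structure of the Hopf pairing `P` is modelled by the Hopf algebra `𝓗` and the space `U` of
functionals on it. -/
structure Represents (mX : Model X 𝓗.toOps) (mY : Model Y (dualOps 𝓗.toOps U)) [HopfObj X]
    (P : HopfPairing X Y) : Prop where
  mulH : Rel (mX.tensor mX) mX μ[X] 𝓗.mul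
  oneH : Rel (unit k B) mX η[X] (LinearMap.toSpanSingleton k H 𝓗.one)
  comulH : Rel mX (mX.tensor mX) Δ[X] 𝓗.comul
  ev : Rel (mY.tensor mX) (unit k B) P.ev (ev U)
  mulU : Rel (mY.tensor mY) mY P.mul (dualHopfOps 𝓗 U).mul
  oneU : Rel (unit k B) mY P.one (LinearMap.toSpanSingleton k U (dualHopfOps 𝓗 U).one)
  comulU : Rel mY (mY.tensor mY) P.comul (dualHopfOps 𝓗 U).comul

namespace Represents

variable {mX : Model X 𝓗.toOps} {mY : Model Y (dualOps 𝓗.toOps U)} [HopfObj X]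
  {P : HopfPairing X Y}

lemma arrow (hP : Represents mX mY P) : Rel (mY.tensor mX) mX P.arrow (arrow 𝓗 U) := by
  have h := (hP.comulH.whiskerLeft mY).comp (((Rel.assoc_inv mY mX mX).comp
    (((Rel.braiding mY mX).whiskerRight mX).comp (Rel.assoc mX mY mX))).comp
      ((hP.ev.whiskerLeft mX).comp (Rel.rid mX)))
  rw [← P.arrow_eq]
  exact h

lemma counit (hP : Represents mX mY P) : Rel mY (unit k B) P.counit (dualHopfOps 𝓗 U).counit :=
  ((Rel.rid_inv mY).comp ((hP.oneH.whiskerLeft mY).comp hP.ev)).congr (by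
    ext f
    simp [BraidedDuality.ev]
    rfl)

lemma lamMap (hP : Represents mX mY P) : Rel ((mX.tensor mY).tensor mX) mX P.lamMap
    (𝓗.mul ∘ₗ (BraidedDuality.arrow 𝓗 U).lTensor H ∘ₗ (TensorProduct.assoc k H U H).toLinearMap) :=
  (Rel.assoc mX mY mX).comp ((hP.arrow.whiskerLeft mX).comp hP.mulH)

lemma rhoMap (hP : Represents mX mY P) : Rel (mY.tensor mX) mX P.rhoMap
    ((TensorProduct.lid k H).toLinearMap ∘ₗ (BraidedDuality.ev U).rTensor H ∘ₗ
      (TensorProduct.assoc k U H H).symm.toLinearMap ∘ₗ 𝓗.comul.lTensor U) :=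
  (hP.comulH.whiskerLeft mY).comp ((Rel.assoc_inv mY mX mX).comp
    ((hP.ev.whiskerRight mX).comp (Rel.lid mX)))

lemma smashHU_mul (hP : Represents mX mY P) :
    Rel ((mX.tensor mY).tensor (mX.tensor mY)) (mX.tensor mY) (twistedMul μ[X] P.mul
      (smashTwistMap P.comul P.arrow)) (smashHU 𝓗 U).mul :=
  hP.mulH.twistedMul hP.mulU (Rel.smashTwistMap hP.comulU hP.arrow)

lemma smashHU_one (hP : Represents mX mY P) : Rel (unit k B) (mX.tensor mY) (tensorOne η[X] P.one)
    (LinearMap.toSpanSingleton k (H ⊗[k] U) (smashHU 𝓗 U).one) := hP.oneH.tensorOne hP.oneU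

end Represents

end Model

end Representation

end BraidedDuality

/-! ### The duality theorem for the finite dual -/

namespace BraidedDuality

section Conclusion

open TensorProduct Coalgebra CategoryTheory MonoidalCategory YDModule MonObj ComonObj HopfObj

universe u v w x y

variable {k : Type u} {B : Type v} [Field k] [Ring B] [HopfAlgebra k B]

lemma braiding_one {V W : Type*} [AddCommMonoid V] [Module k V] [AddCommMonoid W] [Module k W]
    {X : AlgOps k B V} {Y : Ops k B W} (hX : IsHom (unitOps k B) X.toOps
      (LinearMap.toSpanSingleton k V X.one)) (hY : Y.IsYD) (w : W) :
    braiding X.toOps Y (X.one ⊗ₜ w) = w ⊗ₜ X.one := by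
  have h := hX.coact_apply 1
  simp only [LinearMap.toSpanSingleton_apply, one_smul, unitOps_coact, LinearMap.lTensor_tmul] at h
  rw [braiding_tmul, h]
  simp [hY.one_act]

/-- `ρ(f # 1)(x) = ⟨f, x₁⟩ x₂`. -/
lemma rho_one {H : Type*} [AddCommGroup H] [Module k H] {𝓗 : HopfOps k B H} (h𝓗 : 𝓗.IsHopf)
    (U : Submodule k (Module.Dual k H)) (f : U) (x : H) : rho 𝓗 U (f ⊗ₜ 𝓗.one) x =
      TensorProduct.lid k H ((ev U).rTensor H ((TensorProduct.assoc k U H H).symm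
        (f ⊗ₜ 𝓗.comul x))) := by
  have hb (y : H) := braiding_one h𝓗.isAlg.one_isHom h𝓗.isAlg.isYD y
  have h (t : H ⊗[k] H) : TensorProduct.lid k H (TensorProduct.map (ev U)
      (𝓗.mul ∘ₗ braiding 𝓗.toOps 𝓗.toOps) (middle (braiding 𝓗.toOps 𝓗.toOps)
        ((f ⊗ₜ 𝓗.one) ⊗ₜ t))) = TensorProduct.lid k H ((ev U).rTensor H
          ((TensorProduct.assoc k U H H).symm (f ⊗ₜ t))) := by
    induction t with
    | zero => simp
    | add s t hs ht => simp only [map_add, tmul_add, hs, ht]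
    | tmul y z => simp [middle, hb, h𝓗.isAlg.mul_one]
  exact h (𝓗.comul x)

/-- If `H` is quantum cocommutative, then the formula `hP` for `⇀` becomes `f ⇀ x = ⟨f, x₁⟩ x₂`, so
that `ρ(f # 1) = λ(1 # f)`. -/
lemma quantumCocommutative_rLCondition {H : Type*} [AddCommGroup H] [Module k H]
    {𝓗 : HopfOps k B H} (h𝓗 : 𝓗.IsHopf) {U : Submodule k (Module.Dual k H)}
    (hP : ∀ f x, arrow 𝓗 U (f ⊗ₜ x) = TensorProduct.lid k H ((ev U).rTensor H
      ((TensorProduct.assoc k U H H).symm (f ⊗ₜ braiding 𝓗.toOps 𝓗.toOps (𝓗.comul x)))))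
    (hQC : 𝓗.QuantumCocommutative) : RLCondition 𝓗 U := by
  refine fun f => ⟨𝓗.one ⊗ₜ f, LinearMap.ext fun x => ?_⟩
  have h : braiding 𝓗.toOps 𝓗.toOps (𝓗.comul x) = 𝓗.comul x := LinearMap.congr_fun hQC x
  have h' := hP f x
  rw [h] at h'
  rw [rho_one h𝓗, ← h']
  simp [lam, h𝓗.isAlg.one_mul]

namespace Model

variable [hB : Fact (Function.Bijective (HopfAlgebra.antipode k (A := B)))]
  {H : Type*} [AddCommGroup H] [Module k H] {𝓗 : HopfOps k B H}
  {U : Submodule k (Module.Dual k H)} {X Y Z : YDModule.{u, v, w} k B}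
  {mX : Model X 𝓗.toOps} {mY : Model Y (dualOps 𝓗.toOps U)}

namespace Represents

section RL

variable [HopfObj X] {P : HopfPairing X Y}

lemma arrow_apply (hP : Represents mX mY P) (f : U) (x : H) : BraidedDuality.arrow 𝓗 U (f ⊗ₜ x) =
    TensorProduct.lid k H ((BraidedDuality.ev U).rTensor H
      ((TensorProduct.assoc k U H H).symm (f ⊗ₜ braiding 𝓗.toOps 𝓗.toOps (𝓗.comul x)))) := by
  have h : Rel (mY.tensor mX) mX P.arrow _ :=
    ((hP.comulH.comp (Rel.braiding mX mX)).whiskerLeft mY).comp ((Rel.assoc_inv mY mX mX).comp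
      ((hP.ev.whiskerRight mX).comp (Rel.lid mX)))
  exact LinearMap.congr_fun (hP.arrow.eq_lin h rfl) (f ⊗ₜ x)

/-- An element of `H # U` is recovered from its image under `λ` by means of `s`, the inverse of the
antipode of `H`. -/
lemma exists_contract_eq (hP : Represents mX mY P) : ∃ s : H →ₗ[k] H,
    IsHom 𝓗.toOps 𝓗.toOps s ∧ ∀ (t : H ⊗[k] U) (x : H), contract U H x t =
      𝓗.mul (s.lTensor H ((lam 𝓗 U t).rTensor H
        (braiding 𝓗.toOps 𝓗.toOps (𝓗.comul x)))) := by
  obtain ⟨s, hs⟩ := exists_rel mX mX P.antipodeInv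
  refine ⟨s, hs.isHom, fun t x => ?_⟩
  have h := (((hP.comulH.comp (Rel.braiding mX mX)).whiskerLeft (mX.tensor mY)).comp
    ((Rel.assoc_inv (mX.tensor mY) mX mX).comp ((hP.lamMap.whiskerRight mX).comp
      ((hs.whiskerLeft mX).comp (hP.mulH.comp (Rel.rid_inv mX)))))).eq_lin
    ((Rel.assoc mX mY mX).comp (hP.ev.whiskerLeft mX)) P.lamMap_eq
  have h₁ := congrArg (TensorProduct.rid k H) (LinearMap.congr_fun h (t ⊗ₜ x))
  have h₂ (z : H ⊗[k] H) : (𝓗.mul ∘ₗ (BraidedDuality.arrow 𝓗 U).lTensor H ∘ₗ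
      (TensorProduct.assoc k H U H).toLinearMap).rTensor H
        ((TensorProduct.assoc k (H ⊗[k] U) H H).symm (t ⊗ₜ z)) = (lam 𝓗 U t).rTensor H z := by
    induction z with
    | zero => simp
    | add s t hs ht => simp only [map_add, tmul_add, hs, ht]
    | tmul y z => simp [lam]
  simp only [LinearMap.comp_apply, LinearEquiv.coe_coe, LinearMap.lTensor_tmul,
    LinearEquiv.apply_symm_apply, h₂, rid_ev_assoc] at h₁
  exact h₁.symm

/-- Under the `RL`-condition there is a unique map `j : U → H # U` with `λ (j f) = ρ (f # 1)`, as
`λ` is injective. It is a morphism because its pairing with `H` is one. -/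
theorem exists_hom_of_rLCondition (hP : Represents mX mY P) (h𝓗 : 𝓗.IsHopf)
    (hU : IsYDSubobject 𝓗.toOps U) (hRL : RLCondition 𝓗 U) :
    ∃ j : Y ⟶ X ⊗ Y, j ▷ X ≫ P.lamMap = P.rhoMap := by
  obtain ⟨s, hs, hst⟩ := hP.exists_contract_eq
  have hinj : Function.Injective (lam 𝓗 U) := fun t t' h => contract_ext fun x => by
    rw [hst, hst, h]
  let j : U →ₗ[k] H ⊗[k] U := leftInv (lam 𝓗 U) ∘ₗ rho 𝓗 U ∘ₗ
    (TensorProduct.mk k U H).flip 𝓗.one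
  have hj (f : U) : lam 𝓗 U (j f) = rho 𝓗 U (f ⊗ₜ 𝓗.one) := by
    obtain ⟨t, ht⟩ := hRL f
    have : j f = leftInv (lam 𝓗 U) (rho 𝓗 U (f ⊗ₜ 𝓗.one)) := rfl
    rw [this, ← ht, leftInv_apply hinj]
  have hG := ((hP.comulH.comp (Rel.braiding mX mX)).whiskerLeft mY).comp
    ((Rel.assoc_inv mY mX mX).comp ((hP.rhoMap.whiskerRight mX).comp
      (((rel_mkHom hs).whiskerLeft mX).comp hP.mulH)))
  have hjHom : IsHom (dualOps 𝓗.toOps U) (𝓗.toOps.tensor (dualOps 𝓗.toOps U)) j := by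
    refine isHom_of_pairing hB.out h𝓗.isAlg.isYD hU hG.isHom fun f x => ?_
    have h (z : H ⊗[k] H) : (rho 𝓗 U (f ⊗ₜ 𝓗.one)).rTensor H z =
        ((TensorProduct.lid k H).toLinearMap ∘ₗ
    (BraidedDuality.ev U).rTensor H ∘ₗ (TensorProduct.assoc k U H H).symm.toLinearMap ∘ₗ
      𝓗.comul.lTensor U).rTensor H ((TensorProduct.assoc k U H H).symm (f ⊗ₜ z)) := by
      induction z with
      | zero => simp
      | add s t hs ht => simp only [map_add, tmul_add, hs, ht]
      | tmul y z => simp [rho_one h𝓗]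
    rw [hst, hj, h]
    rfl
  refine ⟨mkHom mY (mX.tensor mY) hjHom, ?_⟩
  refine (((rel_mkHom hjHom).whiskerRight mX).comp hP.lamMap).eq hP.rhoMap
    (TensorProduct.ext' fun f x => ?_)
  have h : lam 𝓗 U (j f) x = rho 𝓗 U (f ⊗ₜ 𝓗.one) x := by rw [hj]
  rw [rho_one h𝓗] at h
  exact h

lemma arrowExt {R : Type*} [AddCommGroup R] [Module k R] {𝓡 : AlgOps k B R}
    (hP : Represents mX mY P) (mZ : Model Z 𝓡.toOps) :
    Rel (mY.tensor (mZ.tensor mX)) (mZ.tensor mX) (P.arrowExt Z) (actRH 𝓗 U 𝓡) :=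
  ((Rel.assoc_inv mY mZ mX).comp (((Rel.braiding mY mZ).whiskerRight mX).comp
    (Rel.assoc mZ mY mX))).comp (hP.arrow.whiskerLeft mZ)

end RL

section ComoduleAlgebra

variable {R : Type*} [AddCommGroup R] [Module k R] {𝓡 : AlgOps k B R} {ψ : R →ₗ[k] R ⊗[k] U}
  {mZ : Model Z 𝓡.toOps} [HopfObj X] {P : HopfPairing X Y} [MonObj Z]

/-- The comodule algebra over a Hopf pairing modelled by `ψ`. -/
noncomputable def comoduleAlgebra (hP : Represents mX mY P)
    (hψ : IsComoduleAlgebra 𝓡 (dualHopfOps 𝓗 U) ψ)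
    (hm : Rel (mZ.tensor mZ) mZ μ[Z] 𝓡.mul)
    (ho : Rel (unit k B) mZ η[Z] (LinearMap.toSpanSingleton k R 𝓡.one)) :
    ComoduleAlgebra P Z :=
  have hc := rel_mkHom (mX := mZ) (mY := mZ.tensor mY) hψ.isHom
  { coact := mkHom mZ (mZ.tensor mY) hψ.isHom
    coassoc := (hc.comp ((hc.whiskerRight mY).comp (Rel.assoc mZ mY mY))).eq
      (hc.comp (hP.comulU.whiskerLeft mZ)) (LinearMap.ext hψ.coassoc)
    counit := (hc.comp ((hP.counit.whiskerLeft mZ).comp (Rel.rid mZ))).eq Rel.id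
      (LinearMap.ext hψ.counit)
    map_mul := (hm.comp hc).eq ((hc.tensorHom hc).comp
      (Rel.twistedMul hm hP.mulU (Rel.braiding mY mZ)))
      (TensorProduct.ext' fun r s => hψ.map_mul r s)
    map_one := (ho.comp hc).eq (Rel.tensorOne ho hP.oneU) (by ext; simp [hψ.map_one]) }

variable {Q : ComoduleAlgebra P Z}

lemma act (hP : Represents mX mY P) (hQ : Rel mZ (mZ.tensor mY) Q.coact ψ) :
    Rel (mX.tensor mZ) mZ Q.act (inducedAct 𝓗 U 𝓡 ψ) :=
  (hQ.whiskerLeft mX).comp (((Rel.assoc_inv mX mZ mY).comp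
    (((Rel.braiding mX mZ).whiskerRight mY).comp (Rel.assoc mZ mX mY))).comp
      ((((Rel.braiding mX mY).comp hP.ev).whiskerLeft mZ).comp (Rel.rid mZ)))

lemma iterSmashMul (hP : Represents mX mY P) (hQ : Rel mZ (mZ.tensor mY) Q.coact ψ)
    (hm : Rel (mZ.tensor mZ) mZ μ[Z] 𝓡.mul) :
    Rel (((mZ.tensor mX).tensor mY).tensor ((mZ.tensor mX).tensor mY))
      ((mZ.tensor mX).tensor mY) Q.iterSmashMul (smashRHU 𝓗 U 𝓡 ψ).mul :=
  (hm.twistedMul hP.mulH (Rel.smashTwistMap hP.comulH (hP.act hQ))).twistedMul hP.mulU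
    (Rel.smashTwistMap hP.comulU (hP.arrowExt mZ))

lemma tensorSmashMul (hP : Represents mX mY P) (hm : Rel (mZ.tensor mZ) mZ μ[Z] 𝓡.mul) :
    Rel ((mZ.tensor (mX.tensor mY)).tensor (mZ.tensor (mX.tensor mY)))
      (mZ.tensor (mX.tensor mY)) (ComoduleAlgebra.tensorSmashMul P Z)
      (𝓡.tensorAlg (smashHU 𝓗 U)).mul :=
  hm.twistedMul hP.smashHU_mul (Rel.braiding (mX.tensor mY) mZ)

/-- A morphism `j` with `λ (j f) = ρ (f # 1)` makes `(R # H) # U` and `R ⊗ (H # U)` isomorphic. -/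
theorem isomorphic (hP : Represents mX mY P) (hQ : Rel mZ (mZ.tensor mY) Q.coact ψ)
    (hm : Rel (mZ.tensor mZ) mZ μ[Z] 𝓡.mul)
    (ho : Rel (unit k B) mZ η[Z] (LinearMap.toSpanSingleton k R 𝓡.one))
    {j : Y ⟶ X ⊗ Y} (hj : j ▷ X ≫ P.lamMap = P.rhoMap) :
    (smashRHU 𝓗 U 𝓡 ψ).Isomorphic (𝓡.tensorAlg (smashHU 𝓗 U)) := by
  let := ComoduleAlgebra.tensorSmashMonObj P Z
  let := Q.iterSmashMonObj hj
  refine AlgOps.Isomorphic.symm (isomorphic_of_rel (mX := mZ.tensor (mX.tensor mY))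
    (mY := (mZ.tensor mX).tensor mY) ?_ ?_ ?_ ?_ (Q.shearIso hj) ?_ ?_)
  · rw [ComoduleAlgebra.tensorSmashMonObj_mul]
    exact hP.tensorSmashMul hm
  · rw [ComoduleAlgebra.tensorSmashMonObj_one]
    exact ho.tensorOne hP.smashHU_one
  · rw [ComoduleAlgebra.iterSmashMonObj_mul]
    exact hP.iterSmashMul hQ hm
  · rw [ComoduleAlgebra.iterSmashMonObj_one]
    exact (ho.tensorOne hP.oneH).tensorOne hP.oneU
  · rw [ComoduleAlgebra.tensorSmashMonObj_mul, ComoduleAlgebra.iterSmashMonObj_mul]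
    exact Q.mul_shear hj
  · rw [ComoduleAlgebra.tensorSmashMonObj_one, ComoduleAlgebra.iterSmashMonObj_one]
    exact Q.one_shear hj

end ComoduleAlgebra

end Represents

variable (mX mY) in
lemma represents_hopfPairing (h𝓗 : 𝓗.IsHopf) (hS : Function.Bijective 𝓗.antipode)
    (hU : IsHopfSubalgebra 𝓗 U) (hHH : IsSymmetricPair 𝓗.toOps 𝓗.toOps)
    (hHU : IsSymmetricPair 𝓗.toOps (dualOps 𝓗.toOps U))
    (hUH : IsSymmetricPair (dualOps 𝓗.toOps U) 𝓗.toOps)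
    (hUU : IsSymmetricPair (dualOps 𝓗.toOps U) (dualOps 𝓗.toOps U)) :
    letI := mX.hopfObj h𝓗
    Represents mX mY (hopfPairing mX mY h𝓗 hS hU hHH hHU hUH hUU) :=
  letI := mX.hopfObj h𝓗
  { mulH := rel_mkHom _
    oneH := rel_mkHom _
    comulH := rel_mkHom _
    ev := rel_mkHom (isHom_ev hB.out h𝓗.isAlg.isYD hU.isSub)
    mulU := rel_mkHom (isHom_dual_mul hB.out h𝓗 hU)
    oneU := rel_mkHom (isHom_dual_one hB.out h𝓗 hU)
    comulU := rel_mkHom (isHom_dual_comul hB.out h𝓗 hU) }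

end Model

/-- The duality theorem under the `RL`-condition or quantum cocommutativity of `H`. -/
theorem isomorphic_of_rLCondition_or {k : Type u} {B : Type v} {H : Type x} {R : Type y} [Field k]
    [Ring B] [HopfAlgebra k B] (hB : Function.Bijective (HopfAlgebra.antipode k (A := B)))
    [AddCommGroup H] [Module k H] {𝓗 : HopfOps k B H} (h𝓗 : 𝓗.IsHopf)
    (hS : Function.Bijective 𝓗.antipode) {U : Submodule k (Module.Dual k H)}
    (hU : IsHopfSubalgebra 𝓗 U) (hHH : IsSymmetricPair 𝓗.toOps 𝓗.toOps)
    (hHU : IsSymmetricPair 𝓗.toOps (dualOps 𝓗.toOps U))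
    (hUH : IsSymmetricPair (dualOps 𝓗.toOps U) 𝓗.toOps)
    (hUU : IsSymmetricPair (dualOps 𝓗.toOps U) (dualOps 𝓗.toOps U))
    [AddCommGroup R] [Module k R] {𝓡 : AlgOps k B R} (h𝓡 : 𝓡.IsAlg)
    {ψ : R →ₗ[k] R ⊗[k] U} (hψ : IsComoduleAlgebra 𝓡 (dualHopfOps 𝓗 U) ψ)
    (h : RLCondition 𝓗 U ∨ 𝓗.QuantumCocommutative) :
    (smashRHU 𝓗 U 𝓡 ψ).Isomorphic (𝓡.tensorAlg (smashHU 𝓗 U)) := by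
  have : Fact (Function.Bijective (HopfAlgebra.antipode k (A := B))) := ⟨hB⟩
  -- lifts of `H`, `U` and `R` to one common universe
  let mX := Model.lift.{u, v, y, x} h𝓗.isAlg.isYD
  let mY := Model.lift.{u, v, y, max u x} (V := U) (X₀ := dualOps 𝓗.toOps U)
    (isYD_dualOps hB h𝓗.isAlg.isYD hU.isSub)
  let mZ := Model.lift.{u, v, x, y} h𝓡.isYD
  let := mX.hopfObj h𝓗
  let := mZ.monObj h𝓡
  have hP := Model.represents_hopfPairing mX mY h𝓗 hS hU hHH hHU hUH hUU
  have hRL : RLCondition 𝓗 U := h.elim id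
    (quantumCocommutative_rLCondition h𝓗 hP.arrow_apply)
  obtain ⟨j, hj⟩ := hP.exists_hom_of_rLCondition h𝓗 hU.isSub hRL
  have hm : Model.Rel (mZ.tensor mZ) mZ μ[YDModule.lift.{u, v, x, y} h𝓡.isYD] 𝓡.mul :=
    Model.rel_mkHom h𝓡.mul_isHom
  have ho : Model.Rel (Model.unit k B) mZ η[YDModule.lift.{u, v, x, y} h𝓡.isYD]
      (LinearMap.toSpanSingleton k R 𝓡.one) :=
    Model.rel_mkHom h𝓡.one_isHom
  exact hP.isomorphic (Q := hP.comoduleAlgebra hψ hm ho) (Model.rel_mkHom hψ.isHom) hm ho hj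

end Conclusion

end BraidedDuality

open BraidedDuality in
theorem theorem3p6 {k B H R : Type*} [Field k] [Ring B] [HopfAlgebra k B]
    (hB : Function.Bijective (HopfAlgebra.antipode k (A := B)))
    [AddCommGroup H] [Module k H] (𝓗 : HopfOps k B H) (h𝓗 : 𝓗.IsHopf)
    (hS : Function.Bijective 𝓗.antipode)
    (hHH : IsSymmetricPair 𝓗.toOps 𝓗.toOps)
    (hHD : IsSymmetricPair 𝓗.toOps (dualOps 𝓗.toOps (finiteDual 𝓗.toAlgOps)))
    (hDH : IsSymmetricPair (dualOps 𝓗.toOps (finiteDual 𝓗.toAlgOps)) 𝓗.toOps)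
    (hDD : IsSymmetricPair (dualOps 𝓗.toOps (finiteDual 𝓗.toAlgOps))
      (dualOps 𝓗.toOps (finiteDual 𝓗.toAlgOps)))
    (U : Submodule k (Module.Dual k H)) (hU : IsHopfSubalgebra 𝓗 U)
    [AddCommGroup R] [Module k R] (𝓡 : AlgOps k B R) (h𝓡 : 𝓡.IsAlg)
    (ψ : R →ₗ[k] R ⊗[k] U) (hψ : IsComoduleAlgebra 𝓡 (dualHopfOps 𝓗 U) ψ) :
    (RLCondition 𝓗 U →
      (smashRHU 𝓗 U 𝓡 ψ).Isomorphic (𝓡.tensorAlg (smashHU 𝓗 U))) ∧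
    (𝓗.QuantumCocommutative →
      (smashRHU 𝓗 U 𝓡 ψ).Isomorphic (𝓡.tensorAlg (smashHU 𝓗 U))) := by
  have hD := finiteDual_isYDSubobject 𝓗.toAlgOps
  have hi := isHom_inclusion hU.isSub hD hU.le_finiteDual
  have hi' := Submodule.inclusion_injective hU.le_finiteDual
  have hid := IsHom.id 𝓗.toOps
  have key := isomorphic_of_rLCondition_or hB h𝓗 hS hU hHH
    (.of_injective hid hi Function.injective_id hi' hHD)
    (.of_injective hi hid hi' Function.injective_id hDH)
    (.of_injective hi hi hi' hi' hDD) h𝓡 hψ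
  exact ⟨fun h => key (.inl h), fun h => key (.inr h)⟩
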